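/- Let $M$ be a connected (Hausdorff, second countable) $C^7$ manifold of dimension $n$, let $A\subset TM\setminus 0$ be open with $\pi(A)=M$ and $\lambda v\in A$ for all $v\in A$, $\lambda>0$, and let $L:A\to\mathbb R$ be a $C^6$ conic pseudo-Finsler metric: $L(\lambda v)=\lambda^2L(v)$ for $v\in A$, $\lambda>0$, and for every $v\in A$ the fundamental tensor $g_v(u,w)=\frac12\frac{\partial^2}{\partial t\,\partial s}L(v+tu+sw)|_{t=s=0}$ on $T_{\pi(v)}M$ is nondegenerate. Let $\Gamma^m_{ij}$ denote the Christoffel symbols of the Chern connection of $L$ in canonical coordinates $(x^i,y^i)$ of $TM$ (so $\Gamma^m_{ij}=\Gamma^m_{ji}$ and $\frac{\delta g_{ij}}{\delta x^k}=\sum_m(g_{mj}\Gamma^m_{ik}+g_{im}\Gamma^m_{jk})$, with $\frac{\delta}{\delta x^k}$ as below), and let $R_v$ $(v\in A)$ be its Chern ($hh$-) curvature tensor, with the sign convention $R_v(\xi,\eta)\zeta=\sum\xi^k\eta^l\zeta^jR_j{}^i{}_{kl}(v)\,\partial_{x^i}$, $R_j{}^i{}_{kl}=\frac{\delta\Gamma^i_{jl}}{\delta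 x^k}-\frac{\delta\Gamma^i_{jk}}{\delta x^l}+\sum_h(\Gamma^i_{hk}\Gamma^h_{jl}-\Gamma^i_{hl}\Gamma^h_{jk})$, where $\frac{\delta}{\delta x^k}=\frac{\partial}{\partial x^k}-\sum_iN^i_k\frac{\partial}{\partial y^i}$ and $N^j_i(v)=\sum_k\Gamma^j_{ik}(v)v^k$. Let $P\subset M$ be a connected embedded $C^7$ submanifold of dimension $k<n$, let $\tau>0$, and let $\gamma:[0,\tau]\to M$ be an $L$-geodesic, i.e. a $C^2$ curve with $\dot\gamma(t)\in A$ for all $t$ and $D\dot\gamma=0$, where for a vector field $\zeta$ along $\gamma$ $$D\zeta=D^{\dot\gamma}_{\dot\gamma}\zeta=\sum_m\Bigl(\dot\zeta^m+\sum_{i,j}\zeta^i\dot\gamma^j\,\Gamma^m_{ij}(\dot\gamma)\Bigr)\partial_{x^m}.$$ Assume that $\gamma(0)\in P$, that $g_{\dot\gamma(0)}(\dot\gamma(0),u)=0$ for all $u\in T_{\gamma(0)}P$, and that $g_{\dot\gamma(0)}$ is positive definite. Write $v=\dot\gamma(0)$, $p=\gamma(0)$ and $q=\gamma(\tau)$.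 Let $\mathrm{tan}^P_v:T_pM\to T_pP$ be the $g_v$-orthogonal projection, and let $\tilde S^P_v:T_pP\to T_pP$, $\tilde S^P_v(u)=\mathrm{tan}^P_v(\nabla^V_uV)$, be the normal second fundamental form (shape operator). Here $V$ is any $C^1$ vector field along $P$ near $p$ with $V(p)=v$ that takes values in $A$ and satisfies $g_{V(x)}(V(x),w)=0$ for all $w\in T_xP$ and $x\in P$ near $p$, and $\nabla^V$ is the Chern connection with reference field $V$. A $P$-Jacobi field is a $C^2$ vector field $J$ along $\gamma$ with $DDJ-R_{\dot\gamma}(\dot\gamma,J)\dot\gamma=0$ on $[0,\tau]$, $J(0)\in T_pP$ and $\mathrm{tan}^P_v((DJ)(0))=\tilde S^P_v(J(0))$; an instant $t_0\in(0,\tau]$ is $P$-focal if some $P$-Jacobi field $J\not\equiv0$ satisfies $J(t_0)=0$. Let $PC^2_{P\times q}(\gamma^*TM)$ be the space of continuous, piecewise $C^2$ vector fields $X$ along $\gamma$ with $X(0)\in T_pP$ and $X(\tau)=0$, and put $$\tilde{\mathbf I}^\gamma_{P,q}(X,Y)=\int_0^\tau\bigl(g_{\dot\gamma}(R_{\dot\gamma}(\dot\gamma,X)\dot\gamma,Y)+g_{\dot\gamma}(DX,DY)\bigr)\,dt+g_{v}\bigl(\tilde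 S^P_{v}(X(0)),Y(0)\bigr).$$ If no $t_0\in(0,\tau]$ is $P$-focal, then $\tilde{\mathbf I}^\gamma_{P,q}$ is positive definite on $PC^2_{P\times q}(\gamma^*TM)$: for every $X\in PC^2_{P\times q}(\gamma^*TM)$ the integrand of $\tilde{\mathbf I}^\gamma_{P,q}(X,X)$ is integrable on $[0,\tau]$, and $\tilde{\mathbf I}^\gamma_{P,q}(X,X)>0$ if $X\neq0$. -/

import Mathlib

open Set MeasureTheory
open scoped Manifold ContDiff Topology

noncomputable section

/-! ### The Chern connection of a function `ℓ(x, y)` on `ℝⁿ × ℝⁿ`, in coordinates -/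

namespace FinslerCoord

variable {n : ℕ}

/-- The model space `ℝⁿ`. -/
abbrev Vec (n : ℕ) : Type := EuclideanSpace ℝ (Fin n)

/-- The `m`-th standard basis vector. -/
def e (m : Fin n) : Vec n := EuclideanSpace.single m 1

/-- `∂f/∂xᵐ` at `z = (x, y)`. -/
def dX (m : Fin n) (f : Vec n × Vec n → ℝ) (z : Vec n × Vec n) : ℝ :=
  fderiv ℝ f z (e m, 0)

/-- `∂f/∂yᵐ` at `z = (x, y)`. -/
def dY (m : Fin n) (f : Vec n × Vec n → ℝ) (z : Vec n × Vec n) : ℝ :=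
  fderiv ℝ f z (0, e m)

variable (ℓ : Vec n × Vec n → ℝ)

/-- `g_{ij} = (1/2) ∂²ℓ/∂yⁱ∂yʲ`. -/
def gLow (i j : Fin n) (z : Vec n × Vec n) : ℝ := (1 / 2) * dY i (dY j ℓ) z

/-- `g^{ij}`, the entries of the inverse matrix. -/
def gUp (i j : Fin n) (z : Vec n × Vec n) : ℝ :=
  (Matrix.of fun a b : Fin n => gLow ℓ a b z)⁻¹ i j

/-- The Cartan tensor `C_{ijk} = (1/4) ∂³ℓ/∂yⁱ∂yʲ∂yᵏ`. -/
def cartan (i j k : Fin n) (z : Vec n × Vec n) : ℝ := (1 / 4) * dY i (dY j (dY k ℓ)) z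

/-- The formal Christoffel symbols `γⁱ_{jm}`. -/
def formalChristoffel (i j m : Fin n) (z : Vec n × Vec n) : ℝ :=
  (1 / 2) * ∑ s, gUp ℓ i s z *
    (dX m (gLow ℓ s j) z + dX j (gLow ℓ m s) z - dX s (gLow ℓ j m) z)

/-- `Cⁱ_{jm} = g^{il} C_{ljm}`. -/
def cartanUp (i j m : Fin n) (z : Vec n × Vec n) : ℝ := ∑ l, gUp ℓ i l z * cartan ℓ l j m z

/-- The nonlinear connection `Nⁱ_j`. -/
def nonlinear (i j : Fin n) (z : Vec n × Vec n) : ℝ :=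
  (∑ m, formalChristoffel ℓ i j m z * z.2 m) -
    ∑ m, ∑ r, ∑ s, cartanUp ℓ i j m z * formalChristoffel ℓ m r s z * z.2 r * z.2 s

/-- The Christoffel symbols `Γⁱ_{jk}` of the Chern connection. -/
def chernSymbol (i j k : Fin n) (z : Vec n × Vec n) : ℝ :=
  formalChristoffel ℓ i j k z - ∑ l, ∑ r, gUp ℓ l i z *
    (cartan ℓ j l r z * nonlinear ℓ r k z - cartan ℓ j k r z * nonlinear ℓ r l z
      + cartan ℓ l k r z * nonlinear ℓ r j z)

/-- The horizontal derivative `δf/δxᵏ = ∂f/∂xᵏ - Nⁱ_k ∂f/∂yⁱ`. -/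
def delta (k : Fin n) (f : Vec n × Vec n → ℝ) (z : Vec n × Vec n) : ℝ :=
  dX k f z - ∑ i, nonlinear ℓ i k z * dY i f z

/-- The components `R_j{}^i{}_{kl}` of the Chern (`hh`-) curvature. -/
def chernCurv (j i k l : Fin n) (z : Vec n × Vec n) : ℝ :=
  delta ℓ k (chernSymbol ℓ i j l) z - delta ℓ l (chernSymbol ℓ i j k) z
    + (∑ h, chernSymbol ℓ i h k z * chernSymbol ℓ h j l z)
    - ∑ h, chernSymbol ℓ i h l z * chernSymbol ℓ h j k z

end FinslerCoord

open FinslerCoord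

instance isManifold_one_of_seven {n : ℕ} {M : Type*} [TopologicalSpace M]
    [ChartedSpace (Vec n) M] [IsManifold (𝓡 n) 7 M] : IsManifold (𝓡 n) 1 M :=
  IsManifold.of_le (n := 7) (by norm_num)

/-- The canonical coordinates `(x, y)` on `TM` associated with the chart of `M` around `x₀`.
On `T_{x₀}M` itself the `y`-coordinates are those given by `tangentComp x₀` below. -/
abbrev tangentChart {n : ℕ} {M : Type*} [TopologicalSpace M] [ChartedSpace (Vec n) M]
    [IsManifold (𝓡 n) 7 M] (x₀ : M) :
    PartialEquiv (TangentBundle (𝓡 n) M) (Vec n × Vec n) :=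
  extChartAt (𝓡 n).tangent (⟨x₀, 0⟩ : TangentBundle (𝓡 n) M)

/-- The identification `T_xM = ℝⁿ` given by the chart around `x`: the components of a tangent vector
in the basis `∂/∂xⁱ` of that chart. -/
def tangentComp {n : ℕ} {M : Type*} [TopologicalSpace M] [ChartedSpace (Vec n) M] (x : M) :
    TangentSpace (𝓡 n) x ≃L[ℝ] Vec n where
  toFun v := v
  invFun v := v
  map_add' _ _ := rfl
  map_smul' _ _ := rfl
  left_inv _ := rfl
  right_inv _ := rfl
  continuous_toFun := continuous_id
  continuous_invFun := continuous_id

/-- The fundamental tensor `g_v(u, w) = (1/2) ∂²/∂t∂s L(v + t u + s w)|_{t = s = 0}`, i.e. one half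
of the second differential at `v` of the restriction of `L` to the tangent space containing `v`. -/
def fundamentalTensor {n : ℕ} {M : Type*} [TopologicalSpace M] [ChartedSpace (Vec n) M]
    (L : TangentBundle (𝓡 n) M → ℝ) (v : TangentBundle (𝓡 n) M)
    (u w : TangentSpace (𝓡 n) v.proj) : ℝ :=
  let Lx : Vec n → ℝ := fun y => L ⟨v.proj, (tangentComp v.proj).symm y⟩
  (1 / 2) * fderiv ℝ (fderiv ℝ Lx) (tangentComp v.proj v.2) (tangentComp v.proj u)
    (tangentComp v.proj w)

/-- A (conic) `C⁶` pseudo-Finsler metric `L : A → ℝ` on the `C⁷` manifold `M`, with domain the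
open conic set `A ⊆ TM \ 0` (the values of `L` outside `A` are irrelevant). -/
structure PseudoFinslerMetric (n : ℕ) (M : Type*) [TopologicalSpace M] [ChartedSpace (Vec n) M]
    [IsManifold (𝓡 n) 7 M] where
  A : Set (TangentBundle (𝓡 n) M)
  isOpen_A : IsOpen A
  ne_zero : ∀ v ∈ A, v.2 ≠ 0
  surj : ∀ x : M, ∃ v ∈ A, v.proj = x
  conic : ∀ v ∈ A, ∀ c : ℝ, 0 < c → (⟨v.proj, c • v.2⟩ : TangentBundle (𝓡 n) M) ∈ A
  L : TangentBundle (𝓡 n) M → ℝ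
  contMDiffOn_L : ContMDiffOn (𝓡 n).tangent 𝓘(ℝ, ℝ) 6 L A
  homogeneous : ∀ v ∈ A, ∀ c : ℝ, 0 < c → L ⟨v.proj, c • v.2⟩ = c ^ 2 * L v
  nondegenerate : ∀ v ∈ A, ∀ u : TangentSpace (𝓡 n) v.proj,
    (∀ w : TangentSpace (𝓡 n) v.proj, fundamentalTensor L v u w = 0) → u = 0

section Geometry

variable {n : ℕ} {M : Type*} [TopologicalSpace M] [ChartedSpace (Vec n) M]
  [IsManifold (𝓡 n) 7 M]

namespace PseudoFinslerMetric

variable (F : PseudoFinslerMetric n M)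

/-- The fundamental tensor `g_v` of the metric. -/
def g (v : TangentBundle (𝓡 n) M) (u w : TangentSpace (𝓡 n) v.proj) : ℝ :=
  fundamentalTensor F.L v u w

/-- `L` in the canonical coordinates given by the chart around `x₀`. -/
def localL (x₀ : M) (z : Vec n × Vec n) : ℝ := F.L ((tangentChart x₀).symm z)

/-- The bilinear map `(u, w) ↦ ∑ uⁱ wʲ Γᵐ_{ij}(v) ∂ₘ` in the chart around the base point of `v`. -/
def chernTerm (v : TangentBundle (𝓡 n) M) (u w : Vec n) : Vec n :=
  ∑ m, (∑ i, ∑ j, u i * w j *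
    chernSymbol (F.localL v.proj) m i j (tangentChart v.proj v)) • e m

/-- The Chern curvature tensor `R_v(ξ, η)ζ = ∑ ξᵏ ηˡ ζʲ R_j{}^i{}_{kl}(v) ∂ᵢ`. -/
def R (v : TangentBundle (𝓡 n) M) (ξ η ζ : TangentSpace (𝓡 n) v.proj) :
    TangentSpace (𝓡 n) v.proj :=
  (tangentComp v.proj).symm (∑ i, (∑ j, ∑ k, ∑ l,
    tangentComp v.proj ξ k * tangentComp v.proj η l * tangentComp v.proj ζ j *
    chernCurv (F.localL v.proj) j i k l (tangentChart v.proj v)) • e i)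

end PseudoFinslerMetric

/-! ### Curves on `[0, τ]` and vector fields along them

A curve `γ : [0, τ] → M` is the restriction to `[0, τ]` of a map `ℝ → M`, and likewise for fields
along it; only the values on `[0, τ]` matter, all derivatives being taken within `[0, τ]`. -/

/-- A vector field along `γ`, as a curve in `TM`. -/
def liftField (γ : ℝ → M) (X : ∀ t, TangentSpace (𝓡 n) (γ t)) (t : ℝ) :
    TangentBundle (𝓡 n) M := ⟨γ t, X t⟩

/-- The velocity `γ̇(t)`. -/
def velocity (τ : ℝ) (γ : ℝ → M) (t : ℝ) : TangentSpace (𝓡 n) (γ t) :=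
  mfderivWithin 𝓘(ℝ, ℝ) (𝓡 n) γ (Icc 0 τ) t (1 : ℝ)

/-- A field along `γ` which is `C^r` on `s`. -/
def IsCrField (r : ℕ) (γ : ℝ → M) (s : Set ℝ) (X : ∀ t, TangentSpace (𝓡 n) (γ t)) : Prop :=
  ContMDiffOn 𝓘(ℝ, ℝ) (𝓡 n).tangent r (liftField γ X) s

/-- Continuous and piecewise `C²` fields along `γ` on `[0, τ]`. -/
def IsPiecewiseC2Field (τ : ℝ) (γ : ℝ → M) (X : ∀ t, TangentSpace (𝓡 n) (γ t)) : Prop :=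
  ContinuousOn (liftField γ X) (Icc 0 τ) ∧
  ∃ (m : ℕ) (t : ℕ → ℝ), t 0 = 0 ∧ t m = τ ∧
    ∀ i < m, t i < t (i + 1) ∧ IsCrField 2 γ (Icc (t i) (t (i + 1))) X

/-- `TP` as a subset of `TM`, for a submanifold `P` of dimension `k` given by an embedding
`ι : P → M`. -/
def tangentSet (k : ℕ) {P : Type*} [TopologicalSpace P] [ChartedSpace (Vec k) P]
    (ι : P → M) : Set (TangentBundle (𝓡 n) M) :=
  range (tangentMap (𝓡 k) (𝓡 n) ι)

namespace PseudoFinslerMetric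

variable (F : PseudoFinslerMetric n M)

/-- The covariant derivative `D^ξ_{γ̇} ζ` along `γ` with reference vector `ξ`, computed at `t` in
the chart around `γ(t)`: `(D^ξ_{γ̇} ζ)ᵐ = (ζᵐ)' + ∑ ζⁱ γ̇ʲ Γᵐ_{ij}(γ, ξ)`. -/
def covDeriv (τ : ℝ) (γ : ℝ → M) (ξ ζ : ∀ t, TangentSpace (𝓡 n) (γ t)) (t : ℝ) :
    TangentSpace (𝓡 n) (γ t) :=
  (tangentComp (γ t)).symm
    (derivWithin (fun s => (tangentChart (γ t) (liftField γ ζ s)).2) (Icc 0 τ) t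
      + F.chernTerm ⟨γ t, ξ t⟩ (tangentComp (γ t) (ζ t)) (tangentComp (γ t) (velocity τ γ t)))

/-- `D^{γ̇}_{γ̇} ζ`. -/
def D (τ : ℝ) (γ : ℝ → M) (ζ : ∀ t, TangentSpace (𝓡 n) (γ t)) :
    ∀ t, TangentSpace (𝓡 n) (γ t) :=
  F.covDeriv τ γ (velocity τ γ) ζ

/-- `γ : [0, τ] → M` is an `L`-geodesic. -/
structure IsGeodesic (τ : ℝ) (γ : ℝ → M) : Prop where
  contMDiffOn : ContMDiffOn 𝓘(ℝ, ℝ) (𝓡 n) 2 γ (Icc 0 τ)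
  admissible : ∀ t ∈ Icc 0 τ, liftField γ (velocity τ γ) t ∈ F.A
  parallel : ∀ t ∈ Icc 0 τ, F.D τ γ (velocity τ γ) t = 0

/-- `C²` solutions of the Jacobi equation `D D J - R_{γ̇}(γ̇, J)γ̇ = 0` along `γ`. -/
structure IsJacobi (τ : ℝ) (γ : ℝ → M) (J : ∀ t, TangentSpace (𝓡 n) (γ t)) : Prop where
  smooth : IsCrField 2 γ (Icc 0 τ) J
  equation : ∀ t ∈ Icc 0 τ, F.D τ γ (F.D τ γ J) t
    - F.R ⟨γ t, velocity τ γ t⟩ (velocity τ γ t) (J t) (velocity τ γ t) = 0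

/-! ### The submanifold `P`, given by an embedding `ι : P → M` -/

variable (k : ℕ) {P : Type*} [TopologicalSpace P] [ChartedSpace (Vec k) P]
  (ι : P → M)

/-- The normal bundle `TP^⊥ = {v ∈ A | π(v) ∈ P, g_v(v, w) = 0 for all w ∈ T_{π(v)}P}`. -/
def normalBundle : Set (TangentBundle (𝓡 n) M) :=
  {v | v ∈ F.A ∧ v.proj ∈ range ι ∧
    ∀ w : TangentSpace (𝓡 n) v.proj, ⟨v.proj, w⟩ ∈ tangentSet k ι → F.g v v.2 w = 0}

/-- The tangential part `tan^P_v(z)`: the vector `w ∈ T_{π(v)}P` with `z - w` being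
`g_v`-orthogonal to `T_{π(v)}P`. It exists and is unique if `π(v) ∈ P` and `g_v` is nondegenerate
on `T_{π(v)}P`. -/
def tanPart (v : TangentBundle (𝓡 n) M) (z : TangentSpace (𝓡 n) v.proj) :
    TangentSpace (𝓡 n) v.proj :=
  Classical.epsilon fun w => ⟨v.proj, w⟩ ∈ tangentSet k ι ∧
    ∀ u : TangentSpace (𝓡 n) v.proj, ⟨v.proj, u⟩ ∈ tangentSet k ι → F.g v (z - w) u = 0

/-- `V` is an extension of `v` to a vector field of `M` along `P`, of class `C¹` near
`p = π(v) ∈ P`, which is admissible and `g_V`-orthogonal to `P` near `p`. -/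
structure IsNormalExtension (v : TangentBundle (𝓡 n) M) (p : P)
    (V : P → TangentBundle (𝓡 n) M) : Prop where
  proj_eq : ∀ x, (V x).proj = ι x
  value : V p = v
  smooth : ContMDiffAt (𝓡 k) (𝓡 n).tangent 1 V p
  normal : ∀ᶠ x in 𝓝 p, V x ∈ F.normalBundle k ι

/-- `∇^V_u V` at `p = π(v)`, where `V` is a field along `P` with `V(p) = v` and `u = dι_p(a)`,
computed in the chart around `p`. It only involves the values of `V` along `P`. -/
def nablaAlong (v : TangentBundle (𝓡 n) M) (p : P) (V : P → TangentBundle (𝓡 n) M)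
    (a : TangentSpace (𝓡 k) p) : TangentSpace (𝓡 n) v.proj :=
  (tangentComp v.proj).symm
    (NormedSpace.fromTangentSpace _
        (mfderiv (𝓡 k) 𝓘(ℝ, Vec n) (fun x => (tangentChart v.proj (V x)).2) p a)
      + F.chernTerm v (tangentComp (ι p) (mfderiv (𝓡 k) (𝓡 n) ι p a)) (tangentComp v.proj v.2))

/-- The normal second fundamental form (shape operator) `S̃^P_v(u) = tan^P_v(∇^V_u V)` for
`v ∈ TP^⊥` and `u ∈ T_{π(v)}P`, where `V` is any normal extension of `v` along `P`
(the result does not depend on which one). -/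
def shapeOperator (v : TangentBundle (𝓡 n) M) (u : TangentSpace (𝓡 n) v.proj) :
    TangentSpace (𝓡 n) v.proj :=
  Classical.epsilon fun z => ∃ (p : P) (a : TangentSpace (𝓡 k) p)
    (V : P → TangentBundle (𝓡 n) M),
      tangentMap (𝓡 k) (𝓡 n) ι ⟨p, a⟩ = ⟨v.proj, u⟩ ∧ F.IsNormalExtension k ι v p V ∧
      z = F.tanPart k ι v (F.nablaAlong k ι v p V a)

/-- `P`-Jacobi fields along `γ`: Jacobi fields with `J(0) ∈ TP` and
`tan^P_{γ̇(0)}((D J)(0)) = S̃^P_{γ̇(0)}(J(0))`. -/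
structure IsPJacobi (τ : ℝ) (γ : ℝ → M) (J : ∀ t, TangentSpace (𝓡 n) (γ t)) : Prop
    extends F.IsJacobi τ γ J where
  initial : liftField γ J 0 ∈ tangentSet k ι
  initial_deriv : F.tanPart k ι ⟨γ 0, velocity τ γ 0⟩ (F.D τ γ J 0)
    = F.shapeOperator k ι ⟨γ 0, velocity τ γ 0⟩ (J 0)

/-- `t₀` is a `P`-focal instant: some `P`-Jacobi field which is not identically zero on `[0, τ]`
vanishes at `t₀`. -/
def IsFocal (τ : ℝ) (γ : ℝ → M) (t₀ : ℝ) : Prop :=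
  ∃ J : ∀ t, TangentSpace (𝓡 n) (γ t), F.IsPJacobi k ι τ γ J ∧
    (∃ t ∈ Icc 0 τ, J t ≠ 0) ∧ J t₀ = 0

/-- The integrand `g_{γ̇}(R_{γ̇}(γ̇, V)γ̇, W) + g_{γ̇}(D V, D W)` of the index form. -/
def indexIntegrand (τ : ℝ) (γ : ℝ → M) (V W : ∀ t, TangentSpace (𝓡 n) (γ t)) (t : ℝ) : ℝ :=
  F.g ⟨γ t, velocity τ γ t⟩
      (F.R ⟨γ t, velocity τ γ t⟩ (velocity τ γ t) (V t) (velocity τ γ t)) (W t)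
    + F.g ⟨γ t, velocity τ γ t⟩ (F.D τ γ V t) (F.D τ γ W t)

/-- The `(P, q)`-index form of `γ`, with `q = γ(τ)`. -/
def indexForm (τ : ℝ) (γ : ℝ → M) (V W : ∀ t, TangentSpace (𝓡 n) (γ t)) : ℝ :=
  (∫ t in (0 : ℝ)..τ, F.indexIntegrand τ γ V W t)
    + F.g ⟨γ 0, velocity τ γ 0⟩ (F.shapeOperator k ι ⟨γ 0, velocity τ γ 0⟩ (V 0)) (W 0)

end PseudoFinslerMetric

/-- The space `PC²_{P×q}(γ^*TM)`, `q = γ(τ)`: continuous piecewise `C²` fields along `γ` with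
`X(0) ∈ TP` and `X(τ) = 0`. -/
def pc2Fields (k : ℕ) {P : Type*} [TopologicalSpace P] [ChartedSpace (Vec k) P] (ι : P → M)
    (τ : ℝ) (γ : ℝ → M) : Set (∀ t, TangentSpace (𝓡 n) (γ t)) :=
  {X | IsPiecewiseC2Field τ γ X ∧
    liftField γ X 0 ∈ tangentSet k ι ∧ X τ = 0}

end Geometry

end

/-! The proof is Jacobi's sufficiency argument, run in a parallel frame. Along a geodesic the
covariant derivative D is compatible with g_{γ̇}, so a g_v-orthonormal basis of T_pM extends to a
parallel g_{γ̇}-orthonormal frame; in particular g_{γ̇} stays positive definite along γ, although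
this is assumed at t = 0 only. In frame components a field X becomes a curve x in ℝⁿ, the Jacobi
equation becomes f'' = R f with R(t) self-adjoint, and the index form becomes ∫ (⟨R x, x⟩ + |x'|²) +
⟨S x(0), x(0)⟩ with S symmetric on the subspace T that represents T_pP.

The Euclidean core is `euclidean_index_form_pos`. Let π be the orthogonal projection onto T and let
A solve A'' = R A with A(0) = π and A'(0) = S π + (1 - π). The columns of A are P-Jacobi fields, so
the absence of focal instants makes A(t) invertible on (0, τ]. Write x = A f there. Symmetry of R
and S makes A Lagrangian (`lagrangian_identity`), which gives, off the break points, ⟨R x, x⟩ +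
|x'|² = |x' - A' f|² + d/dt ⟨A' f, x⟩. The boundary term vanishes at τ. At 0 the operator A is
singular, but the boundary term still tends to ⟨S x(0), x(0)⟩ (`tendsto_boundary_term`). Hence the
index form is the limit of ∫_ε^τ |x' - A' f|² as ε → 0. If it were not positive, x' = A' f would
hold almost everywhere, so f would be constant, equal to f(τ) = 0, and x would vanish.

The geometric input is that, along a geodesic, the Chern connection enters only through its
contraction with γ̇, which is governed by the spray H of L: the connection is N = ½ ∂H/∂y and R_y(y,
·)y is `sprayCurv` (`sum_sum_chernSymbol`, `sum_sum_sum_chernCurv`). The equation that determines H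
from L is differentiated to get metric compatibility (`IsSpray.conn_add_conn`), self-adjointness of
the curvature (`IsSpray.curv_symm`) and independence of the chart (`IsCoordChange.conn_eq`,
`IsCoordChange.curv_eq`). Differentiating the relation that a field is normal to P shows that the
shape operator is symmetric and independent of the chosen extension
(`IsSpray.secondDeriv_nabla_normal`, `exists_shapeOperator_form`). -/

noncomputable section

open FinslerCoord

/-! ### Linear differential equations on a compact interval. -/

section LinearODE

variable {E : Type*} [NormedAddCommGroup E] [NormedSpace ℝ E]

theorem hasDerivWithinAt_Icc_of_halves {h : ℝ → E} {v : E} {a c d t : ℝ} (hac : a ≤ c) (hcd : c ≤ d)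
    (ht : t ∈ Icc a d)
    (h1 : t ∈ Icc a c → HasDerivWithinAt h v (Icc a c) t)
    (h2 : t ∈ Icc c d → HasDerivWithinAt h v (Icc c d) t) :
    HasDerivWithinAt h v (Icc a d) t := by
  rcases lt_trichotomy t c with hlt | rfl | hlt
  · refine (h1 ⟨ht.1, hlt.le⟩).mono_of_mem_nhdsWithin ?_
    filter_upwards [self_mem_nhdsWithin, mem_nhdsWithin_of_mem_nhds (Iio_mem_nhds hlt)] with s hs hs'
    exact ⟨hs.1, (mem_Iio.1 hs').le⟩
  · rw [← Icc_union_Icc_eq_Icc hac hcd]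
    exact (h1 ⟨ht.1, le_rfl⟩).union (h2 ⟨le_rfl, ht.2⟩)
  · refine (h2 ⟨hlt.le, ht.2⟩).mono_of_mem_nhdsWithin ?_
    filter_upwards [self_mem_nhdsWithin, mem_nhdsWithin_of_mem_nhds (Ioi_mem_nhds hlt)] with s hs hs'
    exact ⟨(mem_Ioi.1 hs').le, hs.2⟩

/-- Continuation principle: near each c the truth of Q does not change, so connectedness of the
interval carries it from a to b. The radius ε depends on c alone and not on the point s from which
one extends, so no separate closedness argument is needed. It serves both linear equations and
parallel transport across charts. -/
theorem of_forall_eventually_imp_Icc {a b : ℝ} (hab : a ≤ b) {Q : ℝ → Prop} (h0 : Q a)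
    (hdown : ∀ s ∈ Icc a b, ∀ t ∈ Icc a b, s ≤ t → Q t → Q s)
    (hloc : ∀ c ∈ Icc a b, ∃ ε > 0, ∀ s ∈ Icc a b, ∀ t ∈ Icc a b, |s - c| < ε → |t - c| < ε →
      s ≤ t → Q s → Q t) : Q b := by
  refine (isPreconnected_Icc (a := a) (b := b)).induction₂' (fun s t => Q s → Q t)
    (fun c hc => by
      obtain ⟨ε, hε, H⟩ := hloc c hc
      have : Metric.ball c ε ∈ 𝓝[Icc a b] c := mem_nhdsWithin_of_mem_nhds (Metric.ball_mem_nhds c hε)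
      filter_upwards [this, self_mem_nhdsWithin] with t ht ht'
      rw [Metric.mem_ball, Real.dist_eq] at ht
      have hcc : |c - c| < ε := by simpa using hε
      rcases le_total c t with h | h
      · exact ⟨H c hc t ht' hcc ht h, hdown c hc t ht' h⟩
      · exact ⟨hdown t ht' c hc h, H t ht' c hc ht hcc h⟩)
    (fun x y z _ _ _ hxy hyz h => hyz (hxy h)) (left_mem_Icc.2 hab) (right_mem_Icc.2 hab) h0

variable [CompleteSpace E]

/-- Linearity makes the length of the existence interval independent of `x₀`: on the ball of radius
‖x₀‖ + 1 the speed is at most M(2‖x₀‖ + 1) ≤ 2M(‖x₀‖ + 1), so Picard–Lindelöf needs only (b - a) ·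
2M ≤ 1. The extra 1 in the hypothesis keeps the later divisions legitimate when M = 0. -/
theorem exists_linearODE_of_short {A : ℝ → E →L[ℝ] E} {a b M : ℝ} (hab : a ≤ b)
    (hA : ContinuousOn A (Icc a b)) (hM : ∀ t ∈ Icc a b, ‖A t‖ ≤ M) (hM0 : 0 ≤ M)
    (hshort : (b - a) * (2 * M + 1) ≤ 1) (x₀ : E) :
    ∃ x : ℝ → E, x a = x₀ ∧ ∀ t ∈ Icc a b, HasDerivWithinAt x (A t (x t)) (Icc a b) t := by
  lift M to NNReal using hM0
  have hpl : IsPicardLindelof (fun t x => A t x) (⟨a, left_mem_Icc.2 hab⟩ : Icc a b) x₀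
      (‖x₀‖₊ + 1) 0 (M * (2 * ‖x₀‖₊ + 1)) M := by
    refine ⟨fun t ht => ?_, fun x _ => ?_, fun t ht x hx => ?_, ?_⟩
    · refine ((A t).lipschitz.weaken ?_).lipschitzOnWith
      exact_mod_cast hM t ht
    · exact hA.clm_apply continuousOn_const
    · have hx' : ‖x‖ ≤ 2 * ‖x₀‖ + 1 := by
        rw [Metric.mem_closedBall, dist_eq_norm] at hx
        have := norm_le_norm_add_norm_sub' x x₀
        push_cast at hx
        linarith
      calc ‖A t x‖ ≤ ‖A t‖ * ‖x‖ := (A t).le_opNorm x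
        _ ≤ M * (2 * ‖x₀‖ + 1) := by
          have := hM t ht
          gcongr
        _ = _ := by push_cast; rfl
    · have h0 : (0 : ℝ) ≤ ‖x₀‖ := norm_nonneg _
      have h1 : 0 ≤ b - a := sub_nonneg.2 hab
      simp only [sub_self]
      rw [max_eq_left h1]
      push_cast
      have hMn : (0 : ℝ) ≤ M := M.2
      nlinarith [mul_nonneg h1 hMn, mul_nonneg (mul_nonneg h1 hMn) h0, mul_nonneg h1 h0]
  exact hpl.exists_eq_forall_mem_Icc_hasDerivWithinAt₀

/-- Linear differential equations with continuous coefficients have solutions on the whole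
interval. -/
theorem exists_linearODE {A : ℝ → E →L[ℝ] E} {a b : ℝ} (hab : a ≤ b)
    (hA : ContinuousOn A (Icc a b)) (x₀ : E) :
    ∃ x : ℝ → E, x a = x₀ ∧ ∀ t ∈ Icc a b, HasDerivWithinAt x (A t (x t)) (Icc a b) t := by
  obtain ⟨M, hM⟩ := isCompact_Icc.exists_bound_of_continuousOn hA
  have hM0 : 0 ≤ M := (norm_nonneg _).trans (hM a (left_mem_Icc.2 hab))
  refine of_forall_eventually_imp_Icc
    (Q := fun T => ∃ x : ℝ → E, x a = x₀ ∧
      ∀ t ∈ Icc a T, HasDerivWithinAt x (A t (x t)) (Icc a T) t) hab ?_ ?_ ?_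
  · refine ⟨fun _ => x₀, rfl, fun t ht => ?_⟩
    rw [Icc_self] at ht ⊢
    rw [mem_singleton_iff.1 ht]
    exact HasFDerivWithinAt.of_subsingleton subsingleton_singleton
  · rintro s hs t ht hst ⟨x, hx, h⟩
    exact ⟨x, hx, fun u hu => (h u ⟨hu.1, hu.2.trans hst⟩).mono (Icc_subset_Icc_right hst)⟩
  · intro c _
    -- Two points within this distance of c are less than 1 / (2M + 1) apart, which is the length
    -- handled by `exists_linearODE_of_short`.
    refine ⟨1 / (2 * (2 * M + 1)), by positivity, ?_⟩
    rintro s hs t ht hsc htc hst ⟨x, hx, h⟩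
    have hsub : Icc s t ⊆ Icc a b := Icc_subset_Icc hs.1 ht.2
    obtain ⟨y, hy, hy'⟩ := exists_linearODE_of_short hst (hA.mono hsub)
      (fun u hu => hM u (hsub hu)) hM0 (by
        have h3 : t - s < 1 / (2 * M + 1) := by
          have : 1 / (2 * M + 1) = 1 / (2 * (2 * M + 1)) + 1 / (2 * (2 * M + 1)) := by
            field_simp; norm_num
          rw [this]
          linarith [abs_lt.1 hsc, abs_lt.1 htc]
        rw [lt_div_iff₀ (by positivity)] at h3
        exact h3.le) (x s)
    refine ⟨fun u => if u ≤ s then x u else y u, by simp [hs.1, hx], fun u hu => ?_⟩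
    refine hasDerivWithinAt_Icc_of_halves hs.1 hst hu (fun hu' => ?_) (fun hu' => ?_)
    · simp only [if_pos hu'.2]
      exact (h u hu').congr (fun v hv => if_pos hv.2) (if_pos hu'.2)
    · have e : ∀ v ∈ Icc s t, (if v ≤ s then x v else y v) = y v := by
        intro v hv
        split_ifs with hvs
        · rw [le_antisymm hvs hv.1, hy]
        · rfl
      simp only [e u hu']
      exact (hy' u hu').congr e (e u hu')

end LinearODE

/-! ### Jacobi tensors in a Euclidean space and their behaviour at the initial point. -/

section EuclideanIndexForm

open scoped InnerProductSpace
open Filter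

theorem tendsto_clm_apply {α E F : Type*} [NormedAddCommGroup E] [NormedSpace ℝ E]
    [NormedAddCommGroup F] [NormedSpace ℝ F] {l : Filter α} {f : α → E →L[ℝ] F} {g : α → E}
    {f₀ : E →L[ℝ] F} {g₀ : E} (hf : Tendsto f l (𝓝 f₀)) (hg : Tendsto g l (𝓝 g₀)) :
    Tendsto (fun t => f t (g t)) l (𝓝 (f₀ g₀)) :=
  ((isBoundedBilinearMap_apply (𝕜 := ℝ) (E := E) (F := F)).continuous.tendsto (f₀, g₀)).comp
    (hf.prodMk_nhds hg)

variable {V : Type*} [NormedAddCommGroup V] [InnerProductSpace ℝ V]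

theorem ringInverse_apply_apply {A : V →L[ℝ] V} (h : IsUnit A) (a : V) :
    Ring.inverse A (A a) = a := by
  rw [← mul_apply_eq_comp, Ring.inverse_mul_cancel _ h, one_apply_eq_self]

theorem apply_ringInverse_apply {A : V →L[ℝ] V} (h : IsUnit A) (a : V) :
    A (Ring.inverse A a) = a := by
  rw [← mul_apply_eq_comp, Ring.mul_inverse_cancel _ h, one_apply_eq_self]

variable [FiniteDimensional ℝ V]

/-- The second-order operator equation A'' = R A is the linear system (A, A₁)' = (A₁, R A) on pairs
of operators. -/
theorem exists_fundamental_solution {τ : ℝ} (hτ : 0 ≤ τ) {R : ℝ → V →L[ℝ] V}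
    (hR : ContinuousOn R (Icc 0 τ)) (P Q : V →L[ℝ] V) :
    ∃ A A₁ : ℝ → V →L[ℝ] V, A 0 = P ∧ A₁ 0 = Q ∧
      (∀ t ∈ Icc 0 τ, HasDerivWithinAt A (A₁ t) (Icc 0 τ) t) ∧
      ∀ t ∈ Icc 0 τ, HasDerivWithinAt A₁ (R t * A t) (Icc 0 τ) t := by
  let W := V →L[ℝ] V
  let B : ℝ → (W × W) →L[ℝ] (W × W) := fun t =>
    (ContinuousLinearMap.inl ℝ W W).comp (ContinuousLinearMap.snd ℝ W W) +
    (ContinuousLinearMap.inr ℝ W W).comp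
      ((ContinuousLinearMap.compL ℝ V V V (R t)).comp (ContinuousLinearMap.fst ℝ W W))
  have hB : ContinuousOn B (Icc 0 τ) := by
    refine continuousOn_const.add (continuousOn_const.clm_comp (ContinuousOn.clm_comp ?_
      continuousOn_const))
    exact (ContinuousLinearMap.compL ℝ V V V).continuous.comp_continuousOn hR
  obtain ⟨z, hz, h⟩ := exists_linearODE hτ hB (P, Q)
  refine ⟨fun t => (z t).1, fun t => (z t).2, by simp [hz], by simp [hz], fun t ht => ?_,
    fun t ht => ?_⟩
  · have := (ContinuousLinearMap.fst ℝ W W).hasFDerivAt.comp_hasDerivWithinAt t (h t ht)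
    simpa [B] using! this
  · have := (ContinuousLinearMap.snd ℝ W W).hasFDerivAt.comp_hasDerivWithinAt t (h t ht)
    simpa [B] using! this

theorem isUnit_of_forall_eq_zero {A : V →L[ℝ] V} (h : ∀ a, A a = 0 → a = 0) : IsUnit A := by
  rw [ContinuousLinearMap.isUnit_iff_bijective]
  have hi : Function.Injective (A : V →ₗ[ℝ] V) :=
    (injective_iff_map_eq_zero (A : V →ₗ[ℝ] V)).2 h
  exact ⟨hi, LinearMap.injective_iff_surjective.1 hi⟩

theorem nhdsGT_zero_le {τ : ℝ} (hτ : 0 < τ) : 𝓝[>] (0 : ℝ) ≤ 𝓝[Icc 0 τ] 0 := by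
  rw [← nhdsWithin_Ioc_eq_nhdsGT hτ]
  exact nhdsWithin_mono _ Ioc_subset_Icc_self

/-- A(0) = π is singular on Tᗮ, where A(t) vanishes like t. Thus A⁻¹x splits into a part converging
to x(0) and a part q in Tᗮ that is merely bounded; boundedness comes from x(t) - x(0) = O(t) and
x(0) ∈ T. The first part yields ⟨A₁(0) x(0), x(0)⟩ = ⟨S x(0), x(0)⟩. The second contributes nothing
in the limit, because A₁(0) q = q is orthogonal to x(0). -/
theorem tendsto_boundary_term {τ : ℝ} (hτ : 0 < τ) {A A₁ : ℝ → V →L[ℝ] V}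
    (hA : HasDerivWithinAt A (A₁ 0) (Icc 0 τ) 0) (hA₁ : ContinuousWithinAt A₁ (Icc 0 τ) 0)
    (T : Submodule ℝ V) (S : V →L[ℝ] V) (hA0 : A 0 = T.starProjection)
    (hA₁0 : A₁ 0 = S * T.starProjection + (1 - T.starProjection))
    (hinj : ∀ t ∈ Ioc 0 τ, IsUnit (A t))
    {x : ℝ → V} (hx : ContinuousWithinAt x (Icc 0 τ) 0) {C : ℝ}
    (hC : ∀ t ∈ Icc 0 τ, ‖x t - x 0‖ ≤ C * t) (hx0 : x 0 ∈ T) :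
    Tendsto (fun t => ⟪A₁ t (Ring.inverse (A t) (x t)), x t⟫_ℝ) (𝓝[>] 0) (𝓝 ⟪S (x 0), x 0⟫_ℝ) := by
  set π := T.starProjection with hπ
  set p : V →L[ℝ] V := 1 - π with hp
  have hπx : π (x 0) = x 0 := Submodule.starProjection_eq_self_iff.2 hx0
  have hππ : π * π = π := Submodule.isIdempotentElem_starProjection T
  have hπp : π * p = 0 := by rw [hp, mul_sub, mul_one, hππ, sub_self]
  have hpπ : p * π = 0 := by rw [hp, sub_mul, one_mul, hππ, sub_self]
  have hpp : p * p = p := by rw [hp, mul_sub, mul_one, ← hp, hpπ, sub_zero]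
  have hle := nhdsGT_zero_le hτ
  have hmem : ∀ᶠ t in 𝓝[>] (0 : ℝ), t ∈ Ioc 0 τ := Ioc_mem_nhdsGT hτ
  have cA : Tendsto A (𝓝[>] 0) (𝓝 π) := hA0 ▸ (hA.continuousWithinAt.tendsto.mono_left hle)
  have cA₁ : Tendsto A₁ (𝓝[>] 0) (𝓝 (A₁ 0)) := hA₁.tendsto.mono_left hle
  have cx : Tendsto x (𝓝[>] 0) (𝓝 (x 0)) := hx.tendsto.mono_left hle
  have slope_lim : Tendsto (fun t : ℝ => t⁻¹ • (A t - π)) (𝓝[>] 0) (𝓝 (A₁ 0)) := by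
    have h := hasDerivWithinAt_iff_tendsto_slope.1 hA
    have h2 := h.mono_left (show 𝓝[>] (0 : ℝ) ≤ 𝓝[Icc 0 τ \ {0}] 0 by
      rw [← nhdsWithin_Ioc_eq_nhdsGT hτ]
      exact nhdsWithin_mono _ fun t ht => ⟨Ioc_subset_Icc_self ht, ne_of_gt ht.1⟩)
    refine h2.congr fun t => ?_
    simp [slope, hA0]
  have hA₁p : A₁ 0 * p = p := by
    rw [hA₁0, add_mul, mul_assoc, hπp, mul_zero, zero_add, hpp]
  have limp : Tendsto (fun t : ℝ => t⁻¹ • (A t * p)) (𝓝[>] 0) (𝓝 p) := by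
    have := slope_lim.mul_const p
    rw [hA₁p] at this
    refine this.congr fun t => ?_
    rw [smul_mul_assoc, sub_mul, hπp, sub_zero]
  -- Dividing by t on Tᗮ removes the degeneracy: B(t) tends to π + p = 1. With y = B⁻¹x one gets
  -- A⁻¹x = π y + t⁻¹ p y, the last term being q.
  set B : ℝ → V →L[ℝ] V := fun t => A t * π + t⁻¹ • (A t * p) with hB
  have limB : Tendsto B (𝓝[>] 0) (𝓝 1) := by
    have := (cA.mul_const π).add limp
    rwa [hππ, hp, add_sub_cancel] at this
  have hBunit : ∀ᶠ t in 𝓝[>] (0 : ℝ), IsUnit (B t) :=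
    limB.eventually (Units.isOpen.mem_nhds (isUnit_one : IsUnit (1 : V →L[ℝ] V)))
  set y : ℝ → V := fun t => Ring.inverse (B t) (x t) with hy
  have limy : Tendsto y (𝓝[>] 0) (𝓝 (x 0)) := by
    have h1 : Tendsto (fun t => Ring.inverse (B t)) (𝓝[>] 0) (𝓝 1) := by
      have := (NormedRing.inverse_continuousAt (1 : (V →L[ℝ] V)ˣ)).tendsto
      rw [Units.val_one, Ring.inverse_one] at this
      exact this.comp limB
    simpa using tendsto_clm_apply h1 cx
  set q : ℝ → V := fun t => t⁻¹ • p (y t) with hq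
  have hpq : ∀ t, p (q t) = q t := fun t => by
    simp only [hq, map_smul]
    rw [← mul_apply_eq_comp, hpp]
  have hf : ∀ᶠ t in 𝓝[>] (0 : ℝ), Ring.inverse (A t) (x t) = π (y t) + q t := by
    filter_upwards [hmem, hBunit] with t ht hBt
    have h1 : A t (π (y t) + q t) = x t := by
      have := apply_ringInverse_apply hBt (x t)
      rw [← this]
      simp only [hB, hq, hy, map_add, map_smul, add_apply,
        mul_apply_eq_comp, smul_apply]
    rw [← h1, ringInverse_apply_apply (hinj t ht)]
  have hqb : ∃ K : ℝ, ∀ᶠ t in 𝓝[>] (0 : ℝ), ‖q t‖ ≤ K := by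
    have e1 : ∀ᶠ t in 𝓝[>] (0 : ℝ), ‖p * (t⁻¹ • (A t * p)) - p‖ < 1 / 2 := by
      have h0 : Tendsto (fun t : ℝ => ‖p * (t⁻¹ • (A t * p)) - p‖) (𝓝[>] 0) (𝓝 0) := by
        have := ((limp.const_mul p).sub_const p).norm
        rwa [hpp, sub_self, norm_zero] at this
      exact h0.eventually (gt_mem_nhds (by norm_num))
    have e2 : ∀ᶠ t in 𝓝[>] (0 : ℝ), ‖p * (t⁻¹ • (A t - π)) * π‖ < ‖p * A₁ 0 * π‖ + 1 :=
      ((slope_lim.const_mul p).mul_const π).norm.eventually (gt_mem_nhds (by linarith))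
    have e3 : ∀ᶠ t in 𝓝[>] (0 : ℝ), ‖y t‖ < ‖x 0‖ + 1 :=
      limy.norm.eventually (gt_mem_nhds (by linarith))
    refine ⟨2 * (‖p‖ * |C| + (‖p * A₁ 0 * π‖ + 1) * (‖x 0‖ + 1)), ?_⟩
    filter_upwards [hmem, hf, e1, e2, e3] with t ht hft h1 h2 h3
    have ht0 : 0 < t := ht.1
    -- Project x = A(π y) + A q to Tᗮ and divide by t. The first two terms on the right are bounded,
    -- and the operator in the third has norm below 1/2, so that term is absorbed on the left.
    have key : q t = t⁻¹ • p (x t - x 0) - (p * (t⁻¹ • (A t - π)) * π) (y t)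
        - (p * (t⁻¹ • (A t * p)) - p) (q t) := by
      have hAx : A t (π (y t)) + A t (q t) = x t := by
        rw [← map_add, ← hft, apply_ringInverse_apply (hinj t ht)]
      have hpx0 : p (x 0) = 0 := by simp [hp, hπx]
      have hπ2 : ∀ a, p (π a) = 0 := fun a => by
        rw [← mul_apply_eq_comp, hpπ]; rfl
      have hπ3 : ∀ a, π (π a) = π a := fun a => by
        rw [← mul_apply_eq_comp, hππ]
      rw [map_sub, hpx0, ← hAx]
      simp only [sub_apply, mul_apply_eq_comp, hpq, hπ2, hπ3,
        smul_apply, map_smul, map_sub, map_add, smul_sub, smul_add]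
      simp
    have n1 : ‖t⁻¹ • p (x t - x 0)‖ ≤ ‖p‖ * |C| := by
      rw [norm_smul, norm_inv, Real.norm_of_nonneg ht0.le]
      have : ‖p (x t - x 0)‖ ≤ ‖p‖ * (|C| * t) :=
        (p.le_opNorm _).trans (mul_le_mul_of_nonneg_left
          ((hC t (Ioc_subset_Icc_self ht)).trans (by gcongr; exact le_abs_self C)) (norm_nonneg _))
      rw [inv_mul_le_iff₀ ht0]
      linarith
    have n2 : ‖(p * (t⁻¹ • (A t - π)) * π) (y t)‖ ≤ (‖p * A₁ 0 * π‖ + 1) * (‖x 0‖ + 1) :=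
      (ContinuousLinearMap.le_opNorm _ _).trans (by gcongr)
    have n3 : ‖(p * (t⁻¹ • (A t * p)) - p) (q t)‖ ≤ 1 / 2 * ‖q t‖ :=
      (ContinuousLinearMap.le_opNorm _ _).trans (by gcongr)
    have n4 : ‖q t‖ ≤ ‖t⁻¹ • p (x t - x 0)‖ + ‖(p * (t⁻¹ • (A t - π)) * π) (y t)‖
        + ‖(p * (t⁻¹ • (A t * p)) - p) (q t)‖ := by
      conv_lhs => rw [key]
      exact (norm_sub_le _ _).trans (by gcongr; exact norm_sub_le _ _)
    linarith
  obtain ⟨K, hK⟩ := hqb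
  have horth : ∀ a, ⟪p a, x 0⟫_ℝ = 0 := fun a => by
    simpa [hp] using Submodule.starProjection_inner_eq_zero a (x 0) hx0
  have l1 : Tendsto (fun t => ⟪A₁ t (π (y t)), x t⟫_ℝ) (𝓝[>] 0) (𝓝 ⟪S (x 0), x 0⟫_ℝ) := by
    have h2 : Tendsto (fun t => π (y t)) (𝓝[>] 0) (𝓝 (x 0)) := by
      have := (π.continuous.tendsto _).comp limy
      rwa [hπx] at this
    have h1 := (tendsto_clm_apply cA₁ h2).inner (𝕜 := ℝ) cx
    have : A₁ 0 (x 0) = S (x 0) := by simp [hA₁0, hp, hπx]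
    rwa [this] at h1
  have l2 : Tendsto (fun t => ⟪A₁ t (q t), x t⟫_ℝ) (𝓝[>] 0) (𝓝 0) := by
    have hz : Tendsto (fun t => ‖A₁ t - A₁ 0‖ * (K * ‖x t‖) + K * ‖x t - x 0‖) (𝓝[>] 0) (𝓝 0) := by
      have a1 : Tendsto (fun t => ‖A₁ t - A₁ 0‖) (𝓝[>] 0) (𝓝 0) := by
        simpa using (cA₁.sub_const (A₁ 0)).norm
      have a2 : Tendsto (fun t => ‖x t - x 0‖) (𝓝[>] 0) (𝓝 0) := by
        simpa using (cx.sub_const (x 0)).norm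
      simpa using (a1.mul (cx.norm.const_mul K)).add (a2.const_mul K)
    refine squeeze_zero_norm' ?_ hz
    filter_upwards [hK] with t ht
    -- Since q is only bounded, each summand must pair it with a factor tending to 0; subtracting
    -- ⟨A₁(0) q, x(0)⟩ = ⟨q, x(0)⟩ = 0 achieves this.
    have : ⟪A₁ t (q t), x t⟫_ℝ = ⟪(A₁ t - A₁ 0) (q t), x t⟫_ℝ + ⟪q t, x t - x 0⟫_ℝ := by
      have h1 : A₁ 0 (q t) = q t := by
        rw [← hpq t, ← mul_apply_eq_comp, hA₁p]
      have h2 : ⟪q t, x 0⟫_ℝ = 0 := by rw [← hpq t, horth]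
      rw [sub_apply, h1, inner_sub_left, inner_sub_right, h2]
      ring
    rw [this]
    refine (norm_add_le _ _).trans (add_le_add ?_ ?_)
    · refine (norm_inner_le_norm _ _).trans ?_
      calc ‖(A₁ t - A₁ 0) (q t)‖ * ‖x t‖ ≤ (‖A₁ t - A₁ 0‖ * K) * ‖x t‖ := by
            gcongr
            exact (ContinuousLinearMap.le_opNorm _ _).trans (by gcongr)
        _ = _ := by ring
    · exact (norm_inner_le_norm _ _).trans (by gcongr)
  have := l1.add l2
  rw [add_zero] at this
  refine this.congr' ?_
  filter_upwards [hf] with t ht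
  rw [ht, map_add, inner_add_left]

end EuclideanIndexForm

/-! ### Positivity of the index form in a Euclidean space. -/

section EuclideanIndexForm

open scoped InnerProductSpace
open Filter

variable {V : Type*} [NormedAddCommGroup V] [InnerProductSpace ℝ V] [FiniteDimensional ℝ V]

theorem hasDerivAt_of_Icc {E : Type*} [NormedAddCommGroup E] [NormedSpace ℝ E] {f : ℝ → E} {f' : E}
    {a b t : ℝ} (h : HasDerivWithinAt f f' (Icc a b) t) (ht : t ∈ Ioo a b) : HasDerivAt f f' t :=
  h.hasDerivAt (Icc_mem_nhds ht.1 ht.2)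

-- The Wronskian ⟨A a, A₁ b⟩ - ⟨A₁ a, A b⟩ has derivative ⟨A a, R A b⟩ - ⟨R A a, A b⟩, which
-- vanishes by symmetry of R.
omit [FiniteDimensional ℝ V] in
theorem lagrangian_identity {τ : ℝ} {R A A₁ : ℝ → V →L[ℝ] V}
    (hA : ∀ t ∈ Icc 0 τ, HasDerivWithinAt A (A₁ t) (Icc 0 τ) t)
    (hA₁ : ∀ t ∈ Icc 0 τ, HasDerivWithinAt A₁ (R t * A t) (Icc 0 τ) t)
    (hsym : ∀ t ∈ Icc 0 τ, ∀ a b, ⟪R t a, b⟫_ℝ = ⟪a, R t b⟫_ℝ)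
    (h0 : ∀ a b, ⟪A 0 a, A₁ 0 b⟫_ℝ = ⟪A₁ 0 a, A 0 b⟫_ℝ) :
    ∀ t ∈ Icc 0 τ, ∀ a b, ⟪A t a, A₁ t b⟫_ℝ = ⟪A₁ t a, A t b⟫_ℝ := by
  intro t ht a b
  have hd : ∀ s ∈ Icc 0 τ, HasDerivWithinAt
      (fun s => ⟪A s a, A₁ s b⟫_ℝ - ⟪A₁ s a, A s b⟫_ℝ) 0 (Icc 0 τ) s := by
    intro s hs
    have e1 := (hA s hs).clm_apply (hasDerivWithinAt_const s (Icc 0 τ) a)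
    have e2 := (hA s hs).clm_apply (hasDerivWithinAt_const s (Icc 0 τ) b)
    have e3 := (hA₁ s hs).clm_apply (hasDerivWithinAt_const s (Icc 0 τ) a)
    have e4 := (hA₁ s hs).clm_apply (hasDerivWithinAt_const s (Icc 0 τ) b)
    have := (e1.inner ℝ e4).sub (e3.inner ℝ e2)
    convert! this using 1
    simp only [mul_apply_eq_comp, map_zero, add_zero, hsym s hs]
    ring
  have := constant_of_derivWithin_zero (fun s hs => (hd s hs).differentiableWithinAt)
    (fun s hs => (hd s (Ico_subset_Icc_self hs)).derivWithin
      (uniqueDiffOn_Icc (hs.1.trans_lt hs.2) s (Ico_subset_Icc_self hs))) t ht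
  simp only [h0, sub_self] at this
  exact sub_eq_zero.1 this

theorem intervalIntegrable_of_bound_off_countable {E : Type*} [NormedAddCommGroup E] {h : ℝ → E}
    {a b K : ℝ} (hab : a ≤ b) {Z : Set ℝ} (hZ : Z.Countable)
    (hm : AEStronglyMeasurable h (volume.restrict (Icc a b)))
    (hK : ∀ t ∈ Ioo a b \ Z, ‖h t‖ ≤ K) : IntervalIntegrable h volume a b := by
  rw [intervalIntegrable_iff_integrableOn_Ioo_of_le hab]
  have hm' : AEStronglyMeasurable h (volume.restrict (Ioo a b)) :=
    hm.mono_measure (Measure.restrict_mono Ioo_subset_Icc_self le_rfl)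
  refine ⟨hm', HasFiniteIntegral.of_bounded (C := K) ?_⟩
  rw [ae_restrict_iff' measurableSet_Ioo]
  filter_upwards [hZ.ae_notMem volume] with t ht hti
  exact hK t ⟨hti, ht⟩

/-- Completing the square with the Jacobi tensor A: for x = A f and d = x' - A₁ f, the integrand is
|d|² plus the derivative of φ = ⟨A₁ f, x⟩. The field x need only be continuous, with a bounded
derivative off a countable set; this covers broken fields. -/
theorem euclidean_index_form_pos {τ : ℝ} (hτ : 0 < τ) {R : ℝ → V →L[ℝ] V}
    (hR : ContinuousOn R (Icc 0 τ)) (hsym : ∀ t ∈ Icc 0 τ, ∀ a b, ⟪R t a, b⟫_ℝ = ⟪a, R t b⟫_ℝ)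
    (T : Submodule ℝ V) (S : V →L[ℝ] V) (hS : ∀ a ∈ T, ∀ b ∈ T, ⟪S a, b⟫_ℝ = ⟪a, S b⟫_ℝ)
    (hfoc : ∀ f f₁ : ℝ → V, (∀ t ∈ Icc 0 τ, HasDerivWithinAt f (f₁ t) (Icc 0 τ) t) →
      (∀ t ∈ Icc 0 τ, HasDerivWithinAt f₁ (R t (f t)) (Icc 0 τ) t) → f 0 ∈ T →
      (∀ w ∈ T, ⟪f₁ 0 - S (f 0), w⟫_ℝ = 0) → ∀ t₀ ∈ Ioc 0 τ, f t₀ = 0 → ∀ t ∈ Icc 0 τ, f t = 0)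
    {x x' : ℝ → V} (hx : ContinuousOn x (Icc 0 τ)) {Z : Set ℝ} (hZ : Z.Countable)
    (hxd : ∀ t ∈ Ioo 0 τ \ Z, HasDerivAt x (x' t) t) {C : ℝ}
    (hC : ∀ t ∈ Ioo 0 τ \ Z, ‖x' t‖ ≤ C)
    (hm : AEStronglyMeasurable x' (volume.restrict (Icc 0 τ))) (hx0 : x 0 ∈ T) (hxτ : x τ = 0) :
    IntervalIntegrable (fun t => ⟪R t (x t), x t⟫_ℝ + ⟪x' t, x' t⟫_ℝ) volume 0 τ ∧
    ((∃ t ∈ Icc 0 τ, x t ≠ 0) →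
      0 < (∫ t in (0 : ℝ)..τ, (⟪R t (x t), x t⟫_ℝ + ⟪x' t, x' t⟫_ℝ)) + ⟪S (x 0), x 0⟫_ℝ) := by
  have hcpt : IsCompact (Icc 0 τ) := isCompact_Icc
  have hRx : ContinuousOn (fun t => ⟪R t (x t), x t⟫_ℝ) (Icc 0 τ) := (hR.clm_apply hx).inner hx
  have hint : IntervalIntegrable (fun t => ⟪R t (x t), x t⟫_ℝ + ⟪x' t, x' t⟫_ℝ) volume 0 τ := by
    refine (hRx.intervalIntegrable_of_Icc hτ.le).add
      (intervalIntegrable_of_bound_off_countable (K := C * C) hτ.le hZ (hm.inner hm) ?_)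
    intro t ht
    exact (norm_inner_le_norm _ _).trans
      (mul_le_mul (hC t ht) (hC t ht) (norm_nonneg _) ((norm_nonneg _).trans (hC t ht)))
  refine ⟨hint, fun hne => ?_⟩
  set I : ℝ → ℝ := fun t => ⟪R t (x t), x t⟫_ℝ + ⟪x' t, x' t⟫_ℝ with hI
  -- the Lipschitz estimate at the initial point
  have hLip : ∀ t ∈ Icc 0 τ, ‖x t - x 0‖ ≤ |C| * t := by
    intro t ht
    have hsub : Icc 0 t ⊆ Icc 0 τ := Icc_subset_Icc_right ht.2
    have hbd : ∀ s ∈ Ioo 0 t \ Z, ‖x' s‖ ≤ |C| := fun s hs =>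
      (hC s ⟨⟨hs.1.1, hs.1.2.trans_le ht.2⟩, hs.2⟩).trans (le_abs_self C)
    have hi : IntervalIntegrable x' volume 0 t := intervalIntegrable_of_bound_off_countable ht.1 hZ
      (hm.mono_measure (Measure.restrict_mono hsub le_rfl)) hbd
    rw [← integral_eq_of_hasDerivAt_off_countable_of_le x x' ht.1 hZ (hx.mono hsub)
      (fun s hs => hxd s ⟨⟨hs.1.1, hs.1.2.trans_le ht.2⟩, hs.2⟩) hi]
    have : ‖∫ s in (0 : ℝ)..t, x' s‖ ≤ |C| * |t - 0| := by
      refine intervalIntegral.norm_integral_le_of_norm_le_const_ae ?_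
      have hne' : ∀ᵐ s : ℝ, s ≠ t := by simp [ae_iff]
      filter_upwards [hZ.ae_notMem volume, hne'] with s hs hst hs'
      rw [uIoc_of_le ht.1] at hs'
      exact hbd s ⟨⟨hs'.1, lt_of_le_of_ne hs'.2 hst⟩, hs⟩
    rwa [sub_zero, abs_of_nonneg ht.1] at this
  -- the fundamental solution
  set π := T.starProjection with hπ
  have hπmem : ∀ a, π a ∈ T := fun a => Submodule.starProjection_apply_mem T a
  have hππ : ∀ a, π (π a) = π a := fun a => Submodule.starProjection_eq_self_iff.2 (hπmem a)
  have hπsym : ∀ a b, ⟪π a, b⟫_ℝ = ⟪a, π b⟫_ℝ := Submodule.inner_starProjection_left_eq_right T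
  -- With these initial values t ↦ A(t) a is the solution with f(0) = π a and f'(0) - S f(0) = (1 -
  -- π) a, so a ranges exactly once over the initial data of P-Jacobi fields.
  obtain ⟨A, A₁, hA0, hA₁0, hA, hA₁⟩ := exists_fundamental_solution hτ.le hR π (S * π + (1 - π))
  have hlag := lagrangian_identity hA hA₁ hsym (fun a b => by
    have h1 : ⟪π a, S (π b)⟫_ℝ = ⟪S (π a), π b⟫_ℝ := (hS _ (hπmem a) _ (hπmem b)).symm
    simp only [hA0, hA₁0, add_apply, mul_apply_eq_comp, sub_apply, one_apply_eq_self,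
      inner_add_left, inner_add_right, inner_sub_left, inner_sub_right, h1]
    rw [hπsym a (π b), hππ, hπsym a b])
  have huniq : ∀ t ∈ Icc (0 : ℝ) τ, UniqueDiffWithinAt ℝ (Icc 0 τ) t := uniqueDiffOn_Icc hτ
  -- A kernel vector a of A(t) gives a P-Jacobi field vanishing at t, hence identically zero. Its
  -- initial value and velocity then give π a = 0 and (1 - π) a = 0.
  have hAu : ∀ t ∈ Ioc 0 τ, IsUnit (A t) := by
    intro t ht
    refine isUnit_of_forall_eq_zero fun a ha => ?_
    have e1 : ∀ s ∈ Icc 0 τ, HasDerivWithinAt (fun s => A s a) (A₁ s a) (Icc 0 τ) s := fun s hs => by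
      simpa using (hA s hs).clm_apply (hasDerivWithinAt_const s (Icc 0 τ) a)
    have e2 : ∀ s ∈ Icc 0 τ, HasDerivWithinAt (fun s => A₁ s a) (R s (A s a)) (Icc 0 τ) s :=
      fun s hs => by
        simpa using (hA₁ s hs).clm_apply (hasDerivWithinAt_const s (Icc 0 τ) a)
    have hz := hfoc (fun s => A s a) (fun s => A₁ s a) e1 e2 (by simp only [hA0]; exact hπmem a)
      (fun w hw => by
        simp only [hA0, hA₁0, add_apply, mul_apply_eq_comp, sub_apply, one_apply_eq_self,
          add_sub_cancel_left]
        exact Submodule.starProjection_inner_eq_zero a w hw) t ht ha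
    have h0 : (0 : ℝ) ∈ Icc 0 τ := left_mem_Icc.2 hτ.le
    have z0 : π a = 0 := by simpa [hA0] using hz 0 h0
    have z1 : A₁ 0 a = 0 := by
      have h2 : HasDerivWithinAt (fun s => A s a) 0 (Icc 0 τ) 0 :=
        (hasDerivWithinAt_const (0 : ℝ) (Icc 0 τ) (0 : V)).congr hz (hz 0 h0)
      exact (huniq 0 h0).eq_deriv _ (e1 0 h0) h2
    simpa [hA₁0, z0] using z1
  set B : ℝ → V →L[ℝ] V := fun t => Ring.inverse (A t) with hB
  have hBc : ContinuousOn B (Ioc 0 τ) := by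
    intro t ht
    obtain ⟨u, hu⟩ := hAu t ht
    have h1 := (hA t (Ioc_subset_Icc_self ht)).continuousWithinAt.mono Ioc_subset_Icc_self
    refine ContinuousAt.comp_continuousWithinAt (g := Ring.inverse) ?_ h1
    rw [← hu]
    exact NormedRing.inverse_continuousAt u
  have hBd : ∀ t ∈ Ioo 0 τ, HasDerivAt B (-(B t * A₁ t * B t)) t := by
    intro t ht
    obtain ⟨u, hu⟩ := hAu t (Ioo_subset_Ioc_self ht)
    have h1 := hasDerivAt_of_Icc (hA t (Ioo_subset_Icc_self ht)) ht
    have h2 := hasFDerivAt_ringInverse (𝕜 := ℝ) u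
    rw [hu] at h2
    have h3 := h2.comp_hasDerivAt t h1
    convert! h3 using 1
    have : B t = ↑u⁻¹ := by simp only [hB, ← hu, Ring.inverse_unit]
    simp [this, mul_assoc]
  set f : ℝ → V := fun t => B t (x t) with hf
  have hAf : ∀ t ∈ Ioc 0 τ, A t (f t) = x t := fun t ht => apply_ringInverse_apply (hAu t ht) _
  set d : ℝ → V := fun t => x' t - A₁ t (f t) with hd
  have hfd : ∀ t ∈ Ioo 0 τ \ Z, HasDerivAt f (B t (d t)) t := by
    intro t ht
    convert! (hBd t ht.1).clm_apply (hxd t ht) using 1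
    simp only [hd, hf, map_sub, neg_apply, mul_apply_eq_comp]
    abel
  have hfc : ContinuousOn f (Ioc 0 τ) := hBc.clm_apply (hx.mono Ioc_subset_Icc_self)
  have hA₁c : ContinuousOn A₁ (Icc 0 τ) := fun t ht => (hA₁ t ht).continuousWithinAt
  have hA₁f : ContinuousOn (fun t => A₁ t (f t)) (Ioc 0 τ) :=
    (hA₁c.mono Ioc_subset_Icc_self).clm_apply hfc
  set φ : ℝ → ℝ := fun t => ⟪A₁ t (f t), x t⟫_ℝ with hφ
  have hφc : ContinuousOn φ (Ioc 0 τ) := hA₁f.inner (hx.mono Ioc_subset_Icc_self)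
  have hφd : ∀ t ∈ Ioo 0 τ \ Z, HasDerivAt φ (I t - ⟪d t, d t⟫_ℝ) t := by
    intro t ht
    have htI := Ioo_subset_Icc_self ht.1
    have h1 := ((hasDerivAt_of_Icc (hA₁ t htI) ht.1).clm_apply (hfd t ht)).inner ℝ (hxd t ht)
    convert! h1 using 1
    have hx' : x' t = A₁ t (f t) + d t := by simp [hd]
    -- Here f' = B d, and the Lagrangian identity moves A₁ to the other factor: ⟨A₁ B d, A f⟩ = ⟨A B
    -- d, A₁ f⟩. This cross term is what completes the square.
    have h2 : ⟪A₁ t (B t (d t)), x t⟫_ℝ = ⟪d t, A₁ t (f t)⟫_ℝ := by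
      rw [← hAf t (Ioo_subset_Ioc_self ht.1), ← hlag t htI,
        apply_ringInverse_apply (hAu t (Ioo_subset_Ioc_self ht.1))]
    rw [inner_add_left, h2, mul_apply_eq_comp, hAf t (Ioo_subset_Ioc_self ht.1)]
    simp only [hI]
    rw [hx', inner_add_left, inner_add_right, inner_add_right]
    ring
  -- integrability of the square on `[ε, τ]`
  have hdI : ∀ ε ∈ Ioc 0 τ, IntervalIntegrable (fun t => ⟪d t, d t⟫_ℝ) volume ε τ := by
    intro ε hε
    have hsub : Icc ε τ ⊆ Ioc 0 τ := fun t ht => ⟨hε.1.trans_le ht.1, ht.2⟩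
    obtain ⟨K, hK⟩ := (isCompact_Icc (a := ε) (b := τ)).exists_bound_of_continuousOn
      (hA₁f.mono hsub)
    have hdm : AEStronglyMeasurable d (volume.restrict (Icc ε τ)) :=
      (hm.mono_measure (Measure.restrict_mono (hsub.trans Ioc_subset_Icc_self) le_rfl)).sub
        ((hA₁f.mono hsub).aestronglyMeasurable measurableSet_Icc)
    refine intervalIntegrable_of_bound_off_countable (K := (C + K) * (C + K)) hε.2 hZ
      (hdm.inner hdm) ?_
    intro t ht
    have h1 : ‖d t‖ ≤ C + K := (norm_sub_le _ _).trans (add_le_add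
      (hC t ⟨⟨hε.1.trans ht.1.1, ht.1.2⟩, ht.2⟩) (hK t (Ioo_subset_Icc_self ht.1)))
    exact (norm_inner_le_norm _ _).trans
      (mul_le_mul h1 h1 (norm_nonneg _) ((norm_nonneg _).trans h1))
  have hIε : ∀ ε ∈ Ioc 0 τ, IntervalIntegrable I volume ε τ := fun ε hε =>
    hint.mono_set (by
      rw [uIcc_of_le hε.2, uIcc_of_le hτ.le]; exact Icc_subset_Icc_left hε.1.le)
  have hsq : ∀ ε ∈ Ioc 0 τ, ∫ t in ε..τ, ⟪d t, d t⟫_ℝ = (∫ t in ε..τ, I t) + φ ε := by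
    intro ε hε
    have hsub : Icc ε τ ⊆ Ioc 0 τ := fun t ht => ⟨hε.1.trans_le ht.1, ht.2⟩
    have h1 := integral_eq_of_hasDerivAt_off_countable_of_le φ (fun t => I t - ⟪d t, d t⟫_ℝ) hε.2 hZ
      (hφc.mono hsub) (fun t ht => hφd t ⟨⟨hε.1.trans ht.1.1, ht.1.2⟩, ht.2⟩)
      ((hIε ε hε).sub (hdI ε hε))
    rw [intervalIntegral.integral_sub (hIε ε hε) (hdI ε hε)] at h1
    have h2 : φ τ = 0 := by simp [hφ, hxτ]
    linarith
  have hlim : Tendsto (fun ε => ∫ t in ε..τ, ⟪d t, d t⟫_ℝ) (𝓝[>] 0)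
      (𝓝 ((∫ t in (0 : ℝ)..τ, I t) + ⟪S (x 0), x 0⟫_ℝ)) := by
    have h0 : (0 : ℝ) ∈ Icc 0 τ := left_mem_Icc.2 hτ.le
    have t1 := tendsto_boundary_term hτ (hA 0 h0) (hA₁c 0 h0) T S hA0 hA₁0 hAu (hx 0 h0) hLip hx0
    have t2 : Tendsto (fun ε => ∫ t in ε..τ, I t) (𝓝[>] 0) (𝓝 (∫ t in (0 : ℝ)..τ, I t)) := by
      have hc := intervalIntegral.continuousOn_primitive_interval_left (f := I) (μ := volume)
        (a := 0) (b := τ) (by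
          rw [uIcc_of_le hτ.le]
          exact (intervalIntegrable_iff_integrableOn_Icc_of_le hτ.le).1 hint)
      rw [uIcc_of_le hτ.le] at hc
      exact (hc 0 h0).tendsto.mono_left (nhdsGT_zero_le hτ)
    refine (t2.add t1).congr' ?_
    filter_upwards [Ioc_mem_nhdsGT hτ] with ε hε
    rw [hsq ε hε]
  have hnn : ∀ ε ∈ Ioc 0 τ, 0 ≤ ∫ t in ε..τ, ⟪d t, d t⟫_ℝ := fun ε hε =>
    intervalIntegral.integral_nonneg hε.2 fun t _ => real_inner_self_nonneg
  -- Monotonicity in ε bounds each truncated integral by the limit, so no integrability of |d|² up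
  -- to 0 is required.
  have hmono : ∀ ε ∈ Ioc 0 τ, ∀ δ ∈ Ioc 0 τ, δ ≤ ε →
      ∫ t in ε..τ, ⟪d t, d t⟫_ℝ ≤ ∫ t in δ..τ, ⟪d t, d t⟫_ℝ := by
    intro ε hε δ hδ hle
    exact intervalIntegral.integral_mono_interval hle hε.2 le_rfl
      (Eventually.of_forall fun t => real_inner_self_nonneg) (hdI δ hδ)
  have hge : ∀ ε ∈ Ioc 0 τ, ∫ t in ε..τ, ⟪d t, d t⟫_ℝ ≤
      (∫ t in (0 : ℝ)..τ, I t) + ⟪S (x 0), x 0⟫_ℝ := by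
    intro ε hε
    refine ge_of_tendsto hlim ?_
    filter_upwards [Ioc_mem_nhdsGT hε.1] with δ hδ
    exact hmono ε hε δ ⟨hδ.1, hδ.2.trans hε.2⟩ hδ.2
  by_contra hcon
  push Not at hcon
  -- A non-positive limit forces d = 0 almost everywhere on [ε, τ]; then f is constant there, and
  -- f(τ) = 0.
  have hzero : ∀ ε ∈ Ioc 0 τ, x ε = 0 := by
    intro ε hε
    have hsub : Icc ε τ ⊆ Ioc 0 τ := fun t ht => ⟨hε.1.trans_le ht.1, ht.2⟩
    have h1 : ∫ t in ε..τ, ⟪d t, d t⟫_ℝ = 0 := le_antisymm ((hge ε hε).trans hcon) (hnn ε hε)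
    have h2 := (intervalIntegral.integral_eq_zero_iff_of_le_of_nonneg_ae hε.2
      (Eventually.of_forall fun t => real_inner_self_nonneg) (hdI ε hε)).1 h1
    have h3 : (fun t => B t (d t)) =ᵐ[volume.restrict (Ioc ε τ)] fun _ => (0 : V) := by
      filter_upwards [h2] with t ht
      have : d t = 0 := inner_self_eq_zero (𝕜 := ℝ).1 ht
      rw [this, map_zero]
    have h4 : IntervalIntegrable (fun t => B t (d t)) volume ε τ := by
      rw [intervalIntegrable_iff_integrableOn_Ioc_of_le hε.2]
      exact (integrable_congr h3).2 (integrable_zero _ _ _)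
    have h5 := integral_eq_of_hasDerivAt_off_countable_of_le f (fun t => B t (d t)) hε.2 hZ
      (hfc.mono hsub) (fun t ht => hfd t ⟨⟨hε.1.trans ht.1.1, ht.1.2⟩, ht.2⟩) h4
    rw [intervalIntegral.integral_of_le hε.2, integral_congr_ae h3, integral_zero] at h5
    have h6 : f τ = 0 := by simp [hf, hxτ]
    rw [h6, zero_sub, eq_comm, neg_eq_zero] at h5
    rw [← hAf ε hε, h5, map_zero]
  obtain ⟨t, ht, hxt⟩ := hne
  rcases ht.1.eq_or_lt with h | h
  · have h0 : (0 : ℝ) ∈ Icc 0 τ := left_mem_Icc.2 hτ.le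
    have l1 := (hx 0 h0).tendsto.mono_left (nhdsGT_zero_le hτ)
    have l2 : Tendsto x (𝓝[>] 0) (𝓝 0) := by
      refine tendsto_const_nhds.congr' ?_
      filter_upwards [Ioc_mem_nhdsGT hτ] with s hs
      rw [hzero s hs]
    exact hxt (h ▸ tendsto_nhds_unique l1 l2)
  · exact hxt (hzero t ⟨h, ht.2⟩)

end EuclideanIndexForm

/-! ### Homogeneous functions on E × E: Euler relations, spray, connection and curvature. -/

section SprayCalculus

set_option maxSynthPendingDepth 4

open Filter

section Jets

variable {X : Type*} [NormedAddCommGroup X] [NormedSpace ℝ X]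

/-- The second derivative of a function. -/
def secondDeriv (f : X → ℝ) : X → X →L[ℝ] X →L[ℝ] ℝ := fderiv ℝ (fderiv ℝ f)

/-- The third derivative of a function. -/
def thirdDeriv (f : X → ℝ) : X → X →L[ℝ] X →L[ℝ] X →L[ℝ] ℝ := fderiv ℝ (secondDeriv f)

variable {f : X → ℝ} {U : Set X} (hU : IsOpen U) (hf : ContDiffOn ℝ 6 f U)
include hU hf

theorem contDiffOn_fderiv_five : ContDiffOn ℝ 5 (fderiv ℝ f) U :=
  hf.fderiv_of_isOpen hU (by norm_num)

theorem contDiffOn_secondDeriv : ContDiffOn ℝ 4 (secondDeriv f) U :=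
  (contDiffOn_fderiv_five hU hf).fderiv_of_isOpen hU (by norm_num)

theorem contDiffOn_thirdDeriv : ContDiffOn ℝ 3 (thirdDeriv f) U :=
  (contDiffOn_secondDeriv hU hf).fderiv_of_isOpen hU (by norm_num)

variable {z : X} (hz : z ∈ U)
include hz

theorem hasFDerivAt_of_potential : HasFDerivAt f (fderiv ℝ f z) z :=
  ((hf.contDiffAt (hU.mem_nhds hz)).differentiableAt (by norm_num)).hasFDerivAt

theorem hasFDerivAt_fderiv : HasFDerivAt (fderiv ℝ f) (secondDeriv f z) z :=
  (((contDiffOn_fderiv_five hU hf).contDiffAt (hU.mem_nhds hz)).differentiableAt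
    (by norm_num)).hasFDerivAt

theorem hasFDerivAt_secondDeriv : HasFDerivAt (secondDeriv f) (thirdDeriv f z) z :=
  (((contDiffOn_secondDeriv hU hf).contDiffAt (hU.mem_nhds hz)).differentiableAt
    (by norm_num)).hasFDerivAt

theorem hasFDerivAt_thirdDeriv : HasFDerivAt (thirdDeriv f) (fderiv ℝ (thirdDeriv f) z) z :=
  (((contDiffOn_thirdDeriv hU hf).contDiffAt (hU.mem_nhds hz)).differentiableAt
    (by norm_num)).hasFDerivAt

theorem secondDeriv_comm (a b : X) : secondDeriv f z a b = secondDeriv f z b a :=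
  ((hf.contDiffAt (hU.mem_nhds hz)).isSymmSndFDerivAt (by norm_num)) a b

theorem thirdDeriv_comm₁₂ (a b c : X) : thirdDeriv f z a b c = thirdDeriv f z b a c := by
  have : IsSymmSndFDerivAt ℝ (fderiv ℝ f) z :=
    ((contDiffOn_fderiv_five hU hf).contDiffAt (hU.mem_nhds hz)).isSymmSndFDerivAt (by norm_num)
  exact congrArg (fun L => L c) (this a b)

/-- Derivative in direction a of the symmetry of the second derivative, which holds on the whole
open set U. -/
theorem thirdDeriv_comm₂₃ (a b c : X) : thirdDeriv f z a b c = thirdDeriv f z a c b := by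
  have h1 : HasFDerivAt (fun x => secondDeriv f x b c)
      ((((thirdDeriv f z).flip b)).flip c) z := by
    have := ((hasFDerivAt_secondDeriv hU hf hz).clm_apply (hasFDerivAt_const b z)).clm_apply
      (hasFDerivAt_const c z)
    convert! this using 1
    ext v; simp
  have h2 : HasFDerivAt (fun x => secondDeriv f x c b)
      ((((thirdDeriv f z).flip c)).flip b) z := by
    have := ((hasFDerivAt_secondDeriv hU hf hz).clm_apply (hasFDerivAt_const c z)).clm_apply
      (hasFDerivAt_const b z)
    convert! this using 1
    ext v; simp
  have h3 : (fun x => secondDeriv f x b c) =ᶠ[𝓝 z] fun x => secondDeriv f x c b := by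
    filter_upwards [hU.mem_nhds hz] with x hx using secondDeriv_comm hU hf hx b c
  exact congrArg (fun L : X →L[ℝ] ℝ => L a) (h1.unique (h2.congr_of_eventuallyEq h3))

end Jets

theorem hasFDerivAt_bilin_apply {X Y Z W : Type*} [NormedAddCommGroup X] [NormedSpace ℝ X]
    [NormedAddCommGroup Y] [NormedSpace ℝ Y] [NormedAddCommGroup Z] [NormedSpace ℝ Z]
    [NormedAddCommGroup W] [NormedSpace ℝ W]
    {B : X → Y →L[ℝ] Z →L[ℝ] W} {B' : X →L[ℝ] Y →L[ℝ] Z →L[ℝ] W}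
    {a : X → Y} {a' : X →L[ℝ] Y} {b : X → Z} {b' : X →L[ℝ] Z} {z : X}
    (hB : HasFDerivAt B B' z) (ha : HasFDerivAt a a' z) (hb : HasFDerivAt b b' z) :
    ∃ L : X →L[ℝ] W, HasFDerivAt (fun x => B x (a x) (b x)) L z ∧
      ∀ v, L v = B' v (a z) (b z) + B z (a' v) (b z) + B z (a z) (b' v) := by
  refine ⟨_, (hB.clm_apply ha).clm_apply hb, fun v => ?_⟩
  simp
  abel

variable {E : Type*} [NormedAddCommGroup E] [NormedSpace ℝ E]

/-- `ℓ` is a function on `U ⊆ E × E` which is positively homogeneous of degree two with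
nondegenerate Hessian in the second variable. -/
structure IsConicPotential (ℓ : E × E → ℝ) (U : Set (E × E)) : Prop where
  isOpen : IsOpen U
  contDiffOn : ContDiffOn ℝ 6 ℓ U
  homogeneous : ∀ z ∈ U, ∀ᶠ c in 𝓝 (1 : ℝ), ℓ (z.1, c • z.2) = c ^ 2 * ℓ z
  nondegenerate : ∀ z ∈ U, ∀ u : E, (∀ w : E, secondDeriv ℓ z (0, u) (0, w) = 0) → u = 0

/-- The spray coefficients `H` of `ℓ`: the geodesic equation is `x'' + H(x, x') = 0`. -/
structure IsSpray (ℓ : E × E → ℝ) (U : Set (E × E)) (H : E × E → E) : Prop where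
  contDiffOn : ContDiffOn ℝ 3 H U
  eq : ∀ z ∈ U, ∀ w : E, secondDeriv ℓ z (0, H z) (0, w) =
    secondDeriv ℓ z (z.2, 0) (0, w) - fderiv ℝ ℓ z (w, 0)

/-- The nonlinear connection of a spray. -/
def sprayConn (H : E × E → E) (z : E × E) : E →L[ℝ] E :=
  (1 / 2 : ℝ) • (fderiv ℝ H z).comp (ContinuousLinearMap.inr ℝ E E)

theorem sprayConn_apply (H : E × E → E) (z : E × E) (η : E) :
    sprayConn H z η = (1 / 2 : ℝ) • fderiv ℝ H z (0, η) := by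
  simp [sprayConn]

/-- The Riemann curvature of a spray. -/
def sprayCurv (H : E × E → E) (z : E × E) (η : E) : E :=
  (1 / 2 : ℝ) • fderiv ℝ (fderiv ℝ H) z (z.2, -H z) (0, η) - fderiv ℝ H z (η, 0)
    + sprayConn H z (sprayConn H z η)

namespace IsConicPotential

variable {ℓ : E × E → ℝ} {U : Set (E × E)} (hℓ : IsConicPotential ℓ U)
include hℓ

theorem euler {z : E × E} (hz : z ∈ U) : fderiv ℝ ℓ z (0, z.2) = 2 * ℓ z := by
  have h1 : HasDerivAt (fun c : ℝ => (z.1, c • z.2)) ((0, z.2) : E × E) 1 := by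
    have := (hasDerivAt_const (1 : ℝ) z.1).prodMk ((hasDerivAt_id (1 : ℝ)).smul_const z.2)
    simpa using this
  have h2 := hasFDerivAt_of_potential hℓ.isOpen hℓ.contDiffOn hz
  have h3 : HasFDerivAt ℓ (fderiv ℝ ℓ z) ((fun c : ℝ => (z.1, c • z.2)) 1) := by simpa using h2
  have h4 := h3.comp_hasDerivAt (1 : ℝ) h1
  have h5 : HasDerivAt (fun c : ℝ => c ^ 2 * ℓ z) (2 * ℓ z) 1 := by
    simpa using (hasDerivAt_pow 2 (1 : ℝ)).mul_const (ℓ z)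
  exact h4.unique (h5.congr_of_eventuallyEq (hℓ.homogeneous z hz))

/-- Euler's relation dℓ(0, y) = 2ℓ differentiated in direction a; the second term on the left comes
from the dependence of the argument on y. -/
theorem euler₂ {z : E × E} (hz : z ∈ U) (a : E × E) :
    secondDeriv ℓ z a (0, z.2) + fderiv ℝ ℓ z (0, a.2) = 2 * fderiv ℝ ℓ z a := by
  have h1 := hasFDerivAt_fderiv hℓ.isOpen hℓ.contDiffOn hz
  have h2 := h1.clm_apply
    ((ContinuousLinearMap.inr ℝ E E).hasFDerivAt.comp z (hasFDerivAt_snd (𝕜 := ℝ) (p := z)))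
  have h3 := (hasFDerivAt_of_potential hℓ.isOpen hℓ.contDiffOn hz).const_mul 2
  have h4 : (fun x : E × E => fderiv ℝ ℓ x (0, x.2)) =ᶠ[𝓝 z] fun x => 2 * ℓ x := by
    filter_upwards [hℓ.isOpen.mem_nhds hz] with x hx using hℓ.euler hx
  have h5 := congrArg (fun L : (E × E) →L[ℝ] ℝ => L a) (h2.unique (h3.congr_of_eventuallyEq h4))
  simp at h5
  linarith

theorem euler₃ {z : E × E} (hz : z ∈ U) (a b : E × E) :
    thirdDeriv ℓ z b a (0, z.2) + secondDeriv ℓ z a (0, b.2) + secondDeriv ℓ z b (0, a.2) =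
      2 * secondDeriv ℓ z b a := by
  obtain ⟨L, hL, hLv⟩ := hasFDerivAt_bilin_apply
    (hasFDerivAt_secondDeriv hℓ.isOpen hℓ.contDiffOn hz) (hasFDerivAt_const a z)
    ((ContinuousLinearMap.inr ℝ E E).hasFDerivAt.comp z (hasFDerivAt_snd (𝕜 := ℝ) (p := z)))
  have h1 := hasFDerivAt_fderiv hℓ.isOpen hℓ.contDiffOn hz
  have h2 := hL.add (h1.clm_apply (hasFDerivAt_const ((0, a.2) : E × E) z))
  have h3 := (h1.clm_apply (hasFDerivAt_const a z)).const_mul 2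
  have h4 : (fun x : E × E => secondDeriv ℓ x a (0, x.2) + fderiv ℝ ℓ x (0, a.2)) =ᶠ[𝓝 z]
      fun x => 2 * fderiv ℝ ℓ x a := by
    filter_upwards [hℓ.isOpen.mem_nhds hz] with x hx using hℓ.euler₂ hx a
  have h5 := congrArg (fun L : (E × E) →L[ℝ] ℝ => L b) (h2.unique (h3.congr_of_eventuallyEq h4))
  simp [hLv] at h5
  linarith

/-- This is the vanishing of the Cartan tensor on y, a consequence of the 0-homogeneity of the
vertical Hessian. -/
theorem thirdDeriv_vertical {z : E × E} (hz : z ∈ U) (u w : E) :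
    thirdDeriv ℓ z (0, w) (0, u) (0, z.2) = 0 := by
  have := hℓ.euler₃ hz (0, u) (0, w)
  have h2 := secondDeriv_comm hℓ.isOpen hℓ.contDiffOn hz (0, u) (0, w)
  simp only at this
  linarith

theorem thirdDeriv_horizontal {z : E × E} (hz : z ∈ U) (u w : E) :
    thirdDeriv ℓ z (w, 0) (0, u) (0, z.2) = secondDeriv ℓ z (w, 0) (0, u) := by
  have := hℓ.euler₃ hz (0, u) (w, 0)
  have h2 : secondDeriv ℓ z (0, u) (0, 0) = 0 := by
    rw [show ((0, 0) : E × E) = 0 from rfl, map_zero]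
  simp only at this
  linarith

theorem secondDeriv_horizontal {z : E × E} (hz : z ∈ U) (w : E) :
    secondDeriv ℓ z (w, 0) (0, z.2) = 2 * fderiv ℝ ℓ z (w, 0) := by
  have := hℓ.euler₂ hz (w, 0)
  have h2 : fderiv ℝ ℓ z (0, 0) = 0 := by
    rw [show ((0, 0) : E × E) = 0 from rfl, map_zero]
  simp only at this
  linarith

end IsConicPotential

namespace IsSpray

variable {ℓ : E × E → ℝ} {U : Set (E × E)} {H : E × E → E} (hH : IsSpray ℓ U H)
  (hℓ : IsConicPotential ℓ U)
include hH hℓ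

theorem hasFDerivAt {z : E × E} (hz : z ∈ U) : HasFDerivAt H (fderiv ℝ H z) z :=
  ((hH.contDiffOn.contDiffAt (hℓ.isOpen.mem_nhds hz)).differentiableAt (by norm_num)).hasFDerivAt

theorem contDiffOn_fderiv : ContDiffOn ℝ 2 (fderiv ℝ H) U :=
  hH.contDiffOn.fderiv_of_isOpen hℓ.isOpen (by norm_num)

theorem hasFDerivAt_fderiv {z : E × E} (hz : z ∈ U) :
    HasFDerivAt (fderiv ℝ H) (fderiv ℝ (fderiv ℝ H) z) z :=
  (((hH.contDiffOn_fderiv hℓ).contDiffAt (hℓ.isOpen.mem_nhds hz)).differentiableAt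
    (by norm_num)).hasFDerivAt

/-- The spray is defined implicitly through the Hessian, so its derivative is reached by
differentiating that equation. The terms containing the derivative of the Hessian combine into the
third derivative in the direction (y, -H) of the spray. -/
theorem eq_deriv {z : E × E} (hz : z ∈ U) (v : E × E) (w : E) :
    secondDeriv ℓ z (0, fderiv ℝ H z v) (0, w) =
      thirdDeriv ℓ z v (z.2, -H z) (0, w) + secondDeriv ℓ z (v.2, 0) (0, w)
        - secondDeriv ℓ z v (w, 0) := by
  have hD := hasFDerivAt_secondDeriv hℓ.isOpen hℓ.contDiffOn hz
  obtain ⟨L, hL, hLv⟩ := hasFDerivAt_bilin_apply hD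
    ((ContinuousLinearMap.inr ℝ E E).hasFDerivAt.comp z (hH.hasFDerivAt hℓ hz))
    (hasFDerivAt_const ((0, w) : E × E) z)
  obtain ⟨M, hM, hMv⟩ := hasFDerivAt_bilin_apply hD
    ((ContinuousLinearMap.inl ℝ E E).hasFDerivAt.comp z (hasFDerivAt_snd (𝕜 := ℝ) (p := z)))
    (hasFDerivAt_const ((0, w) : E × E) z)
  have h3 := hM.sub ((_root_.hasFDerivAt_fderiv hℓ.isOpen hℓ.contDiffOn hz).clm_apply
    (hasFDerivAt_const ((w, 0) : E × E) z))
  have h4 : (fun x : E × E => secondDeriv ℓ x (0, H x) (0, w)) =ᶠ[𝓝 z]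
      fun x => secondDeriv ℓ x (x.2, 0) (0, w) - fderiv ℝ ℓ x (w, 0) := by
    filter_upwards [hℓ.isOpen.mem_nhds hz] with x hx using hH.eq x hx w
  have h5 := congrArg (fun L : (E × E) →L[ℝ] ℝ => L v) (hL.unique (h3.congr_of_eventuallyEq h4))
  simp [hLv, hMv] at h5
  have h6 : thirdDeriv ℓ z v (z.2, -H z) (0, w) =
      thirdDeriv ℓ z v (z.2, 0) (0, w) - thirdDeriv ℓ z v (0, H z) (0, w) := by
    rw [show ((z.2, -H z) : E × E) = (z.2, 0) - (0, H z) by simp, map_sub]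
    rfl
  linarith

theorem conn_eq {z : E × E} (hz : z ∈ U) (η w : E) :
    secondDeriv ℓ z (0, sprayConn H z η) (0, w) =
      (1 / 2) * (thirdDeriv ℓ z (z.2, -H z) (0, η) (0, w) + secondDeriv ℓ z (η, 0) (0, w)
        - secondDeriv ℓ z (w, 0) (0, η)) := by
  have h := hH.eq_deriv hℓ hz (0, η) w
  rw [thirdDeriv_comm₁₂ hℓ.isOpen hℓ.contDiffOn hz,
    secondDeriv_comm hℓ.isOpen hℓ.contDiffOn hz (0, η) (w, 0)] at h
  have e : ((0, sprayConn H z η) : E × E) = (1 / 2 : ℝ) • (0, fderiv ℝ H z (0, η)) := by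
    simp [sprayConn_apply]
  rw [e, map_smul, smul_apply, h, smul_eq_mul]

/-- In `conn_eq` the mixed second derivatives are skew in η and w, so they cancel in the symmetric
sum. What remains says that g is parallel along integral curves of the spray. -/
theorem conn_add_conn {z : E × E} (hz : z ∈ U) (η w : E) :
    secondDeriv ℓ z (0, sprayConn H z η) (0, w) + secondDeriv ℓ z (0, η) (0, sprayConn H z w) =
      thirdDeriv ℓ z (z.2, -H z) (0, η) (0, w) := by
  rw [secondDeriv_comm hℓ.isOpen hℓ.contDiffOn hz (0, η), hH.conn_eq hℓ hz, hH.conn_eq hℓ hz,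
    thirdDeriv_comm₂₃ hℓ.isOpen hℓ.contDiffOn hz _ (0, w)]
  ring

/-- `sprayCurv` is the operator in D D J = R J, the linearization of x'' + H(x, x') = 0. Its lowered
form is computed by differentiating `conn_eq` along the spray and inserting `eq_deriv` for the
horizontal derivative of H; every term of the outcome is symmetric in η and w. -/
theorem curv_symm {z : E × E} (hz : z ∈ U) (η w : E) :
    secondDeriv ℓ z (0, sprayCurv H z η) (0, w) = secondDeriv ℓ z (0, sprayCurv H z w) (0, η) := by
  have hU := hℓ.isOpen
  have hc := hℓ.contDiffOn
  have hD2 := hasFDerivAt_secondDeriv hU hc hz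
  have hD3 := hasFDerivAt_thirdDeriv hU hc hz
  set S : E × E := (z.2, -H z) with hS
  have hSd : HasFDerivAt (fun x : E × E => (x.2, -H x))
      ((ContinuousLinearMap.snd ℝ E E).prod (-fderiv ℝ H z)) z :=
    (hasFDerivAt_snd (𝕜 := ℝ) (p := z)).prodMk (hH.hasFDerivAt hℓ hz).neg
  -- the derivative along the spray of the derivative of the metric
  have hk : ∀ η w : E, ∃ K : (E × E) →L[ℝ] ℝ,
      HasFDerivAt (fun x : E × E => thirdDeriv ℓ x (x.2, -H x) (0, η) (0, w)) K z := by
    intro η w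
    obtain ⟨L, hL, -⟩ := hasFDerivAt_bilin_apply hD3 hSd (hasFDerivAt_const ((0, η) : E × E) z)
    exact ⟨_, hL.clm_apply (hasFDerivAt_const ((0, w) : E × E) z)⟩
  have hNd : ∀ η : E, HasFDerivAt (fun x => sprayConn H x η)
      ((1 / 2 : ℝ) • ((fderiv ℝ (fderiv ℝ H) z).flip (0, η))) z := by
    intro η
    have h := ((hH.hasFDerivAt_fderiv hℓ hz).clm_apply
      (hasFDerivAt_const ((0, η) : E × E) z)).const_smul (1 / 2 : ℝ)
    simp only [sprayConn_apply]
    convert! h using 1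
    ext v <;> simp
  -- The derivative K of the derivative of g along the spray is kept abstract. Exchanging η and w
  -- leaves the differentiated function unchanged near z, so the same K serves both orders and no
  -- fourth derivative has to be expanded.
  have key : ∀ η w : E, ∀ K : (E × E) →L[ℝ] ℝ,
      HasFDerivAt (fun x : E × E => thirdDeriv ℓ x (x.2, -H x) (0, η) (0, w)) K z →
      secondDeriv ℓ z (0, sprayCurv H z η) (0, w) =
        (1 / 2) * K S - (1 / 2) * (thirdDeriv ℓ z S (η, 0) (0, w) + thirdDeriv ℓ z S (w, 0) (0, η))
          + secondDeriv ℓ z (η, 0) (w, 0)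
          - secondDeriv ℓ z (0, sprayConn H z w) (0, sprayConn H z η) := by
    intro η w K hK
    obtain ⟨L, hL, hLv⟩ := hasFDerivAt_bilin_apply hD2
      ((ContinuousLinearMap.inr ℝ E E).hasFDerivAt.comp z (hNd η))
      (hasFDerivAt_const ((0, w) : E × E) z)
    obtain ⟨M, hM, hMv⟩ := hasFDerivAt_bilin_apply hD2 (hasFDerivAt_const ((η, 0) : E × E) z)
      (hasFDerivAt_const ((0, w) : E × E) z)
    obtain ⟨M', hM', hMv'⟩ := hasFDerivAt_bilin_apply hD2 (hasFDerivAt_const ((w, 0) : E × E) z)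
      (hasFDerivAt_const ((0, η) : E × E) z)
    have h3 := ((hK.add hM).sub hM').const_mul (1 / 2)
    have h4 : (fun x : E × E => secondDeriv ℓ x (0, sprayConn H x η) (0, w)) =ᶠ[𝓝 z]
        fun x => (1 / 2) * (thirdDeriv ℓ x (x.2, -H x) (0, η) (0, w)
          + secondDeriv ℓ x (η, 0) (0, w) - secondDeriv ℓ x (w, 0) (0, η)) := by
      filter_upwards [hU.mem_nhds hz] with x hx using hH.conn_eq hℓ hx η w
    have h5 := congrArg (fun L : (E × E) →L[ℝ] ℝ => L S) (hL.unique (h3.congr_of_eventuallyEq h4))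
    simp [hLv, hMv, hMv'] at h5
    have h6 := hH.eq_deriv hℓ hz (η, 0) w
    rw [thirdDeriv_comm₁₂ hU hc hz, ← hS] at h6
    have h8 : secondDeriv ℓ z (((η, 0) : E × E).2, 0) (0, w) = 0 := by
      rw [show (((η, 0) : E × E).2, (0 : E)) = 0 from rfl, map_zero]; rfl
    have h9 := hH.conn_eq hℓ hz (sprayConn H z η) w
    have h10 := hH.conn_eq hℓ hz w (sprayConn H z η)
    rw [← hS] at h9 h10
    rw [thirdDeriv_comm₂₃ hU hc hz _ (0, w)] at h10
    have e : ((0, sprayCurv H z η) : E × E) =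
        (0, (2 : ℝ)⁻¹ • fderiv ℝ (fderiv ℝ H) z S (0, η)) - (0, fderiv ℝ H z (η, 0))
          + (0, sprayConn H z (sprayConn H z η)) := by
      simp [sprayCurv, hS]
    rw [e, map_add, map_sub, add_apply, sub_apply]
    rw [h8] at h6
    linarith
  obtain ⟨K, hK⟩ := hk η w
  have hK' : HasFDerivAt (fun x : E × E => thirdDeriv ℓ x (x.2, -H x) (0, w) (0, η)) K z := by
    refine hK.congr_of_eventuallyEq ?_
    filter_upwards [hU.mem_nhds hz] with x hx using thirdDeriv_comm₂₃ hU hc hx _ _ _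
  rw [key η w K hK, key w η K hK', secondDeriv_comm hU hc hz (w, 0) (η, 0),
    secondDeriv_comm hU hc hz (0, sprayConn H z w) (0, sprayConn H z η)]
  ring

end IsSpray

end SprayCalculus

/-! ### Behaviour of spray, connection and curvature under a change of coordinates. -/

section SprayTransformation

set_option maxSynthPendingDepth 4

open Filter

variable {E : Type*} [NormedAddCommGroup E] [NormedSpace ℝ E]

/-- The tangent map of `φ : E → E` on `E × E`. -/
def tangentLift (φ : E → E) (z : E × E) : E × E := (φ z.1, fderiv ℝ φ z.1 z.2)

/-- `φ` is a change of coordinates on the projection of the open set `U` whose tangent map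
carries `ℓ` to `ℓ'`. -/
structure IsCoordChange (ℓ ℓ' : E × E → ℝ) (U U' : Set (E × E)) (φ : E → E) : Prop where
  contDiffAt : ∀ z ∈ U, ContDiffAt ℝ 7 φ z.1
  surjective : ∀ z ∈ U, Function.Surjective (fderiv ℝ φ z.1)
  mapsTo : ∀ z ∈ U, tangentLift φ z ∈ U'
  eq : ∀ z ∈ U, ℓ z = ℓ' (tangentLift φ z)

variable {φ : E → E}

theorem hasFDerivAt_tangentLift {z : E × E} (h : ContDiffAt ℝ 7 φ z.1) :
    ∃ L : (E × E) →L[ℝ] E × E, HasFDerivAt (tangentLift φ) L z ∧ ∀ v : E × E,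
      L v = (fderiv ℝ φ z.1 v.1, fderiv ℝ (fderiv ℝ φ) z.1 v.1 z.2 + fderiv ℝ φ z.1 v.2) := by
  have h1 := (h.differentiableAt (by norm_num)).hasFDerivAt
  have h2 := ((h.fderiv_right (m := 6) (by norm_num)).differentiableAt (by norm_num)).hasFDerivAt
  have hf := hasFDerivAt_fst (𝕜 := ℝ) (p := z)
  have hs := hasFDerivAt_snd (𝕜 := ℝ) (p := z)
  refine ⟨_, (h1.comp z hf).prodMk ((h2.comp z hf).clm_apply hs), fun v => ?_⟩
  simp [add_comm]

theorem hasFDerivAt_second_of_contDiffAt {x : E} (h : ContDiffAt ℝ 7 φ x) :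
    HasFDerivAt (fderiv ℝ φ) (fderiv ℝ (fderiv ℝ φ) x) x :=
  ((h.fderiv_right (m := 6) (by norm_num)).differentiableAt (by norm_num)).hasFDerivAt

theorem hasFDerivAt_third_of_contDiffAt {x : E} (h : ContDiffAt ℝ 7 φ x) :
    HasFDerivAt (fderiv ℝ (fderiv ℝ φ)) (fderiv ℝ (fderiv ℝ (fderiv ℝ φ)) x) x :=
  (((h.fderiv_right (m := 6) (by norm_num)).fderiv_right (m := 5) (by norm_num)).differentiableAt
    (by norm_num)).hasFDerivAt

namespace IsCoordChange

variable {ℓ ℓ' : E × E → ℝ} {U U' : Set (E × E)} (hφ : IsCoordChange ℓ ℓ' U U' φ)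
  (hℓ : IsConicPotential ℓ U) (hℓ' : IsConicPotential ℓ' U')
include hφ

omit hφ in
theorem symm₂ {x : E} (h : ContDiffAt ℝ 7 φ x) (a b : E) :
    fderiv ℝ (fderiv ℝ φ) x a b = fderiv ℝ (fderiv ℝ φ) x b a :=
  (h.isSymmSndFDerivAt (by norm_num)) a b

omit hφ in
theorem symm₃ {x : E} (h : ContDiffAt ℝ 7 φ x) (a b c : E) :
    fderiv ℝ (fderiv ℝ (fderiv ℝ φ)) x a b c = fderiv ℝ (fderiv ℝ (fderiv ℝ φ)) x b a c := by
  have : IsSymmSndFDerivAt ℝ (fderiv ℝ φ) x :=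
    (h.fderiv_right (m := 6) (by norm_num)).isSymmSndFDerivAt (by norm_num)
  exact congrArg (fun L => L c) (this a b)

include hℓ hℓ'

theorem fderiv_eq {z : E × E} (hz : z ∈ U) (v : E × E) :
    fderiv ℝ ℓ z v = fderiv ℝ ℓ' (tangentLift φ z)
      (fderiv ℝ φ z.1 v.1, fderiv ℝ (fderiv ℝ φ) z.1 v.1 z.2 + fderiv ℝ φ z.1 v.2) := by
  obtain ⟨L, hL, hLv⟩ := hasFDerivAt_tangentLift (hφ.contDiffAt z hz)
  have h1 := (hasFDerivAt_of_potential hℓ'.isOpen hℓ'.contDiffOn (hφ.mapsTo z hz)).comp z hL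
  have h2 : ℓ =ᶠ[𝓝 z] ℓ' ∘ tangentLift φ := by
    filter_upwards [hℓ.isOpen.mem_nhds hz] with x hx using hφ.eq x hx
  rw [(h1.congr_of_eventuallyEq h2).fderiv, ContinuousLinearMap.comp_apply, hLv]

/-- The second slot is kept vertical, since the equation of the spray is tested against vertical
vectors only. -/
theorem secondDeriv_eq {z : E × E} (hz : z ∈ U) (v : E × E) (w : E) :
    secondDeriv ℓ z v (0, w) = secondDeriv ℓ' (tangentLift φ z)
      (fderiv ℝ φ z.1 v.1, fderiv ℝ (fderiv ℝ φ) z.1 v.1 z.2 + fderiv ℝ φ z.1 v.2)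
      (0, fderiv ℝ φ z.1 w) +
      fderiv ℝ ℓ' (tangentLift φ z) (0, fderiv ℝ (fderiv ℝ φ) z.1 v.1 w) := by
  obtain ⟨L, hL, hLv⟩ := hasFDerivAt_tangentLift (hφ.contDiffAt z hz)
  have h0 := (hasFDerivAt_second_of_contDiffAt (hφ.contDiffAt z hz)).comp z
    (hasFDerivAt_fst (𝕜 := ℝ) (p := z))
  have h1 := ((hasFDerivAt_fderiv hℓ'.isOpen hℓ'.contDiffOn (hφ.mapsTo z hz)).comp z hL).clm_apply
    ((ContinuousLinearMap.inr ℝ E E).hasFDerivAt.comp z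
      (h0.clm_apply (hasFDerivAt_const w z)))
  have h2 := (hasFDerivAt_fderiv hℓ.isOpen hℓ.contDiffOn hz).clm_apply
    (hasFDerivAt_const ((0, w) : E × E) z)
  have h3 : (fun x : E × E => fderiv ℝ ℓ x (0, w)) =ᶠ[𝓝 z]
      fun x => fderiv ℝ ℓ' (tangentLift φ x) (0, fderiv ℝ φ x.1 w) := by
    filter_upwards [hℓ.isOpen.mem_nhds hz] with x hx
    simpa using hφ.fderiv_eq hℓ hℓ' hx (0, w)
  have h5 := congrArg (fun L : (E × E) →L[ℝ] ℝ => L v) (h2.unique (h1.congr_of_eventuallyEq h3))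
  simp [hLv] at h5
  rw [h5, add_comm]

variable {H H' : E × E → E} (hH : IsSpray ℓ U H) (hH' : IsSpray ℓ' U' H')
include hH hH'

/-- Both sides have the same Hessian products with the vectors φ'(w), which exhaust E by
surjectivity; nondegeneracy then identifies them. -/
theorem spray_eq {z : E × E} (hz : z ∈ U) :
    H' (tangentLift φ z) = fderiv ℝ φ z.1 (H z) - fderiv ℝ (fderiv ℝ φ) z.1 z.2 z.2 := by
  have hp := hφ.mapsTo z hz
  set A := fderiv ℝ φ z.1 with hA
  set D := fderiv ℝ (fderiv ℝ φ) z.1 with hD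
  rw [← sub_eq_zero]
  refine hℓ'.nondegenerate _ hp _ fun w' => ?_
  obtain ⟨w, rfl⟩ := hφ.surjective z hz w'
  have h1 := hφ.secondDeriv_eq hℓ hℓ' hz (z.2, -H z) w
  have h2 := hφ.fderiv_eq hℓ hℓ' hz (w, 0)
  have h3 := hH.eq z hz w
  have h4 := hH'.eq _ hp (A w)
  have e1 : ((z.2, -H z) : E × E) = (z.2, 0) - (0, H z) := by simp
  rw [e1, map_sub, sub_apply, ← e1, h3, sub_sub_cancel] at h1
  simp only [map_zero, add_zero] at h2
  rw [symm₂ (hφ.contDiffAt z hz) w z.2] at h2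
  rw [← hA, ← hD] at h1 h2
  have e2 : ((A w, D z.2 w) : E × E) = (A w, 0) + (0, D z.2 w) := by simp
  rw [e2, map_add] at h2
  have e3 : ((A (z.2, -H z).1, D (z.2, -H z).1 z.2 + A (z.2, -H z).2) : E × E)
      = ((tangentLift φ z).2, 0) - (0, A (H z) - D z.2 z.2) := by
    simp [tangentLift, hA]
    exact (sub_eq_add_neg _ _).symm
  have e4 : ((0, H' (tangentLift φ z) - (A (H z) - D z.2 z.2)) : E × E) =
    (0, H' (tangentLift φ z)) - (0, A (H z) - D z.2 z.2) := by simp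
  rw [e3, map_sub, sub_apply] at h1
  rw [← hA, e4, map_sub, sub_apply, h4]
  linarith

theorem spray_deriv_eq {z : E × E} (hz : z ∈ U) (v : E × E) :
    fderiv ℝ H' (tangentLift φ z)
      (fderiv ℝ φ z.1 v.1, fderiv ℝ (fderiv ℝ φ) z.1 v.1 z.2 + fderiv ℝ φ z.1 v.2) =
    fderiv ℝ (fderiv ℝ φ) z.1 v.1 (H z) + fderiv ℝ φ z.1 (fderiv ℝ H z v)
      - fderiv ℝ (fderiv ℝ (fderiv ℝ φ)) z.1 v.1 z.2 z.2
      - 2 • fderiv ℝ (fderiv ℝ φ) z.1 z.2 v.2 := by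
  have hc := hφ.contDiffAt z hz
  obtain ⟨L, hL, hLv⟩ := hasFDerivAt_tangentLift hc
  have hf := hasFDerivAt_fst (𝕜 := ℝ) (p := z)
  have hs := hasFDerivAt_snd (𝕜 := ℝ) (p := z)
  have h1 := (hH'.hasFDerivAt hℓ' (hφ.mapsTo z hz)).comp z hL
  have h2 := ((hasFDerivAt_second_of_contDiffAt hc).comp z hf).clm_apply (hH.hasFDerivAt hℓ hz)
  obtain ⟨M, hM, hMv⟩ := hasFDerivAt_bilin_apply ((hasFDerivAt_third_of_contDiffAt hc).comp z hf)
    hs hs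
  have h3 : (H' ∘ tangentLift φ) =ᶠ[𝓝 z]
      fun x => fderiv ℝ φ x.1 (H x) - fderiv ℝ (fderiv ℝ φ) x.1 x.2 x.2 := by
    filter_upwards [hℓ.isOpen.mem_nhds hz] with x hx using hφ.spray_eq hℓ hℓ' hH hH' hx
  have h5 := congrArg (fun L : (E × E) →L[ℝ] E => L v)
    (h1.unique ((h2.sub hM).congr_of_eventuallyEq h3))
  simp [hLv, hMv] at h5
  rw [h5, symm₂ hc v.2 z.2, two_smul]
  abel

/-- Half the vertical derivative of the law of the spray. The inhomogeneous term φ''(y, η) is the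
usual one for a connection. -/
theorem conn_eq {z : E × E} (hz : z ∈ U) (η : E) :
    sprayConn H' (tangentLift φ z) (fderiv ℝ φ z.1 η) =
      fderiv ℝ φ z.1 (sprayConn H z η) - fderiv ℝ (fderiv ℝ φ) z.1 z.2 η := by
  have h := hφ.spray_deriv_eq hℓ hℓ' hH hH' hz (0, η)
  simp only [map_zero, zero_apply, zero_add, sub_zero] at h
  rw [sprayConn_apply, h, sprayConn_apply, map_smul, smul_sub, ← Nat.cast_smul_eq_nsmul ℝ,
    smul_smul]
  norm_num

/-- Tensoriality of the curvature. Differentiating the law of the connection along the spray and the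
law of the spray horizontally produces second and third derivatives of φ, which cancel in the
combination defining `sprayCurv`. -/
theorem curv_eq {z : E × E} (hz : z ∈ U) (η : E) :
    sprayCurv H' (tangentLift φ z) (fderiv ℝ φ z.1 η) = fderiv ℝ φ z.1 (sprayCurv H z η) := by
  have hc := hφ.contDiffAt z hz
  have hp := hφ.mapsTo z hz
  obtain ⟨L, hL, hLv⟩ := hasFDerivAt_tangentLift hc
  have hf := hasFDerivAt_fst (𝕜 := ℝ) (p := z)
  have hs := hasFDerivAt_snd (𝕜 := ℝ) (p := z)
  set A := fderiv ℝ φ z.1 with hA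
  set D := fderiv ℝ (fderiv ℝ φ) z.1 with hD
  set T := fderiv ℝ (fderiv ℝ (fderiv ℝ φ)) z.1 with hT
  set p := tangentLift φ z with hpdef
  have hAd := (hasFDerivAt_second_of_contDiffAt hc).comp z hf
  have hDd := (hasFDerivAt_third_of_contDiffAt hc).comp z hf
  -- the transformation law of the connection, differentiated along the spray
  have h1 := ((hH'.hasFDerivAt_fderiv hℓ' hp).comp z hL).clm_apply
    ((ContinuousLinearMap.inr ℝ E E).hasFDerivAt.comp z (hAd.clm_apply (hasFDerivAt_const η z)))
  have h2 := hAd.clm_apply ((hH.hasFDerivAt_fderiv hℓ hz).clm_apply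
    (hasFDerivAt_const ((0, η) : E × E) z))
  obtain ⟨M, hM, hMv⟩ := hasFDerivAt_bilin_apply hDd hs (hasFDerivAt_const η z)
  have h3 : (fun x : E × E => fderiv ℝ H' (tangentLift φ x) (0, fderiv ℝ φ x.1 η)) =ᶠ[𝓝 z]
      fun x => fderiv ℝ φ x.1 (fderiv ℝ H x (0, η))
        - (2 : ℝ) • fderiv ℝ (fderiv ℝ φ) x.1 x.2 η := by
    filter_upwards [hℓ.isOpen.mem_nhds hz] with x hx
    have := hφ.spray_deriv_eq hℓ hℓ' hH hH' hx (0, η)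
    simp only [map_zero, zero_apply, zero_add, sub_zero] at this
    rw [this, ← Nat.cast_smul_eq_nsmul ℝ]
    norm_num
  have h5 := congrArg (fun L : (E × E) →L[ℝ] E => L (z.2, -H z))
    (h1.unique ((h2.sub (hM.const_smul (2 : ℝ))).congr_of_eventuallyEq h3))
  simp [hLv, hMv] at h5
  rw [← hA, ← hD, ← hT, ← hpdef] at h5
  have e1 : ((A z.2, D z.2 z.2 - A (H z)) : E × E) = (p.2, -H' p) := by
    rw [hpdef, hφ.spray_eq hℓ hℓ' hH hH' hz]
    simp [tangentLift, hA, hD]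
  have e1' : ((A z.2, D z.2 z.2 + -A (H z)) : E × E) = (p.2, -H' p) := by
    rw [← sub_eq_add_neg, e1]
  rw [e1'] at h5
  -- the transformation law of the spray, differentiated horizontally
  have h6 := hφ.spray_deriv_eq hℓ hℓ' hH hH' hz (η, 0)
  simp only [map_zero, add_zero, smul_zero, sub_zero] at h6
  rw [← hA, ← hD, ← hT, ← hpdef] at h6
  have e2 : ((A η, D η z.2) : E × E) = (A η, 0) + (0, D η z.2) := by simp
  rw [e2, map_add] at h6
  have hN := hφ.conn_eq hℓ hℓ' hH hH' hz η
  have hNN := hφ.conn_eq hℓ hℓ' hH hH' hz (sprayConn H z η)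
  rw [← hA, ← hD, ← hpdef] at hN hNN
  have e3 : fderiv ℝ H' p (0, D z.2 η) = (2 : ℝ) • sprayConn H' p (D z.2 η) := by
    rw [sprayConn_apply, smul_smul]; norm_num
  have e4 : fderiv ℝ H z (0, η) = (2 : ℝ) • sprayConn H z η := by
    rw [sprayConn_apply, smul_smul]; norm_num
  have s1 : D η z.2 = D z.2 η := symm₂ hc _ _
  have s2 : T z.2 η z.2 = T η z.2 z.2 := symm₃ hc _ _ _
  have s3 : T z.2 z.2 η = T z.2 η z.2 := by
    have h7 := hasFDerivAt_third_of_contDiffAt hc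
    have h8 := (h7.clm_apply (hasFDerivAt_const z.2 z.1)).clm_apply (hasFDerivAt_const η z.1)
    have h9 := (h7.clm_apply (hasFDerivAt_const η z.1)).clm_apply (hasFDerivAt_const z.2 z.1)
    have h10 : (fun x => fderiv ℝ (fderiv ℝ φ) x z.2 η) =ᶠ[𝓝 z.1]
        fun x => fderiv ℝ (fderiv ℝ φ) x η z.2 := by
      filter_upwards [hc.eventually (by norm_num)] with x hx using symm₂ hx _ _
    have h11 := congrArg (fun L : E →L[ℝ] E => L z.2)
      (h8.unique (h9.congr_of_eventuallyEq h10))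
    simpa using h11
  have s4 : D (H z) η = D η (H z) := symm₂ hc _ _
  rw [s1, e3] at h6
  rw [e3, e4] at h5
  have h12 : fderiv ℝ H' p (A η, 0) = D η (H z) + A (fderiv ℝ H z (η, 0)) - T η z.2 z.2
      - (2 : ℝ) • sprayConn H' p (D z.2 η) := eq_sub_of_add_eq h6
  have h13 : fderiv ℝ (fderiv ℝ H') p (p.2, -H' p) (0, A η) =
      D z.2 ((2 : ℝ) • sprayConn H z η) + A (fderiv ℝ (fderiv ℝ H) z (z.2, -H z) (0, η))
        - (2 : ℝ) • (T η z.2 z.2 - D η (H z)) - (2 : ℝ) • sprayConn H' p (D z.2 η) := by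
    rw [← s2, ← s3, ← s4]
    rw [← sub_eq_zero] at h5 ⊢
    refine Eq.trans ?_ h5
    simp only [smul_sub]
    abel
  simp only [sprayCurv]
  rw [h13, h12, hN, map_sub, hNN]
  simp only [map_add, map_sub, map_smul, smul_add, smul_sub, smul_smul]
  module

end IsCoordChange

end SprayTransformation

/-! ### The Chern symbols in coordinates, contracted with y. -/

namespace FinslerCoord

set_option maxSynthPendingDepth 4

open Filter

variable {n : ℕ}

theorem sum_smul_e (v : Vec n) : ∑ i, v i • e i = v := by
  ext j
  simp [e, Pi.single_apply]

theorem map_eq_sum {F : Type*} [AddCommGroup F] [Module ℝ F] (L : Vec n →ₗ[ℝ] F) (v : Vec n) :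
    L v = ∑ i, v i • L (e i) := by
  conv_lhs => rw [← sum_smul_e v, map_sum]
  simp

theorem map_inr_eq_sum {F : Type*} [NormedAddCommGroup F] [NormedSpace ℝ F]
    (L : Vec n × Vec n →L[ℝ] F) (v : Vec n) : L (0, v) = ∑ i, v i • L (0, e i) :=
  map_eq_sum ((L.comp (ContinuousLinearMap.inr ℝ _ _)).toLinearMap) v

theorem map_inl_eq_sum {F : Type*} [NormedAddCommGroup F] [NormedSpace ℝ F]
    (L : Vec n × Vec n →L[ℝ] F) (v : Vec n) : L (v, 0) = ∑ i, v i • L (e i, 0) :=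
  map_eq_sum ((L.comp (ContinuousLinearMap.inl ℝ _ _)).toLinearMap) v

variable {ℓ : Vec n × Vec n → ℝ} {U : Set (Vec n × Vec n)}

theorem contDiffOn_dY (hU : IsOpen U) {f : Vec n × Vec n → ℝ} {k m : WithTop ℕ∞}
    (hf : ContDiffOn ℝ k f U) (h : m + 1 ≤ k) (i : Fin n) : ContDiffOn ℝ m (dY i f) U :=
  (hf.fderiv_of_isOpen hU h).clm_apply contDiffOn_const

theorem contDiffOn_dX (hU : IsOpen U) {f : Vec n × Vec n → ℝ} {k m : WithTop ℕ∞}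
    (hf : ContDiffOn ℝ k f U) (h : m + 1 ≤ k) (i : Fin n) : ContDiffOn ℝ m (dX i f) U :=
  (hf.fderiv_of_isOpen hU h).clm_apply contDiffOn_const

theorem contDiffOn_det {m : WithTop ℕ∞} {ι : Type*} [Fintype ι] [DecidableEq ι]
    {A : Vec n × Vec n → Matrix ι ι ℝ} (hA : ∀ i j, ContDiffOn ℝ m (fun z => A z i j) U) :
    ContDiffOn ℝ m (fun z => (A z).det) U := by
  simp only [Matrix.det_apply]
  exact ContDiffOn.sum fun σ _ => (contDiffOn_prod fun i _ => hA _ _).const_smul _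

theorem contDiffOn_inv_apply {m : WithTop ℕ∞} {ι : Type*} [Fintype ι] [DecidableEq ι]
    {A : Vec n × Vec n → Matrix ι ι ℝ} (hA : ∀ i j, ContDiffOn ℝ m (fun z => A z i j) U)
    (hdet : ∀ z ∈ U, (A z).det ≠ 0) (i j : ι) : ContDiffOn ℝ m (fun z => (A z)⁻¹ i j) U := by
  simp only [Matrix.inv_def, Matrix.smul_apply, Ring.inverse_eq_inv', smul_eq_mul,
    Matrix.adjugate_apply]
  refine ((contDiffOn_det hA).inv hdet).mul (contDiffOn_det fun a b => ?_)
  by_cases h : a = j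
  · subst h
    simp only [Matrix.updateRow_self]
    exact contDiffOn_const
  · simp only [Matrix.updateRow_ne h]
    exact hA a b

section Identities

variable (hℓ : IsConicPotential ℓ U)
include hℓ

theorem dY_dY_eq {z : Vec n × Vec n} (hz : z ∈ U) (i j : Fin n) :
    dY i (dY j ℓ) z = secondDeriv ℓ z (0, e i) (0, e j) := by
  have h := (hasFDerivAt_fderiv hℓ.isOpen hℓ.contDiffOn hz).clm_apply
    (hasFDerivAt_const ((0, e j) : Vec n × Vec n) z)
  have h2 : dY i (dY j ℓ) z = fderiv ℝ (fun x => fderiv ℝ ℓ x (0, e j)) z (0, e i) := rfl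
  rw [h2, h.fderiv]
  simp

theorem gLow_eq {z : Vec n × Vec n} (hz : z ∈ U) (i j : Fin n) :
    gLow ℓ i j z = (1 / 2) * secondDeriv ℓ z (0, e i) (0, e j) := by
  rw [gLow, dY_dY_eq hℓ hz]

theorem fderiv_secondDeriv_apply {z : Vec n × Vec n} (hz : z ∈ U) (a b v : Vec n × Vec n) :
    fderiv ℝ (fun x => secondDeriv ℓ x a b) z v = thirdDeriv ℓ z v a b := by
  obtain ⟨L, hL, hLv⟩ := hasFDerivAt_bilin_apply
    (hasFDerivAt_secondDeriv hℓ.isOpen hℓ.contDiffOn hz) (hasFDerivAt_const a z)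
    (hasFDerivAt_const b z)
  rw [hL.fderiv, hLv]
  simp

theorem dX_gLow {z : Vec n × Vec n} (hz : z ∈ U) (m i j : Fin n) :
    dX m (gLow ℓ i j) z = (1 / 2) * thirdDeriv ℓ z (e m, 0) (0, e i) (0, e j) := by
  have h : gLow ℓ i j =ᶠ[𝓝 z] fun x => (1 / 2) * secondDeriv ℓ x (0, e i) (0, e j) := by
    filter_upwards [hℓ.isOpen.mem_nhds hz] with x hx using gLow_eq hℓ hx i j
  obtain ⟨L, hL, -⟩ := hasFDerivAt_bilin_apply
    (hasFDerivAt_secondDeriv hℓ.isOpen hℓ.contDiffOn hz)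
    (hasFDerivAt_const ((0, e i) : Vec n × Vec n) z) (hasFDerivAt_const ((0, e j) : Vec n × Vec n) z)
  rw [dX, h.fderiv_eq, fderiv_const_mul hL.differentiableAt, smul_apply,
    fderiv_secondDeriv_apply hℓ hz, smul_eq_mul]

theorem cartan_eq {z : Vec n × Vec n} (hz : z ∈ U) (i j k : Fin n) :
    cartan ℓ i j k z = (1 / 4) * thirdDeriv ℓ z (0, e i) (0, e j) (0, e k) := by
  have h : dY j (dY k ℓ) =ᶠ[𝓝 z] fun x => secondDeriv ℓ x (0, e j) (0, e k) := by
    filter_upwards [hℓ.isOpen.mem_nhds hz] with x hx using dY_dY_eq hℓ hx j k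
  rw [cartan, dY, h.fderiv_eq, fderiv_secondDeriv_apply hℓ hz]

theorem det_gLow_ne_zero {z : Vec n × Vec n} (hz : z ∈ U) :
    (Matrix.of fun a b : Fin n => gLow ℓ a b z).det ≠ 0 := by
  intro h
  obtain ⟨v, hv, hv0⟩ := Matrix.exists_mulVec_eq_zero_iff.2 h
  refine hv ?_
  have : (WithLp.toLp 2 v : Vec n) = 0 := by
    refine hℓ.nondegenerate z hz _ fun w => ?_
    rw [secondDeriv_comm hℓ.isOpen hℓ.contDiffOn hz, map_inr_eq_sum (secondDeriv ℓ z) w]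
    rw [sum_apply]
    refine Finset.sum_eq_zero fun i _ => ?_
    rw [smul_apply, map_inr_eq_sum]
    have h1 := congrFun hv0 i
    simp only [Matrix.mulVec, dotProduct, Matrix.of_apply, gLow_eq hℓ hz, Pi.zero_apply] at h1
    have h2 : ∑ j, (WithLp.toLp 2 v : Vec n) j • secondDeriv ℓ z (0, e i) (0, e j) =
        2 * ∑ j, (1 / 2) * secondDeriv ℓ z (0, e i) (0, e j) * v j := by
      rw [Finset.mul_sum]
      refine Finset.sum_congr rfl fun j _ => ?_
      rw [smul_eq_mul]
      ring
    rw [h2, h1, mul_zero, smul_zero]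
  ext i
  exact congrArg (fun u : Vec n => u i) this

theorem gLow_comm {z : Vec n × Vec n} (hz : z ∈ U) (i j : Fin n) :
    gLow ℓ i j z = gLow ℓ j i z := by
  rw [gLow_eq hℓ hz, gLow_eq hℓ hz, secondDeriv_comm hℓ.isOpen hℓ.contDiffOn hz]

theorem gUp_comm {z : Vec n × Vec n} (hz : z ∈ U) (i j : Fin n) :
    gUp ℓ i j z = gUp ℓ j i z := by
  have h : (Matrix.of fun a b : Fin n => gLow ℓ a b z).transpose =
      Matrix.of fun a b : Fin n => gLow ℓ a b z := by
    ext a b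
    exact gLow_comm hℓ hz b a
  have h2 := Matrix.transpose_nonsing_inv (Matrix.of fun a b : Fin n => gLow ℓ a b z)
  rw [h] at h2
  exact congrFun (congrFun h2 j) i

theorem contDiffOn_gLow (i j : Fin n) : ContDiffOn ℝ 4 (gLow ℓ i j) U :=
  contDiffOn_const.mul (contDiffOn_dY hℓ.isOpen (contDiffOn_dY hℓ.isOpen hℓ.contDiffOn
    (m := 5) (by norm_num) j) (by norm_num) i)

theorem contDiffOn_gUp (i j : Fin n) : ContDiffOn ℝ 3 (gUp ℓ i j) U :=
  contDiffOn_inv_apply (fun a b => (contDiffOn_gLow hℓ a b).of_le (by norm_num))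
    (fun _ hz => det_gLow_ne_zero hℓ hz) i j

theorem contDiffOn_cartan (i j k : Fin n) : ContDiffOn ℝ 3 (cartan ℓ i j k) U :=
  contDiffOn_const.mul (contDiffOn_dY hℓ.isOpen (contDiffOn_dY hℓ.isOpen (contDiffOn_dY hℓ.isOpen
    hℓ.contDiffOn (m := 5) (by norm_num) k) (m := 4) (by norm_num) j) (by norm_num) i)

theorem contDiffOn_formalChristoffel (i j m : Fin n) :
    ContDiffOn ℝ 3 (formalChristoffel ℓ i j m) U := by
  have h := fun a b c => contDiffOn_dX hℓ.isOpen (contDiffOn_gLow hℓ a b) (m := 3) (by norm_num) c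
  exact contDiffOn_const.mul (ContDiffOn.sum fun s _ =>
    (contDiffOn_gUp hℓ i s).mul (((h _ _ _).add (h _ _ _)).sub (h _ _ _)))

omit hℓ in
theorem contDiffOn_snd_apply {m : WithTop ℕ∞} (i : Fin n) :
    ContDiffOn ℝ m (fun z : Vec n × Vec n => z.2 i) U :=
  ((EuclideanSpace.proj (𝕜 := ℝ) i : Vec n →L[ℝ] ℝ).contDiff.comp contDiff_snd).contDiffOn

theorem contDiffOn_nonlinear (i j : Fin n) : ContDiffOn ℝ 3 (nonlinear ℓ i j) U := by
  refine (ContDiffOn.sum fun m _ => (contDiffOn_formalChristoffel hℓ i j m).mul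
    (contDiffOn_snd_apply m)).sub (ContDiffOn.sum fun m _ => ContDiffOn.sum fun r _ =>
    ContDiffOn.sum fun s _ => ((ContDiffOn.mul ?_ (contDiffOn_formalChristoffel hℓ m r s)).mul
      (contDiffOn_snd_apply r)).mul (contDiffOn_snd_apply s))
  exact ContDiffOn.sum fun l _ => (contDiffOn_gUp hℓ i l).mul (contDiffOn_cartan hℓ l j m)

theorem contDiffOn_chernSymbol (i j k : Fin n) : ContDiffOn ℝ 3 (chernSymbol ℓ i j k) U := by
  refine (contDiffOn_formalChristoffel hℓ i j k).sub (ContDiffOn.sum fun l _ =>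
    ContDiffOn.sum fun r _ => (contDiffOn_gUp hℓ l i).mul ?_)
  exact (((contDiffOn_cartan hℓ _ _ _).mul (contDiffOn_nonlinear hℓ _ _)).sub
    ((contDiffOn_cartan hℓ _ _ _).mul (contDiffOn_nonlinear hℓ _ _))).add
    ((contDiffOn_cartan hℓ _ _ _).mul (contDiffOn_nonlinear hℓ _ _))

end Identities

/-- The vector whose `g`-product with `e s` is `q s`. -/
def sharp (ℓ : Vec n × Vec n → ℝ) (z : Vec n × Vec n) (q : Fin n → ℝ) : Vec n :=
  WithLp.toLp 2 fun i => ∑ s, gUp ℓ i s z * q s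

theorem sharp_apply (z : Vec n × Vec n) (q : Fin n → ℝ) (i : Fin n) :
    sharp ℓ z q i = ∑ s, gUp ℓ i s z * q s := rfl

theorem sharp_congr {z : Vec n × Vec n} {q q' : Fin n → ℝ} {i : Fin n} (h : ∀ s, q s = q' s) :
    sharp ℓ z q i = sharp ℓ z q' i := by
  rw [funext h]

/-- The spray coefficients of `ℓ` in coordinates. -/
def coordSpray (ℓ : Vec n × Vec n → ℝ) (z : Vec n × Vec n) : Vec n :=
  WithLp.toLp 2 fun i => ∑ j, ∑ m, formalChristoffel ℓ i j m z * z.2 j * z.2 m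

theorem coordSpray_apply (z : Vec n × Vec n) (i : Fin n) :
    coordSpray ℓ z i = ∑ j, ∑ m, formalChristoffel ℓ i j m z * z.2 j * z.2 m := rfl

/-- The formal Christoffel symbols of the first kind, as a trilinear form. -/
def loweredChristoffel (ℓ : Vec n × Vec n → ℝ) (z : Vec n × Vec n) (t a b : Vec n) : ℝ :=
  (1 / 4) * (thirdDeriv ℓ z (b, 0) (0, t) (0, a) + thirdDeriv ℓ z (a, 0) (0, b) (0, t)
    - thirdDeriv ℓ z (t, 0) (0, a) (0, b))

variable (hℓ : IsConicPotential ℓ U)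
include hℓ

/-- The factor 2 is the ratio between the vertical Hessian of ℓ and g. -/
theorem secondDeriv_sharp {z : Vec n × Vec n} (hz : z ∈ U) (q : Fin n → ℝ) (t : Fin n) :
    secondDeriv ℓ z (0, sharp ℓ z q) (0, e t) = 2 * q t := by
  rw [secondDeriv_comm hℓ.isOpen hℓ.contDiffOn hz, map_inr_eq_sum]
  have h1 : ∀ i, sharp ℓ z q i • secondDeriv ℓ z (0, e t) (0, e i) =
      2 * ∑ s, gLow ℓ t i z * (gUp ℓ i s z * q s) := by
    intro i
    rw [sharp_apply, gLow_eq hℓ hz, smul_eq_mul, ← Finset.mul_sum]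
    ring
  simp only [h1]
  rw [← Finset.mul_sum, Finset.sum_comm]
  congr 1
  have h2 := Matrix.mul_nonsing_inv (Matrix.of fun a b : Fin n => gLow ℓ a b z)
    (det_gLow_ne_zero hℓ hz).isUnit
  have h3 : ∀ s, ∑ i, gLow ℓ t i z * (gUp ℓ i s z * q s) =
      (if t = s then 1 else 0) * q s := by
    intro s
    have := congrFun (congrFun h2 t) s
    rw [Matrix.mul_apply, Matrix.one_apply] at this
    rw [← this, Finset.sum_mul]
    refine Finset.sum_congr rfl fun i _ => ?_
    rw [mul_assoc]
    rfl
  simp [h3]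

theorem eq_of_secondDeriv_eq {z : Vec n × Vec n} (hz : z ∈ U) {u v : Vec n}
    (h : ∀ t, secondDeriv ℓ z (0, u) (0, e t) = secondDeriv ℓ z (0, v) (0, e t)) : u = v := by
  rw [← sub_eq_zero]
  refine hℓ.nondegenerate z hz _ fun w => ?_
  have e1 : ((0, u - v) : Vec n × Vec n) = (0, u) - (0, v) := by simp
  rw [e1, map_sub, sub_apply, sub_eq_zero, map_inr_eq_sum, map_inr_eq_sum (secondDeriv ℓ z (0, v))]
  simp only [h]

theorem formalChristoffel_eq {z : Vec n × Vec n} (hz : z ∈ U) (i j m : Fin n) :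
    formalChristoffel ℓ i j m z =
      sharp ℓ z (fun s => loweredChristoffel ℓ z (e s) (e j) (e m)) i := by
  rw [formalChristoffel, sharp_apply, Finset.mul_sum]
  refine Finset.sum_congr rfl fun s _ => ?_
  rw [dX_gLow hℓ hz, dX_gLow hℓ hz, dX_gLow hℓ hz, loweredChristoffel]
  ring

omit hℓ in
theorem loweredChristoffel_sum_right (z : Vec n × Vec n) (t a b : Vec n) :
    loweredChristoffel ℓ z t a b = ∑ m, b m * loweredChristoffel ℓ z t a (e m) := by
  simp only [loweredChristoffel]
  rw [map_inl_eq_sum (thirdDeriv ℓ z) b, map_inr_eq_sum (thirdDeriv ℓ z (a, 0)) b,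
    map_inr_eq_sum (thirdDeriv ℓ z (t, 0) (0, a)) b]
  simp only [sum_apply, smul_apply, smul_eq_mul, mul_sub, mul_add,
    Finset.mul_sum, Finset.sum_sub_distrib, Finset.sum_add_distrib]
  simp only [mul_left_comm]

theorem loweredChristoffel_comm {z : Vec n × Vec n} (hz : z ∈ U) (t a b : Vec n) :
    loweredChristoffel ℓ z t a b = loweredChristoffel ℓ z t b a := by
  simp only [loweredChristoffel]
  rw [thirdDeriv_comm₂₃ hℓ.isOpen hℓ.contDiffOn hz (b, 0) (0, t),
    thirdDeriv_comm₂₃ hℓ.isOpen hℓ.contDiffOn hz (a, 0) (0, b),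
    thirdDeriv_comm₂₃ hℓ.isOpen hℓ.contDiffOn hz (t, 0)]
  ring

omit hℓ in
theorem sharp_sum {ι : Type*} (S : Finset ι) (z : Vec n × Vec n) (c : ι → ℝ) (q : ι → Fin n → ℝ)
    (i : Fin n) :
    ∑ k ∈ S, c k * sharp ℓ z (q k) i = sharp ℓ z (fun s => ∑ k ∈ S, c k * q k s) i := by
  simp only [sharp_apply, Finset.mul_sum]
  rw [Finset.sum_comm]
  refine Finset.sum_congr rfl fun s _ => Finset.sum_congr rfl fun k _ => ?_
  ring

theorem sum_formalChristoffel {z : Vec n × Vec n} (hz : z ∈ U) (i j : Fin n) (b : Vec n) :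
    ∑ m, b m * formalChristoffel ℓ i j m z =
      sharp ℓ z (fun s => loweredChristoffel ℓ z (e s) (e j) b) i := by
  simp only [formalChristoffel_eq hℓ hz]
  rw [sharp_sum]
  refine sharp_congr fun s => ?_
  rw [loweredChristoffel_sum_right]

theorem coordSpray_eq {z : Vec n × Vec n} (hz : z ∈ U) :
    coordSpray ℓ z = sharp ℓ z (fun s => loweredChristoffel ℓ z (e s) z.2 z.2) := by
  ext i
  have h : ∀ j, ∑ m, formalChristoffel ℓ i j m z * z.2 j * z.2 m =
      z.2 j * sharp ℓ z (fun s => loweredChristoffel ℓ z (e s) (e j) z.2) i := by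
    intro j
    rw [← sum_formalChristoffel hℓ hz, Finset.mul_sum]
    refine Finset.sum_congr rfl fun m _ => ?_
    ring
  rw [coordSpray_apply]
  simp only [h]
  rw [sharp_sum]
  refine sharp_congr fun s => ?_
  rw [loweredChristoffel_comm hℓ hz, loweredChristoffel_sum_right]
  simp only [loweredChristoffel_comm hℓ hz _ z.2]

/-- For a = b = y the Euler relations collapse the three third derivatives in `loweredChristoffel`
to the right-hand side of the spray equation. -/
theorem isSpray_coordSpray : IsSpray ℓ U (coordSpray ℓ) where
  contDiffOn := by
    rw [contDiffOn_euclidean]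
    intro i
    simp only [coordSpray_apply]
    exact ContDiffOn.sum fun j _ => ContDiffOn.sum fun m _ =>
      ((contDiffOn_formalChristoffel hℓ i j m).mul (contDiffOn_snd_apply j)).mul
        (contDiffOn_snd_apply m)
  eq := by
    intro z hz w
    have key : ∀ t, secondDeriv ℓ z (0, coordSpray ℓ z) (0, e t) =
        secondDeriv ℓ z (z.2, 0) (0, e t) - fderiv ℝ ℓ z (e t, 0) := by
      intro t
      rw [coordSpray_eq hℓ hz, secondDeriv_sharp hℓ hz, loweredChristoffel,
        hℓ.thirdDeriv_horizontal hz, thirdDeriv_comm₂₃ hℓ.isOpen hℓ.contDiffOn hz (z.2, 0),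
        hℓ.thirdDeriv_horizontal hz, hℓ.thirdDeriv_horizontal hz, hℓ.secondDeriv_horizontal hz]
      ring
    rw [map_inr_eq_sum, map_inr_eq_sum (secondDeriv ℓ z (z.2, 0)), map_inl_eq_sum (fderiv ℝ ℓ z)]
    simp only [key, smul_sub, Finset.sum_sub_distrib]

theorem secondDeriv_conn_eq {z : Vec n × Vec n} (hz : z ∈ U) (η w : Vec n) :
    secondDeriv ℓ z (0, sprayConn (coordSpray ℓ) z η) (0, w) =
      2 * (loweredChristoffel ℓ z w η z.2
        - (1 / 4) * thirdDeriv ℓ z (0, w) (0, η) (0, coordSpray ℓ z)) := by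
  rw [(isSpray_coordSpray hℓ).conn_eq hℓ hz, loweredChristoffel, hℓ.thirdDeriv_horizontal hz,
    thirdDeriv_comm₂₃ hℓ.isOpen hℓ.contDiffOn hz (η, 0), hℓ.thirdDeriv_horizontal hz,
    thirdDeriv_comm₂₃ hℓ.isOpen hℓ.contDiffOn hz (z.2, 0),
    thirdDeriv_comm₂₃ hℓ.isOpen hℓ.contDiffOn hz (0, w),
    thirdDeriv_comm₁₂ hℓ.isOpen hℓ.contDiffOn hz (0, w),
    thirdDeriv_comm₂₃ hℓ.isOpen hℓ.contDiffOn hz (0, coordSpray ℓ z) (0, w)]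
  have e1 : ((z.2, -coordSpray ℓ z) : Vec n × Vec n) = (z.2, 0) - (0, coordSpray ℓ z) := by simp
  rw [e1, map_sub, sub_apply, sub_apply]
  ring

/-- Raising an index turns both sides into vectors; their products with each basis vector agree by
`secondDeriv_conn_eq`. Thus the nonlinear connection built from Christoffel symbols and Cartan
tensor is half the vertical derivative of the spray. -/
theorem nonlinear_eq {z : Vec n × Vec n} (hz : z ∈ U) (i j : Fin n) :
    nonlinear ℓ i j z = sprayConn (coordSpray ℓ) z (e j) i := by
  have h1 : ∑ m, formalChristoffel ℓ i j m z * z.2 m =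
      sharp ℓ z (fun s => loweredChristoffel ℓ z (e s) (e j) z.2) i := by
    rw [← sum_formalChristoffel hℓ hz]
    exact Finset.sum_congr rfl fun m _ => mul_comm _ _
  have h2 : ∑ m, ∑ r, ∑ s, cartanUp ℓ i j m z * formalChristoffel ℓ m r s z * z.2 r * z.2 s =
      sharp ℓ z (fun s => (1 / 4) * thirdDeriv ℓ z (0, e s) (0, e j) (0, coordSpray ℓ z)) i := by
    have h3 : ∀ m, ∑ r, ∑ s, cartanUp ℓ i j m z * formalChristoffel ℓ m r s z * z.2 r * z.2 s =
        coordSpray ℓ z m *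
          sharp ℓ z (fun s => (1 / 4) * thirdDeriv ℓ z (0, e s) (0, e j) (0, e m)) i := by
      intro m
      rw [coordSpray_apply, sharp_apply, cartanUp, mul_comm]
      simp only [Finset.mul_sum, Finset.sum_mul, cartan_eq hℓ hz, mul_assoc]
    simp only [h3]
    rw [sharp_sum]
    refine sharp_congr fun s => ?_
    rw [map_inr_eq_sum (thirdDeriv ℓ z (0, e s) (0, e j)) (coordSpray ℓ z), Finset.mul_sum]
    refine Finset.sum_congr rfl fun m _ => ?_
    rw [smul_eq_mul]
    ring
  rw [nonlinear, h1, h2]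
  have h4 : sharp ℓ z (fun s => loweredChristoffel ℓ z (e s) (e j) z.2)
      - sharp ℓ z (fun s => (1 / 4) * thirdDeriv ℓ z (0, e s) (0, e j) (0, coordSpray ℓ z)) =
      sprayConn (coordSpray ℓ) z (e j) := by
    refine eq_of_secondDeriv_eq hℓ hz fun t => ?_
    rw [secondDeriv_conn_eq hℓ hz]
    have e1 : ∀ a b : Vec n, ((0, a - b) : Vec n × Vec n) = (0, a) - (0, b) := by simp
    rw [e1, map_sub, sub_apply, secondDeriv_sharp hℓ hz, secondDeriv_sharp hℓ hz]
    ring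
  exact congrArg (fun u : Vec n => u i) h4

/-- The Cartan term of N drops out when contracted with y. This is the 2-homogeneity of H. -/
theorem conn_self {z : Vec n × Vec n} (hz : z ∈ U) :
    sprayConn (coordSpray ℓ) z z.2 = coordSpray ℓ z := by
  refine eq_of_secondDeriv_eq hℓ hz fun t => ?_
  rw [secondDeriv_conn_eq hℓ hz, thirdDeriv_comm₂₃ hℓ.isOpen hℓ.contDiffOn hz (0, e t),
    hℓ.thirdDeriv_vertical hz, coordSpray_eq hℓ hz, secondDeriv_sharp hℓ hz]
  ring

theorem chernSymbol_eq {z : Vec n × Vec n} (hz : z ∈ U) (i j k : Fin n) :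
    chernSymbol ℓ i j k z = sharp ℓ z (fun s => loweredChristoffel ℓ z (e s) (e j) (e k)
      - (1 / 4) * (thirdDeriv ℓ z (0, e j) (0, e s) (0, sprayConn (coordSpray ℓ) z (e k))
        - thirdDeriv ℓ z (0, e j) (0, e k) (0, sprayConn (coordSpray ℓ) z (e s))
        + thirdDeriv ℓ z (0, e s) (0, e k) (0, sprayConn (coordSpray ℓ) z (e j)))) i := by
  have hc : ∀ a b c : Fin n, ∑ r, cartan ℓ a b r z * nonlinear ℓ r c z =
      (1 / 4) * thirdDeriv ℓ z (0, e a) (0, e b) (0, sprayConn (coordSpray ℓ) z (e c)) := by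
    intro a b c
    rw [map_inr_eq_sum (thirdDeriv ℓ z (0, e a) (0, e b)), Finset.mul_sum]
    refine Finset.sum_congr rfl fun r _ => ?_
    rw [cartan_eq hℓ hz, nonlinear_eq hℓ hz, smul_eq_mul]
    ring
  rw [chernSymbol, formalChristoffel_eq hℓ hz, sharp_apply, sharp_apply, ← Finset.sum_sub_distrib]
  refine Finset.sum_congr rfl fun s _ => ?_
  rw [← Finset.mul_sum, Finset.sum_add_distrib, Finset.sum_sub_distrib, hc, hc, hc,
    gUp_comm hℓ hz s i]
  ring

theorem chernSymbol_comm {z : Vec n × Vec n} (hz : z ∈ U) (i j k : Fin n) :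
    chernSymbol ℓ i j k z = chernSymbol ℓ i k j z := by
  rw [chernSymbol_eq hℓ hz, chernSymbol_eq hℓ hz]
  refine sharp_congr fun s => ?_
  rw [loweredChristoffel_comm hℓ hz, thirdDeriv_comm₁₂ hℓ.isOpen hℓ.contDiffOn hz (0, e j) (0, e s),
    thirdDeriv_comm₁₂ hℓ.isOpen hℓ.contDiffOn hz (0, e j) (0, e k),
    thirdDeriv_comm₁₂ hℓ.isOpen hℓ.contDiffOn hz (0, e s) (0, e k)]
  ring

/-- Of the three Cartan corrections in the Chern symbol, two are contracted with y and vanish. In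
the third, y meets N and gives N y = H, leaving the formula `secondDeriv_conn_eq`. -/
theorem sum_chernSymbol {z : Vec n × Vec n} (hz : z ∈ U) (i j : Fin n) :
    ∑ k, z.2 k * chernSymbol ℓ i j k z = sprayConn (coordSpray ℓ) z (e j) i := by
  simp only [chernSymbol_eq hℓ hz]
  rw [sharp_sum]
  have h : sharp ℓ z (fun s => ∑ k, z.2 k * (loweredChristoffel ℓ z (e s) (e j) (e k)
      - (1 / 4) * (thirdDeriv ℓ z (0, e j) (0, e s) (0, sprayConn (coordSpray ℓ) z (e k))
        - thirdDeriv ℓ z (0, e j) (0, e k) (0, sprayConn (coordSpray ℓ) z (e s))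
        + thirdDeriv ℓ z (0, e s) (0, e k) (0, sprayConn (coordSpray ℓ) z (e j))))) =
      sprayConn (coordSpray ℓ) z (e j) := by
    refine eq_of_secondDeriv_eq hℓ hz fun t => ?_
    rw [secondDeriv_sharp hℓ hz, secondDeriv_conn_eq hℓ hz]
    have hU := hℓ.isOpen
    have hc := hℓ.contDiffOn
    have s1 := loweredChristoffel_sum_right (ℓ := ℓ) z (e t) (e j) z.2
    have s2 : ∑ k, z.2 k * thirdDeriv ℓ z (0, e j) (0, e t)
        (0, sprayConn (coordSpray ℓ) z (e k)) =
        thirdDeriv ℓ z (0, e t) (0, e j) (0, coordSpray ℓ z) := by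
      rw [thirdDeriv_comm₁₂ hU hc hz (0, e t), ← conn_self hℓ hz]
      have := map_eq_sum (((thirdDeriv ℓ z (0, e j) (0, e t)).comp
        ((ContinuousLinearMap.inr ℝ (Vec n) (Vec n)).comp
          (sprayConn (coordSpray ℓ) z))).toLinearMap) z.2
      simpa using this.symm
    have s3 : ∑ k, z.2 k * thirdDeriv ℓ z (0, e j) (0, e k)
        (0, sprayConn (coordSpray ℓ) z (e t)) = 0 := by
      have := hℓ.thirdDeriv_vertical hz (sprayConn (coordSpray ℓ) z (e t)) (e j)
      rw [thirdDeriv_comm₂₃ hU hc hz, map_inr_eq_sum (thirdDeriv ℓ z (0, e j)) z.2] at this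
      simpa using this
    have s4 : ∑ k, z.2 k * thirdDeriv ℓ z (0, e t) (0, e k)
        (0, sprayConn (coordSpray ℓ) z (e j)) = 0 := by
      have := hℓ.thirdDeriv_vertical hz (sprayConn (coordSpray ℓ) z (e j)) (e t)
      rw [thirdDeriv_comm₂₃ hU hc hz, map_inr_eq_sum (thirdDeriv ℓ z (0, e t)) z.2] at this
      simpa using this
    have : ∑ k, z.2 k * (loweredChristoffel ℓ z (e t) (e j) (e k)
      - (1 / 4) * (thirdDeriv ℓ z (0, e j) (0, e t) (0, sprayConn (coordSpray ℓ) z (e k))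
        - thirdDeriv ℓ z (0, e j) (0, e k) (0, sprayConn (coordSpray ℓ) z (e t))
        + thirdDeriv ℓ z (0, e t) (0, e k) (0, sprayConn (coordSpray ℓ) z (e j)))) =
      (∑ k, z.2 k * loweredChristoffel ℓ z (e t) (e j) (e k)) - (1 / 4) *
        ((∑ k, z.2 k * thirdDeriv ℓ z (0, e j) (0, e t) (0, sprayConn (coordSpray ℓ) z (e k)))
        - (∑ k, z.2 k * thirdDeriv ℓ z (0, e j) (0, e k) (0, sprayConn (coordSpray ℓ) z (e t)))
        + ∑ k, z.2 k * thirdDeriv ℓ z (0, e t) (0, e k) (0, sprayConn (coordSpray ℓ) z (e j))) := by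
      simp only [Finset.mul_sum, ← Finset.sum_sub_distrib, ← Finset.sum_add_distrib]
      refine Finset.sum_congr rfl fun k _ => ?_
      ring
    rw [this, ← s1, s2, s3, s4]
    ring
  exact congrArg (fun u : Vec n => u i) h

theorem sum_chernSymbol' {z : Vec n × Vec n} (hz : z ∈ U) (i k : Fin n) :
    ∑ j, z.2 j * chernSymbol ℓ i j k z = sprayConn (coordSpray ℓ) z (e k) i := by
  rw [← sum_chernSymbol hℓ hz]
  exact Finset.sum_congr rfl fun j _ => by rw [chernSymbol_comm hℓ hz]

theorem sum_sum_chernSymbol {z : Vec n × Vec n} (hz : z ∈ U) (u : Vec n) :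
    (∑ m, (∑ i, ∑ j, u i * z.2 j * chernSymbol ℓ m i j z) • e m) =
      sprayConn (coordSpray ℓ) z u := by
  have h : ∀ m, ∑ i, ∑ j, u i * z.2 j * chernSymbol ℓ m i j z =
      sprayConn (coordSpray ℓ) z u m := by
    intro m
    have h1 := map_eq_sum ((EuclideanSpace.proj (𝕜 := ℝ) m : Vec n →L[ℝ] ℝ).comp
      (sprayConn (coordSpray ℓ) z)).toLinearMap u
    refine Eq.trans ?_ h1.symm
    refine Finset.sum_congr rfl fun i _ => ?_
    have h2 : ((EuclideanSpace.proj (𝕜 := ℝ) m : Vec n →L[ℝ] ℝ).comp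
      (sprayConn (coordSpray ℓ) z)).toLinearMap (e i) = sprayConn (coordSpray ℓ) z (e i) m := rfl
    rw [h2, ← sum_chernSymbol hℓ hz, smul_eq_mul, Finset.mul_sum]
    exact Finset.sum_congr rfl fun j _ => by ring
  simp only [h]
  exact sum_smul_e _

end FinslerCoord

/-! ### The Chern curvature contracted with y. -/

namespace FinslerCoord

set_option maxSynthPendingDepth 4

open Filter

variable {n : ℕ} {ℓ : Vec n × Vec n → ℝ} {U : Set (Vec n × Vec n)} (hℓ : IsConicPotential ℓ U)
include hℓ

theorem delta_eq {z : Vec n × Vec n} (hz : z ∈ U) (k : Fin n) (f : Vec n × Vec n → ℝ) :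
    delta ℓ k f z = fderiv ℝ f z (e k, -sprayConn (coordSpray ℓ) z (e k)) := by
  have e1 : ((e k, -sprayConn (coordSpray ℓ) z (e k)) : Vec n × Vec n) =
    (e k, 0) - (0, sprayConn (coordSpray ℓ) z (e k)) := by simp
  rw [e1, map_sub, map_inr_eq_sum]
  simp only [delta, nonlinear_eq hℓ hz, smul_eq_mul]
  rfl

theorem hasFDerivAt_chernSymbol {z : Vec n × Vec n} (hz : z ∈ U) (i j k : Fin n) :
    HasFDerivAt (chernSymbol ℓ i j k) (fderiv ℝ (chernSymbol ℓ i j k) z) z :=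
  (((contDiffOn_chernSymbol hℓ i j k).contDiffAt (hℓ.isOpen.mem_nhds hz)).differentiableAt
    (by norm_num)).hasFDerivAt

theorem sum_fderiv_chernSymbol {z : Vec n × Vec n} (hz : z ∈ U) (i k : Fin n)
    (v : Vec n × Vec n) :
    ∑ j, z.2 j * fderiv ℝ (chernSymbol ℓ i j k) z v =
      (1 / 2) * fderiv ℝ (fderiv ℝ (coordSpray ℓ)) z v (0, e k) i
        - ∑ j, v.2 j * chernSymbol ℓ i j k z := by
  have hH := isSpray_coordSpray hℓ
  have h1 : HasFDerivAt (fun x : Vec n × Vec n => ∑ j, x.2 j * chernSymbol ℓ i j k x)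
      (∑ j, (z.2 j • fderiv ℝ (chernSymbol ℓ i j k) z + chernSymbol ℓ i j k z •
        ((EuclideanSpace.proj (𝕜 := ℝ) j : Vec n →L[ℝ] ℝ).comp
          (ContinuousLinearMap.snd ℝ (Vec n) (Vec n))))) z := by
    refine HasFDerivAt.fun_sum fun j _ => ?_
    exact HasFDerivAt.mul ((EuclideanSpace.proj (𝕜 := ℝ) j : Vec n →L[ℝ] ℝ).hasFDerivAt.comp z
      hasFDerivAt_snd) (hasFDerivAt_chernSymbol hℓ hz i j k)
  have h2 := ((EuclideanSpace.proj (𝕜 := ℝ) i : Vec n →L[ℝ] ℝ).hasFDerivAt.comp z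
    ((hH.hasFDerivAt_fderiv hℓ hz).clm_apply
      (hasFDerivAt_const ((0, e k) : Vec n × Vec n) z))).const_mul (1 / 2)
  have h3 : (fun x : Vec n × Vec n => ∑ j, x.2 j * chernSymbol ℓ i j k x) =ᶠ[𝓝 z]
      fun x => (1 / 2) * (fderiv ℝ (coordSpray ℓ) x (0, e k)) i := by
    filter_upwards [hℓ.isOpen.mem_nhds hz] with x hx
    rw [sum_chernSymbol' hℓ hx, sprayConn_apply]
    rfl
  have h4 := congrArg (fun L : (Vec n × Vec n) →L[ℝ] ℝ => L v)
    (h1.unique (h2.congr_of_eventuallyEq h3))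
  simp [Finset.sum_add_distrib] at h4
  have h5 : ∑ j, v.2 j * chernSymbol ℓ i j k z = ∑ j, chernSymbol ℓ i j k z * v.2 j :=
    Finset.sum_congr rfl fun j _ => mul_comm _ _
  rw [h5]
  linarith

/-- Pulling yʲ through the horizontal derivatives costs terms N Γ, since the k-th horizontal
derivative of yʲ is -Nʲ_k. They cancel the contracted quadratic terms of the curvature and leave
only derivatives of N. -/
theorem sum_chernCurv {z : Vec n × Vec n} (hz : z ∈ U) (i k l : Fin n) :
    ∑ j, z.2 j * chernCurv ℓ j i k l z =
      (1 / 2) * fderiv ℝ (fderiv ℝ (coordSpray ℓ)) z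
        (e k, -sprayConn (coordSpray ℓ) z (e k)) (0, e l) i
      - (1 / 2) * fderiv ℝ (fderiv ℝ (coordSpray ℓ)) z
        (e l, -sprayConn (coordSpray ℓ) z (e l)) (0, e k) i := by
  have h1 := sum_fderiv_chernSymbol hℓ hz i l (e k, -sprayConn (coordSpray ℓ) z (e k))
  have h2 := sum_fderiv_chernSymbol hℓ hz i k (e l, -sprayConn (coordSpray ℓ) z (e l))
  have h3 : ∀ a b : Fin n, ∑ j, z.2 j * ∑ h, chernSymbol ℓ i h a z * chernSymbol ℓ h j b z =
      ∑ h, sprayConn (coordSpray ℓ) z (e b) h * chernSymbol ℓ i h a z := by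
    intro a b
    simp only [Finset.mul_sum]
    rw [Finset.sum_comm]
    refine Finset.sum_congr rfl fun h _ => ?_
    rw [← sum_chernSymbol' hℓ hz, Finset.sum_mul]
    exact Finset.sum_congr rfl fun j _ => by ring
  simp only [chernCurv, delta_eq hℓ hz, mul_add, mul_sub, Finset.sum_add_distrib,
    Finset.sum_sub_distrib]
  rw [h1, h2, h3, h3]
  simp only [PiLp.neg_apply, neg_mul, Finset.sum_neg_distrib]
  ring

theorem half_secondDeriv_self {z : Vec n × Vec n} (hz : z ∈ U) (v : Vec n × Vec n) :
    (1 / 2 : ℝ) • fderiv ℝ (fderiv ℝ (coordSpray ℓ)) z v (0, z.2) =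
      fderiv ℝ (coordSpray ℓ) z v - sprayConn (coordSpray ℓ) z v.2 := by
  have hH := isSpray_coordSpray hℓ
  have h1 := ((hH.hasFDerivAt_fderiv hℓ hz).clm_apply
    ((ContinuousLinearMap.inr ℝ (Vec n) (Vec n)).hasFDerivAt.comp z
      (hasFDerivAt_snd (𝕜 := ℝ) (p := z)))).const_smul (1 / 2 : ℝ)
  have h3 : (fun x : Vec n × Vec n => (1 / 2 : ℝ) • fderiv ℝ (coordSpray ℓ) x (0, x.2)) =ᶠ[𝓝 z]
      coordSpray ℓ := by
    filter_upwards [hℓ.isOpen.mem_nhds hz] with x hx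
    rw [← sprayConn_apply, conn_self hℓ hx]
  have h4 := congrArg (fun L : (Vec n × Vec n) →L[ℝ] Vec n => L v)
    (h1.unique ((hH.hasFDerivAt hℓ hz).congr_of_eventuallyEq h3))
  simp at h4
  rw [sprayConn_apply, ← h4]
  simp

/-- After the contraction with yᵏ as well, the term with y in the last slot is removed by
`half_secondDeriv_self`, the derivative of the relation N y = H. -/
theorem sum_sum_sum_chernCurv {z : Vec n × Vec n} (hz : z ∈ U) (η : Vec n) :
    (∑ i, (∑ j, ∑ k, ∑ l, z.2 k * η l * z.2 j * chernCurv ℓ j i k l z) • e i) =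
      sprayCurv (coordSpray ℓ) z η := by
  have hH := isSpray_coordSpray hℓ
  set H := coordSpray ℓ with hHdef
  have h : ∀ i, ∑ j, ∑ k, ∑ l, z.2 k * η l * z.2 j * chernCurv ℓ j i k l z =
      sprayCurv H z η i := by
    intro i
    have h1 : ∑ j, ∑ k, ∑ l, z.2 k * η l * z.2 j * chernCurv ℓ j i k l z =
        ∑ k, ∑ l, z.2 k * η l * ∑ j, z.2 j * chernCurv ℓ j i k l z := by
      rw [Finset.sum_comm]
      refine Finset.sum_congr rfl fun k _ => ?_
      rw [Finset.sum_comm]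
      refine Finset.sum_congr rfl fun l _ => ?_
      rw [Finset.mul_sum]
      exact Finset.sum_congr rfl fun j _ => by ring
    rw [h1]
    simp only [sum_chernCurv hℓ hz, mul_sub, Finset.sum_sub_distrib]
    let hz' : Vec n →L[ℝ] Vec n × Vec n :=
      (ContinuousLinearMap.id ℝ (Vec n)).prod (-sprayConn H z)
    let Q : Vec n →L[ℝ] Vec n →L[ℝ] Vec n :=
      (ContinuousLinearMap.compL ℝ (Vec n) (Vec n × Vec n) (Vec n)).flip
        (ContinuousLinearMap.inr ℝ (Vec n) (Vec n)) ∘L ((fderiv ℝ (fderiv ℝ H) z) ∘L hz')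
    have hQ : ∀ a b, Q a b = fderiv ℝ (fderiv ℝ H) z (a, -sprayConn H z a) (0, b) :=
      fun a b => rfl
    have hQs : ∀ a b, Q a b i = ∑ k, ∑ l, a k * b l * Q (e k) (e l) i := by
      intro a b
      have q1 := map_eq_sum Q.toLinearMap a
      simp only [ContinuousLinearMap.coe_coe] at q1
      rw [q1, sum_apply]
      have q2 : ∀ k, ((a k • Q (e k)) b) i = ∑ l, a k * b l * Q (e k) (e l) i := by
        intro k
        have q3 := map_eq_sum (Q (e k)).toLinearMap b
        simp only [ContinuousLinearMap.coe_coe] at q3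
        rw [smul_apply, q3]
        simp [Finset.mul_sum, mul_assoc]
      rw [← Finset.sum_congr rfl fun k _ => q2 k]
      simp
    have t1 : ∑ k, ∑ l, z.2 k * η l * (1 / 2 * fderiv ℝ (fderiv ℝ H) z
        (e k, -sprayConn H z (e k)) (0, e l) i) = (1 / 2) * Q z.2 η i := by
      rw [hQs, Finset.mul_sum]
      refine Finset.sum_congr rfl fun k _ => ?_
      rw [Finset.mul_sum]
      refine Finset.sum_congr rfl fun l _ => ?_
      rw [hQ]
      ring
    have t2 : ∑ k, ∑ l, z.2 k * η l * (1 / 2 * fderiv ℝ (fderiv ℝ H) z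
        (e l, -sprayConn H z (e l)) (0, e k) i) = (1 / 2) * Q η z.2 i := by
      rw [hQs, Finset.mul_sum, Finset.sum_comm]
      refine Finset.sum_congr rfl fun k _ => ?_
      rw [Finset.mul_sum]
      refine Finset.sum_congr rfl fun l _ => ?_
      rw [hQ]
      ring
    rw [t1, t2]
    have h5 := half_secondDeriv_self hℓ hz (η, -sprayConn H z η)
    rw [← hHdef] at h5
    have h6 : fderiv ℝ H z (η, -sprayConn H z η) =
        fderiv ℝ H z (η, 0) - (2 : ℝ) • sprayConn H z (sprayConn H z η) := by
      have e1 : ((η, -sprayConn H z η) : Vec n × Vec n) = (η, 0) - (0, sprayConn H z η) := by simp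
      rw [e1, map_sub, sprayConn_apply _ _ (sprayConn H z η), smul_smul]
      norm_num
    have h7 : sprayCurv H z η = (1 / 2 : ℝ) • Q z.2 η - (1 / 2 : ℝ) • Q η z.2 := by
      rw [hQ, hQ, h5, h6, sprayCurv, conn_self hℓ hz, map_neg, ← hHdef]
      module
    rw [h7]
    simp
  simp only [h]
  exact sum_smul_e _

end FinslerCoord

/-! ### Canonical charts of the tangent bundle. -/

section TangentCharts

open Filter

variable {n : ℕ} {M : Type*} [TopologicalSpace M] [ChartedSpace (Vec n) M]
  [IsManifold (𝓡 n) 7 M]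

theorem isManifold_tangentBundle_six : IsManifold (𝓡 n).tangent 6 (TangentBundle (𝓡 n) M) := by
  have : IsManifold (𝓡 n) (6 + 1) M := by norm_num; infer_instance
  have := TangentBundle.contMDiffVectorBundle (I := 𝓡 n) (M := M) (n := 6)
  have : IsManifold (𝓡 n) 6 M := IsManifold.of_le (n := 7) (by norm_num)
  infer_instance

theorem tangentChart_apply (x₀ : M) (v : TangentBundle (𝓡 n) M) :
    tangentChart x₀ v = (extChartAt (𝓡 n) x₀ v.proj,
      tangentCoordChange (𝓡 n) v.proj x₀ v.proj v.2) := rfl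

theorem tangentChart_source (x₀ : M) :
    (tangentChart (n := n) x₀).source = {v | v.proj ∈ (extChartAt (𝓡 n) x₀).source} := by
  ext v
  simp [tangentChart]

theorem tangentChart_target (x₀ : M) :
    (tangentChart (n := n) x₀).target = {z | z.1 ∈ (extChartAt (𝓡 n) x₀).target} := by
  ext z
  simp [tangentChart]
  exact TangentBundle.mem_chart_target_iff _ _

theorem tangentCoordChange_left_inv {x y p : M} (hx : p ∈ (extChartAt (𝓡 n) x).source)
    (hy : p ∈ (extChartAt (𝓡 n) y).source) (a : Vec n) :
    tangentCoordChange (𝓡 n) y x p (tangentCoordChange (𝓡 n) x y p a) = a := by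
  rw [tangentCoordChange_comp ⟨⟨hx, hy⟩, hx⟩, tangentCoordChange_self hx]

theorem tangentChart_symm_apply (x₀ : M) {z : Vec n × Vec n}
    (hz : z.1 ∈ (extChartAt (𝓡 n) x₀).target) :
    (tangentChart x₀).symm z = ⟨(extChartAt (𝓡 n) x₀).symm z.1,
      tangentCoordChange (𝓡 n) x₀ ((extChartAt (𝓡 n) x₀).symm z.1)
        ((extChartAt (𝓡 n) x₀).symm z.1) z.2⟩ := by
  have : z ∈ (tangentChart (n := n) x₀).target := by rw [tangentChart_target]; exact hz
  apply (tangentChart (n := n) x₀).injOn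
  · exact (tangentChart (n := n) x₀).map_target this
  · rw [tangentChart_source]
    exact (extChartAt (𝓡 n) x₀).map_target hz
  rw [(tangentChart (n := n) x₀).right_inv this, tangentChart_apply]
  ext1
  · exact ((extChartAt (𝓡 n) x₀).right_inv hz).symm
  · exact (tangentCoordChange_left_inv ((extChartAt (𝓡 n) x₀).map_target hz)
      (mem_extChartAt_source _) _).symm

theorem tangentChart_self (v : TangentBundle (𝓡 n) M) :
    tangentChart v.proj v = (extChartAt (𝓡 n) v.proj v.proj, v.2) := by
  exact Prod.ext rfl (tangentCoordChange_self (mem_extChartAt_source _))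

theorem fderiv_chartChange {x₀ x₁ p : M} :
    fderiv ℝ (extChartAt (𝓡 n) x₁ ∘ (extChartAt (𝓡 n) x₀).symm) (extChartAt (𝓡 n) x₀ p) =
      tangentCoordChange (𝓡 n) x₀ x₁ p := by
  rw [tangentCoordChange_def]
  simp [fderivWithin_univ]

theorem contDiffAt_chartChange {x₀ x₁ p : M} (h₀ : p ∈ (extChartAt (𝓡 n) x₀).source)
    (h₁ : p ∈ (extChartAt (𝓡 n) x₁).source) :
    ContDiffAt ℝ 7 (extChartAt (𝓡 n) x₁ ∘ (extChartAt (𝓡 n) x₀).symm)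
      (extChartAt (𝓡 n) x₀ p) := by
  have h' : extChartAt (𝓡 n) x₀ p ∈ ((extChartAt (𝓡 n) x₀).symm ≫ extChartAt (𝓡 n) x₁).source := by
    rw [PartialEquiv.trans_source'', PartialEquiv.symm_symm, PartialEquiv.symm_target]
    exact mem_image_of_mem _ ⟨h₀, h₁⟩
  have := contDiffWithinAt_ext_coord_change (n := 7) x₁ x₀ h'
  simpa using! this

/-- Coordinate changes of TM are tangent lifts of coordinate changes of M; this links the manifold
to the spray calculus on E × E. -/
theorem tangentLift_chartChange {x₀ x₁ : M} {v : TangentBundle (𝓡 n) M}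
    (h₀ : v.proj ∈ (extChartAt (𝓡 n) x₀).source) (h₁ : v.proj ∈ (extChartAt (𝓡 n) x₁).source) :
    tangentLift (extChartAt (𝓡 n) x₁ ∘ (extChartAt (𝓡 n) x₀).symm) (tangentChart x₀ v) =
      tangentChart x₁ v := by
  refine Prod.ext (congrArg (extChartAt (𝓡 n) x₁) ((extChartAt (𝓡 n) x₀).left_inv h₀)) ?_
  exact (congrArg (fun L : Vec n →L[ℝ] Vec n => L (tangentChart x₀ v).2) fderiv_chartChange).trans
    (tangentCoordChange_comp ⟨⟨mem_extChartAt_source _, h₀⟩, h₁⟩)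

theorem contMDiffWithinAt_tangentChart {E H N : Type*} [NormedAddCommGroup E] [NormedSpace ℝ E]
    [TopologicalSpace H] {I : ModelWithCorners ℝ E H} [TopologicalSpace N] [ChartedSpace H N]
    {m : WithTop ℕ∞} (hm : m ≤ 6) {f : N → TangentBundle (𝓡 n) M} {s : Set N} {t : N} {x₀ : M}
    (hf : ContMDiffWithinAt I (𝓡 n).tangent m f s t)
    (h₀ : (f t).proj ∈ (extChartAt (𝓡 n) x₀).source) :
    ContMDiffWithinAt I 𝓘(ℝ, Vec n × Vec n) m (fun u => tangentChart x₀ (f u)) s t := by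
  have := isManifold_tangentBundle_six (n := n) (M := M)
  have h1 : ContMDiffAt (𝓡 n).tangent 𝓘(ℝ, Vec n × Vec n) 6 (tangentChart (n := n) x₀) (f t) := by
    refine contMDiffAt_extChartAt' ?_
    rw [← extChartAt_source (𝓡 n).tangent]
    change f t ∈ (tangentChart (n := n) x₀).source
    rw [tangentChart_source]
    exact h₀
  exact (h1.of_le hm).comp_contMDiffWithinAt t hf

theorem contMDiffWithinAt_of_tangentChart {E H N : Type*} [NormedAddCommGroup E] [NormedSpace ℝ E]
    [TopologicalSpace H] {I : ModelWithCorners ℝ E H} [TopologicalSpace N] [ChartedSpace H N]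
    {m : WithTop ℕ∞} (hm : m ≤ 6) {f : N → TangentBundle (𝓡 n) M} {s : Set N} {t : N} {x₀ : M}
    (hf : ContMDiffWithinAt I 𝓘(ℝ, Vec n × Vec n) m (fun u => tangentChart x₀ (f u)) s t)
    (h₀ : ∀ᶠ u in 𝓝[s] t, (f u).proj ∈ (extChartAt (𝓡 n) x₀).source)
    (h₀t : (f t).proj ∈ (extChartAt (𝓡 n) x₀).source) :
    ContMDiffWithinAt I (𝓡 n).tangent m f s t := by
  have := isManifold_tangentBundle_six (n := n) (M := M)
  have hs : ∀ u, (f u).proj ∈ (extChartAt (𝓡 n) x₀).source →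
      f u ∈ (tangentChart (n := n) x₀).source := fun u hu => by
    rw [tangentChart_source]; exact hu
  have hmem : tangentChart x₀ (f t) ∈ (tangentChart (n := n) x₀).target :=
    (tangentChart (n := n) x₀).map_source (hs t h₀t)
  have h1 : ContMDiffAt 𝓘(ℝ, Vec n × Vec n) (𝓡 n).tangent 6 (tangentChart (n := n) x₀).symm
      (tangentChart x₀ (f t)) :=
    (contMDiffOn_extChartAt_symm (n := 6) (I := (𝓡 n).tangent)
      (⟨x₀, 0⟩ : TangentBundle (𝓡 n) M)).contMDiffAt
      ((isOpen_extChartAt_target (I := (𝓡 n).tangent) _).mem_nhds hmem)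
  have h2 := (h1.of_le hm).comp_contMDiffWithinAt t hf
  refine h2.congr_of_eventuallyEq ?_ ?_
  · filter_upwards [h₀] with u hu
    exact ((tangentChart (n := n) x₀).left_inv (hs u hu)).symm
  · exact ((tangentChart (n := n) x₀).left_inv (hs t h₀t)).symm

end TangentCharts

/-! ### The metric, its spray and its curvature in an arbitrary chart. -/

namespace PseudoFinslerMetric

open Filter

variable {n : ℕ} {M : Type*} [TopologicalSpace M] [ChartedSpace (Vec n) M]
  [IsManifold (𝓡 n) 7 M] (F : PseudoFinslerMetric n M)

/-- The domain of `L` in the canonical coordinates of the chart around `x₀`. -/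
def chartDomain (x₀ : M) : Set (Vec n × Vec n) :=
  (tangentChart (n := n) x₀).target ∩ (tangentChart (n := n) x₀).symm ⁻¹' F.A

theorem isOpen_target_inter_preimage (x₀ : M) {s : Set (TangentBundle (𝓡 n) M)} (hs : IsOpen s) :
    IsOpen ((tangentChart (n := n) x₀).target ∩ (tangentChart (n := n) x₀).symm ⁻¹' s) :=
  (continuousOn_extChartAt_symm (I := (𝓡 n).tangent)
    (⟨x₀, 0⟩ : TangentBundle (𝓡 n) M)).isOpen_inter_preimage
    (isOpen_extChartAt_target _) hs

variable {F}

theorem tangentChart_mem_chartDomain {x₀ : M} {v : TangentBundle (𝓡 n) M} (hv : v ∈ F.A)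
    (h₀ : v.proj ∈ (extChartAt (𝓡 n) x₀).source) : tangentChart x₀ v ∈ F.chartDomain x₀ := by
  have hs : v ∈ (tangentChart (n := n) x₀).source := by rw [tangentChart_source]; exact h₀
  refine ⟨(tangentChart (n := n) x₀).map_source hs, ?_⟩
  rw [mem_preimage, (tangentChart (n := n) x₀).left_inv hs]
  exact hv

theorem localL_tangentChart {x₀ : M} {v : TangentBundle (𝓡 n) M}
    (h₀ : v.proj ∈ (extChartAt (𝓡 n) x₀).source) : F.localL x₀ (tangentChart x₀ v) = F.L v := by
  have hs : v ∈ (tangentChart (n := n) x₀).source := by rw [tangentChart_source]; exact h₀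
  rw [localL, (tangentChart (n := n) x₀).left_inv hs]

theorem contDiffOn_localL (x₀ : M) : ContDiffOn ℝ 6 (F.localL x₀) (F.chartDomain x₀) := by
  have := isManifold_tangentBundle_six (n := n) (M := M)
  rw [← contMDiffOn_iff_contDiffOn]
  exact F.contMDiffOn_L.comp ((contMDiffOn_extChartAt_symm (n := 6) (I := (𝓡 n).tangent)
      (⟨x₀, 0⟩ : TangentBundle (𝓡 n) M)).mono inter_subset_left) inter_subset_right

/-- On a single fibre the chart is the affine map κ, so the second differential of L on the fibre is
the vertical Hessian of the local expression of L. -/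
theorem g_eq {x₀ : M} {v : TangentBundle (𝓡 n) M} (hv : v ∈ F.A)
    (h₀ : v.proj ∈ (extChartAt (𝓡 n) x₀).source) (u w : TangentSpace (𝓡 n) v.proj) :
    F.g v u w = (1 / 2) * secondDeriv (F.localL x₀) (tangentChart x₀ v)
      (0, tangentCoordChange (𝓡 n) v.proj x₀ v.proj u)
      (0, tangentCoordChange (𝓡 n) v.proj x₀ v.proj w) := by
  set B : Vec n →L[ℝ] Vec n := tangentCoordChange (𝓡 n) v.proj x₀ v.proj with hB
  let κ : Vec n → Vec n × Vec n := fun y => (extChartAt (𝓡 n) x₀ v.proj, B y)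
  have hκ : ∀ y, HasFDerivAt κ ((ContinuousLinearMap.inr ℝ (Vec n) (Vec n)).comp B) y := by
    intro y
    have := (hasFDerivAt_const (𝕜 := ℝ) (extChartAt (𝓡 n) x₀ v.proj) y).prodMk B.hasFDerivAt
    exact this
  have hU : IsOpen (F.chartDomain x₀) := isOpen_target_inter_preimage x₀ F.isOpen_A
  have hc := contDiffOn_localL (F := F) x₀
  let Lx : Vec n → ℝ := fun y => F.L ⟨v.proj, (tangentComp v.proj).symm y⟩
  have hLx : ∀ y, Lx y = F.localL x₀ (κ y) := fun y =>
    (localL_tangentChart (F := F) (v := ⟨v.proj, (tangentComp v.proj).symm y⟩) h₀).symm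
  set y₀ : Vec n := tangentComp v.proj v.2 with hy₀
  have hz : κ y₀ ∈ F.chartDomain x₀ := tangentChart_mem_chartDomain hv h₀
  have hκo : IsOpen (κ ⁻¹' F.chartDomain x₀) :=
    hU.preimage (continuous_const.prodMk B.continuous)
  have h1 : ∀ y ∈ κ ⁻¹' F.chartDomain x₀, fderiv ℝ Lx y =
      (fderiv ℝ (F.localL x₀) (κ y)).comp ((ContinuousLinearMap.inr ℝ (Vec n) (Vec n)).comp B) := by
    intro y hy
    have := (hasFDerivAt_of_potential hU hc hy).comp y (hκ y)
    rw [show Lx = F.localL x₀ ∘ κ from funext hLx, this.fderiv]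
  have h2 : fderiv ℝ Lx =ᶠ[𝓝 y₀] fun y =>
      (fderiv ℝ (F.localL x₀) (κ y)).comp
        ((ContinuousLinearMap.inr ℝ (Vec n) (Vec n)).comp B) := by
    filter_upwards [hκo.mem_nhds hz] with y hy using h1 y hy
  have h3 := ((hasFDerivAt_fderiv hU hc hz).comp y₀ (hκ y₀)).clm_comp
    (hasFDerivAt_const ((ContinuousLinearMap.inr ℝ (Vec n) (Vec n)).comp B) y₀)
  have h4 : ∀ u w : Vec n, fderiv ℝ (fderiv ℝ Lx) y₀ u w =
      secondDeriv (F.localL x₀) (κ y₀) (0, B u) (0, B w) := by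
    intro u w
    rw [h2.fderiv_eq]
    have h5 := congrArg (fun L : Vec n →L[ℝ] Vec n →L[ℝ] ℝ => L u w) h3.fderiv
    refine h5.trans ?_
    simp
  exact congrArg (fun r => (1 / 2) * r) (h4 u w)

theorem isConicPotential (x₀ : M) : IsConicPotential (F.localL x₀) (F.chartDomain x₀) where
  isOpen := isOpen_target_inter_preimage x₀ F.isOpen_A
  contDiffOn := contDiffOn_localL x₀
  homogeneous := by
    rintro z ⟨hzt, hzA⟩
    rw [tangentChart_target] at hzt
    rw [mem_preimage, tangentChart_symm_apply x₀ hzt] at hzA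
    filter_upwards [lt_mem_nhds (zero_lt_one : (0 : ℝ) < 1)] with c hc
    have h := F.homogeneous _ hzA c hc
    rw [localL, localL, tangentChart_symm_apply x₀ hzt,
      tangentChart_symm_apply (z := (z.1, c • z.2)) x₀ hzt, map_smul]
    exact h
  nondegenerate := by
    rintro z ⟨hzt, hzA⟩ u hu
    have hzt' := hzt
    rw [tangentChart_target] at hzt'
    have h₀ : ((tangentChart (n := n) x₀).symm z).proj ∈ (extChartAt (𝓡 n) x₀).source :=
      (extChartAt (𝓡 n) x₀).map_target hzt'
    set v := (tangentChart (n := n) x₀).symm z with hv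
    have hvz : tangentChart x₀ v = z := (tangentChart (n := n) x₀).right_inv hzt
    have h1 := F.nondegenerate v hzA (tangentCoordChange (𝓡 n) x₀ v.proj v.proj u) (fun w => by
      have := g_eq hzA h₀ (tangentCoordChange (𝓡 n) x₀ v.proj v.proj u) w
      rw [tangentCoordChange_left_inv h₀ (mem_extChartAt_source _), hvz, hu, mul_zero] at this
      exact this)
    have h2 := congrArg (tangentCoordChange (𝓡 n) v.proj x₀ v.proj) h1
    rw [tangentCoordChange_left_inv h₀ (mem_extChartAt_source _)] at h2
    exact h2.trans (map_zero _)

theorem _root_.IsConicPotential.mono {E : Type*} [NormedAddCommGroup E] [NormedSpace ℝ E]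
    {ℓ : E × E → ℝ} {U V : Set (E × E)} (h : IsConicPotential ℓ U) (hV : IsOpen V) (hVU : V ⊆ U) :
    IsConicPotential ℓ V :=
  ⟨hV, h.contDiffOn.mono hVU, fun z hz => h.homogeneous z (hVU hz),
    fun z hz => h.nondegenerate z (hVU hz)⟩

/-- The part of `chartDomain x₀` lying over the chart around `x₁`. -/
def overlapDomain (F : PseudoFinslerMetric n M) (x₀ x₁ : M) : Set (Vec n × Vec n) :=
  (tangentChart (n := n) x₀).target ∩ (tangentChart (n := n) x₀).symm ⁻¹'
    (F.A ∩ {v | v.proj ∈ (extChartAt (𝓡 n) x₁).source})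

theorem isConicPotential_overlapDomain (x₀ x₁ : M) :
    IsConicPotential (F.localL x₀) (F.overlapDomain x₀ x₁) := by
  refine (isConicPotential x₀).mono (isOpen_target_inter_preimage x₀ (F.isOpen_A.inter ?_))
    fun z hz => ⟨hz.1, hz.2.1⟩
  exact (isOpen_extChartAt_source x₁).preimage (FiberBundle.continuous_proj _ _)

theorem tangentChart_mem_overlapDomain {x₀ x₁ : M} {v : TangentBundle (𝓡 n) M} (hv : v ∈ F.A)
    (h₀ : v.proj ∈ (extChartAt (𝓡 n) x₀).source) (h₁ : v.proj ∈ (extChartAt (𝓡 n) x₁).source) :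
    tangentChart x₀ v ∈ F.overlapDomain x₀ x₁ := by
  have hs : v ∈ (tangentChart (n := n) x₀).source := by rw [tangentChart_source]; exact h₀
  refine ⟨(tangentChart (n := n) x₀).map_source hs, ?_⟩
  rw [mem_preimage, (tangentChart (n := n) x₀).left_inv hs]
  exact ⟨hv, h₁⟩

theorem isCoordChange (x₀ x₁ : M) :
    IsCoordChange (F.localL x₀) (F.localL x₁) (F.overlapDomain x₀ x₁) (F.chartDomain x₁)
      (extChartAt (𝓡 n) x₁ ∘ (extChartAt (𝓡 n) x₀).symm) := by
  have hv : ∀ z ∈ F.overlapDomain x₀ x₁, ∃ v : TangentBundle (𝓡 n) M, v ∈ F.A ∧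
      v.proj ∈ (extChartAt (𝓡 n) x₀).source ∧ v.proj ∈ (extChartAt (𝓡 n) x₁).source ∧
      tangentChart x₀ v = z := by
    rintro z ⟨hzt, hzA, hz1⟩
    refine ⟨_, hzA, ?_, hz1, (tangentChart (n := n) x₀).right_inv hzt⟩
    rw [tangentChart_target] at hzt
    exact (extChartAt (𝓡 n) x₀).map_target hzt
  refine ⟨fun z hz => ?_, fun z hz => ?_, fun z hz => ?_, fun z hz => ?_⟩ <;>
    obtain ⟨v, hvA, h₀, h₁, rfl⟩ := hv z hz
  · exact contDiffAt_chartChange h₀ h₁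
  · rw [tangentChart_apply]
    simp only
    rw [fderiv_chartChange]
    exact fun a => ⟨_, tangentCoordChange_left_inv h₁ h₀ a⟩
  · rw [tangentLift_chartChange h₀ h₁]
    exact tangentChart_mem_chartDomain hvA h₁
  · rw [tangentLift_chartChange h₀ h₁, localL_tangentChart h₀, localL_tangentChart h₁]

/-- The spray coefficients of the metric in the chart around `x₀`. -/
def spray (F : PseudoFinslerMetric n M) (x₀ : M) : Vec n × Vec n → Vec n :=
  coordSpray (F.localL x₀)

theorem isSpray (x₀ : M) : IsSpray (F.localL x₀) (F.chartDomain x₀) (F.spray x₀) :=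
  isSpray_coordSpray (isConicPotential x₀)

theorem isSpray_overlapDomain (x₀ x₁ : M) :
    IsSpray (F.localL x₀) (F.overlapDomain x₀ x₁) (F.spray x₀) :=
  isSpray_coordSpray (isConicPotential_overlapDomain x₀ x₁)

theorem chernTerm_self {v : TangentBundle (𝓡 n) M} (hv : v ∈ F.A) (u : Vec n) :
    F.chernTerm v u v.2 = sprayConn (F.spray v.proj) (tangentChart v.proj v) u := by
  have hz := tangentChart_mem_chartDomain hv (mem_extChartAt_source (I := 𝓡 n) v.proj)
  refine Eq.trans ?_ (sum_sum_chernSymbol (isConicPotential v.proj) hz u)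
  have h : (tangentChart v.proj v).2 = v.2 := congrArg Prod.snd (tangentChart_self v)
  rw [h]
  rfl

theorem R_self {v : TangentBundle (𝓡 n) M} (hv : v ∈ F.A) (η : TangentSpace (𝓡 n) v.proj) :
    F.R v v.2 η v.2 = sprayCurv (F.spray v.proj) (tangentChart v.proj v) η := by
  have hz := tangentChart_mem_chartDomain hv (mem_extChartAt_source (I := 𝓡 n) v.proj)
  refine Eq.trans ?_ (sum_sum_sum_chernCurv (isConicPotential v.proj) hz η)
  have h : (tangentChart v.proj v).2 = v.2 := congrArg Prod.snd (tangentChart_self v)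
  rw [h]
  rfl

/-- `R` is defined in the chart around the base point of v, which varies along a curve. By
tensoriality one fixed chart computes it at all nearby points. -/
theorem R_eq {x₀ : M} {v : TangentBundle (𝓡 n) M} (hv : v ∈ F.A)
    (h₀ : v.proj ∈ (extChartAt (𝓡 n) x₀).source) (η : TangentSpace (𝓡 n) v.proj) :
    tangentCoordChange (𝓡 n) v.proj x₀ v.proj (F.R v v.2 η v.2) =
      sprayCurv (F.spray x₀) (tangentChart x₀ v)
        (tangentCoordChange (𝓡 n) v.proj x₀ v.proj η) := by
  have hp := mem_extChartAt_source (I := 𝓡 n) v.proj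
  have h := (isCoordChange (F := F) v.proj x₀).curv_eq (isConicPotential_overlapDomain _ _)
    (isConicPotential x₀) (isSpray_overlapDomain _ _) (isSpray x₀)
    (tangentChart_mem_overlapDomain hv hp h₀) η
  rw [tangentLift_chartChange hp h₀] at h
  have e1 : fderiv ℝ (extChartAt (𝓡 n) x₀ ∘ (extChartAt (𝓡 n) v.proj).symm)
      (tangentChart v.proj v).1 = tangentCoordChange (𝓡 n) v.proj x₀ v.proj := fderiv_chartChange
  rw [e1] at h
  rw [R_self hv]
  exact h.symm

theorem g_comm {v : TangentBundle (𝓡 n) M} (hv : v ∈ F.A) (u w : TangentSpace (𝓡 n) v.proj) :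
    F.g v u w = F.g v w u := by
  have hp := mem_extChartAt_source (I := 𝓡 n) v.proj
  rw [g_eq hv hp, g_eq hv hp, secondDeriv_comm (isConicPotential v.proj).isOpen
    (isConicPotential v.proj).contDiffOn (tangentChart_mem_chartDomain hv hp)]

theorem g_R_symm {v : TangentBundle (𝓡 n) M} (hv : v ∈ F.A) (u w : TangentSpace (𝓡 n) v.proj) :
    F.g v (F.R v v.2 u v.2) w = F.g v (F.R v v.2 w v.2) u := by
  have hp := mem_extChartAt_source (I := 𝓡 n) v.proj
  rw [g_eq hv hp, g_eq hv hp, R_eq hv hp, R_eq hv hp, (isSpray v.proj).curv_symm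
    (isConicPotential v.proj) (tangentChart_mem_chartDomain hv hp)]

end PseudoFinslerMetric

/-- Differentiating φ'(x(u)) yields the term φ''(y, ζ), which is exactly the defect in the
transformation law of the connection. -/
theorem IsCoordChange.hasDerivWithinAt_covariant {E : Type*} [NormedAddCommGroup E]
    [NormedSpace ℝ E] [FiniteDimensional ℝ E] {ℓ ℓ' : E × E → ℝ} {U U' : Set (E × E)} {φ : E → E}
    (hφ : IsCoordChange ℓ ℓ' U U' φ) (hℓ : IsConicPotential ℓ U) (hℓ' : IsConicPotential ℓ' U')
    {H H' : E × E → E} (hH : IsSpray ℓ U H) (hH' : IsSpray ℓ' U' H') {z : ℝ → E × E} {ζ : ℝ → E}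
    {w : E} {s : Set ℝ} {t : ℝ} (hz : HasDerivWithinAt (fun u => (z u).1) (z t).2 s t)
    (hzU : z t ∈ U) (hζ : HasDerivWithinAt ζ (w - sprayConn H (z t) (ζ t)) s t) :
    HasDerivWithinAt (fun u => fderiv ℝ φ (z u).1 (ζ u)) (fderiv ℝ φ (z t).1 w -
      sprayConn H' (tangentLift φ (z t)) (fderiv ℝ φ (z t).1 (ζ t))) s t := by
  have h1 := hasFDerivAt_second_of_contDiffAt (hφ.contDiffAt _ hzU)
  have h2 : HasDerivWithinAt (fun u => fderiv ℝ φ (z u).1)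
      (fderiv ℝ (fderiv ℝ φ) (z t).1 (z t).2) s t :=
    HasFDerivAt.comp_hasDerivWithinAt (f := fun u => (z u).1) t h1 hz
  have h := h2.clm_apply hζ
  refine h.congr_deriv ?_
  rw [hφ.conn_eq hℓ hℓ' hH hH' hzU, map_sub]
  abel

/-! ### Covariant derivatives along a geodesic, in any chart. -/

section Curves

open Filter

variable {n : ℕ} {M : Type*} [TopologicalSpace M] [ChartedSpace (Vec n) M]
  [IsManifold (𝓡 n) 7 M] {F : PseudoFinslerMetric n M} {τ : ℝ} {γ : ℝ → M}

/-- The coordinates of the velocity of a curve in the chart around `x₀`. -/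
def velocityChart (τ : ℝ) (γ : ℝ → M) (x₀ : M) (u : ℝ) : Vec n × Vec n :=
  tangentChart x₀ (liftField γ (velocity τ γ) u)

/-- The components of a field along a curve in the chart around `x₀`. -/
def fieldChart (γ : ℝ → M) (ζ : ∀ t, TangentSpace (𝓡 n) (γ t)) (x₀ : M) (u : ℝ) : Vec n :=
  (tangentChart x₀ (liftField γ ζ u)).2

theorem fieldChart_eq (ζ : ∀ t, TangentSpace (𝓡 n) (γ t)) (x₀ : M) (u : ℝ) :
    fieldChart γ ζ x₀ u = tangentCoordChange (𝓡 n) (γ u) x₀ (γ u) (tangentComp (γ u) (ζ u)) := rfl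

theorem fieldChart_self (ζ : ∀ t, TangentSpace (𝓡 n) (γ t)) (u : ℝ) :
    fieldChart γ ζ (γ u) u = tangentComp (γ u) (ζ u) :=
  tangentCoordChange_self (mem_extChartAt_source _)

theorem fieldChart_change (ζ : ∀ t, TangentSpace (𝓡 n) (γ t)) {x₀ x₁ : M} {u : ℝ}
    (h₀ : γ u ∈ (extChartAt (𝓡 n) x₀).source) (h₁ : γ u ∈ (extChartAt (𝓡 n) x₁).source) :
    fieldChart γ ζ x₁ u = tangentCoordChange (𝓡 n) x₀ x₁ (γ u) (fieldChart γ ζ x₀ u) :=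
  (tangentCoordChange_comp ⟨⟨mem_extChartAt_source _, h₀⟩, h₁⟩).symm

theorem velocityChart_fst (x₀ : M) (u : ℝ) :
    (velocityChart (n := n) τ γ x₀ u).1 = extChartAt (𝓡 n) x₀ (γ u) := rfl

theorem velocityChart_snd (x₀ : M) (u : ℝ) :
    (velocityChart (n := n) τ γ x₀ u).2 = fieldChart γ (velocity τ γ) x₀ u := rfl

omit [IsManifold (𝓡 n) 7 M] in
theorem eventually_mem_source {s : Set ℝ} {t : ℝ} {x₀ : M} (hγ : ContinuousWithinAt γ s t)
    (h₀ : γ t ∈ (extChartAt (𝓡 n) x₀).source) :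
    ∀ᶠ u in 𝓝[s] t, γ u ∈ (extChartAt (𝓡 n) x₀).source :=
  hγ ((isOpen_extChartAt_source x₀).mem_nhds h₀)

theorem hasDerivWithinAt_extChartAt_comp {t : ℝ} {x₀ : M}
    (hγ : MDifferentiableWithinAt 𝓘(ℝ, ℝ) (𝓡 n) γ (Icc 0 τ) t)
    (h₀ : γ t ∈ (extChartAt (𝓡 n) x₀).source) :
    HasDerivWithinAt (fun u => extChartAt (𝓡 n) x₀ (γ u)) (velocityChart τ γ x₀ t).2
      (Icc 0 τ) t := by
  have h1 := hγ.hasMFDerivWithinAt.2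
  have h2 : HasDerivWithinAt (fun u => extChartAt (𝓡 n) (γ t) (γ u))
      (tangentComp (γ t) (velocity τ γ t)) (Icc 0 τ) t := by
    obtain ⟨B, hB⟩ : ∃ B : ℝ →L[ℝ] Vec n, B = mfderivWithin 𝓘(ℝ, ℝ) (𝓡 n) γ (Icc 0 τ) t := ⟨_, rfl⟩
    have h3 : HasFDerivWithinAt (fun u => extChartAt (𝓡 n) (γ t) (γ u)) B (Icc 0 τ) t := by
      rw [hB]
      simpa [writtenInExtChartAt, Function.comp_def] using! h1
    have h4 : tangentComp (γ t) (velocity τ γ t) = B 1 := by rw [hB]; rfl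
    rw [h4]
    exact h3.hasDerivWithinAt
  have h4 : HasFDerivAt (extChartAt (𝓡 n) x₀ ∘ (extChartAt (𝓡 n) (γ t)).symm)
      (tangentCoordChange (𝓡 n) (γ t) x₀ (γ t)) (extChartAt (𝓡 n) (γ t) (γ t)) := by
    rw [← fderiv_chartChange]
    exact ((contDiffAt_chartChange (mem_extChartAt_source _) h₀).differentiableAt
      (by norm_num)).hasFDerivAt
  refine (h4.comp_hasDerivWithinAt t h2).congr_of_eventuallyEq ?_ ?_
  · filter_upwards [eventually_mem_source (n := n) hγ.continuousWithinAt
      (mem_extChartAt_source (γ t))] with u hu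
    change _ = extChartAt (𝓡 n) x₀ ((extChartAt (𝓡 n) (γ t)).symm (extChartAt (𝓡 n) (γ t) (γ u)))
    rw [(extChartAt (𝓡 n) (γ t)).left_inv hu]
  · change _ = extChartAt (𝓡 n) x₀ ((extChartAt (𝓡 n) (γ t)).symm (extChartAt (𝓡 n) (γ t) (γ t)))
    rw [(extChartAt (𝓡 n) (γ t)).left_inv (mem_extChartAt_source _)]

namespace PseudoFinslerMetric

/-- The field `w` is the covariant derivative within `s` at `t` of the field `ζ` along the
geodesic `γ`. -/
def HasCovDerivWithin (F : PseudoFinslerMetric n M) (τ : ℝ) (γ : ℝ → M)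
    (ζ : ∀ t, TangentSpace (𝓡 n) (γ t)) (s : Set ℝ) (t : ℝ) (w : TangentSpace (𝓡 n) (γ t)) :
    Prop :=
  HasDerivWithinAt (fieldChart γ ζ (γ t)) (tangentComp (γ t) w -
    sprayConn (F.spray (γ t)) (velocityChart τ γ (γ t) t) (fieldChart γ ζ (γ t) t)) s t

namespace IsGeodesic

variable (hγ : F.IsGeodesic τ γ)
include hγ

theorem mdifferentiableWithinAt {t : ℝ} (ht : t ∈ Icc 0 τ) :
    MDifferentiableWithinAt 𝓘(ℝ, ℝ) (𝓡 n) γ (Icc 0 τ) t :=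
  (hγ.contMDiffOn t ht).mdifferentiableWithinAt (by norm_num)

theorem continuousWithinAt {t : ℝ} (ht : t ∈ Icc 0 τ) : ContinuousWithinAt γ (Icc 0 τ) t :=
  (hγ.contMDiffOn t ht).continuousWithinAt

theorem velocityChart_mem {t : ℝ} (ht : t ∈ Icc 0 τ) {x₀ : M}
    (h₀ : γ t ∈ (extChartAt (𝓡 n) x₀).source) : velocityChart τ γ x₀ t ∈ F.chartDomain x₀ :=
  tangentChart_mem_chartDomain (hγ.admissible t ht) h₀

theorem hasDerivWithinAt_change {ζ : ∀ t, TangentSpace (𝓡 n) (γ t)} {s : Set ℝ}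
    (hs : s ⊆ Icc 0 τ) {t : ℝ} (ht : t ∈ Icc 0 τ) {x₀ x₁ : M}
    (h₀ : γ t ∈ (extChartAt (𝓡 n) x₀).source) (h₁ : γ t ∈ (extChartAt (𝓡 n) x₁).source)
    {w : Vec n}
    (h : HasDerivWithinAt (fieldChart γ ζ x₀) (w - sprayConn (F.spray x₀) (velocityChart τ γ x₀ t)
      (fieldChart γ ζ x₀ t)) s t) :
    HasDerivWithinAt (fieldChart γ ζ x₁) (tangentCoordChange (𝓡 n) x₀ x₁ (γ t) w -
      sprayConn (F.spray x₁) (velocityChart τ γ x₁ t) (fieldChart γ ζ x₁ t)) s t := by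
  have hx := (hasDerivWithinAt_extChartAt_comp (hγ.mdifferentiableWithinAt ht) h₀).mono hs
  have h2 := (isCoordChange (F := F) x₀ x₁).hasDerivWithinAt_covariant
    (isConicPotential_overlapDomain _ _) (isConicPotential x₁) (isSpray_overlapDomain _ _)
    (isSpray x₁) (z := velocityChart τ γ x₀) hx
    (tangentChart_mem_overlapDomain (hγ.admissible t ht) h₀ h₁) h
  have e : ∀ u, γ u ∈ (extChartAt (𝓡 n) x₀).source → γ u ∈ (extChartAt (𝓡 n) x₁).source →
      fieldChart γ ζ x₁ u = fderiv ℝ (extChartAt (𝓡 n) x₁ ∘ (extChartAt (𝓡 n) x₀).symm)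
        (velocityChart τ γ x₀ u).1 (fieldChart γ ζ x₀ u) := by
    intro u hu₀ hu₁
    rw [velocityChart_fst, fderiv_chartChange, fieldChart_change ζ hu₀ hu₁]
  have hc := (hγ.continuousWithinAt ht).mono hs
  rw [← e t h₀ h₁, velocityChart_fst, fderiv_chartChange, velocityChart,
    tangentLift_chartChange (v := liftField γ (velocity τ γ) t) h₀ h₁] at h2
  refine h2.congr_of_eventuallyEq ?_ (e t h₀ h₁)
  filter_upwards [eventually_mem_source hc h₀, eventually_mem_source hc h₁] with u hu₀ hu₁
  exact e u hu₀ hu₁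

/-- The definition of `HasCovDerivWithin` uses the chart around γ(t). Differential equations along γ
need one chart valid on an interval of times. -/
theorem hasCovDerivWithin_iff {ζ : ∀ t, TangentSpace (𝓡 n) (γ t)} {s : Set ℝ}
    (hs : s ⊆ Icc 0 τ) {t : ℝ} (ht : t ∈ Icc 0 τ) {x₀ : M}
    (h₀ : γ t ∈ (extChartAt (𝓡 n) x₀).source) {w : TangentSpace (𝓡 n) (γ t)} :
    F.HasCovDerivWithin τ γ ζ s t w ↔
      HasDerivWithinAt (fieldChart γ ζ x₀)
        (tangentCoordChange (𝓡 n) (γ t) x₀ (γ t) (tangentComp (γ t) w) -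
          sprayConn (F.spray x₀) (velocityChart τ γ x₀ t) (fieldChart γ ζ x₀ t)) s t := by
  have hp := mem_extChartAt_source (I := 𝓡 n) (γ t)
  refine ⟨fun h => hγ.hasDerivWithinAt_change hs ht hp h₀ h, fun h => ?_⟩
  have := hγ.hasDerivWithinAt_change hs ht h₀ hp h
  rwa [tangentCoordChange_left_inv hp h₀] at this

/-- The Chern term of D is evaluated on γ̇ in both the reference and the direction slot, so
`chernTerm_self` replaces it by the spray connection. -/
theorem D_eq {ζ : ∀ t, TangentSpace (𝓡 n) (γ t)} (hτ : 0 < τ) {t : ℝ} (ht : t ∈ Icc 0 τ)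
    {w : TangentSpace (𝓡 n) (γ t)} (h : F.HasCovDerivWithin τ γ ζ (Icc 0 τ) t w) :
    F.D τ γ ζ t = w := by
  have h1 := HasDerivWithinAt.derivWithin h (uniqueDiffOn_Icc hτ t ht)
  have h2 := chernTerm_self (hγ.admissible t ht) (tangentComp (γ t) (ζ t))
  have h3 : tangentComp (γ t) (F.D τ γ ζ t) =
      derivWithin (fieldChart γ ζ (γ t)) (Icc 0 τ) t
        + F.chernTerm ⟨γ t, velocity τ γ t⟩ (tangentComp (γ t) (ζ t))
          (tangentComp (γ t) (velocity τ γ t)) := rfl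
  apply (tangentComp (γ t)).injective
  rw [h3, h1, fieldChart_self]
  exact (congrArg _ h2).trans (sub_add_cancel _ _)

theorem contDiffWithinAt_chart {t : ℝ} (ht : t ∈ Icc 0 τ) {x₀ : M}
    (h₀ : γ t ∈ (extChartAt (𝓡 n) x₀).source) :
    ContDiffWithinAt ℝ 2 (fun u => extChartAt (𝓡 n) x₀ (γ u)) (Icc 0 τ) t := by
  rw [← contMDiffWithinAt_iff_contDiffWithinAt]
  have h1 : ContMDiffAt (𝓡 n) 𝓘(ℝ, Vec n) 2 (extChartAt (𝓡 n) x₀) (γ t) := by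
    refine (contMDiffAt_extChartAt' (n := 7) ?_).of_le (by norm_num)
    rwa [← extChartAt_source (𝓡 n)]
  exact h1.comp_contMDiffWithinAt t (hγ.contMDiffOn t ht)

theorem contDiffWithinAt_velocityChart (hτ : 0 < τ) {t : ℝ} (ht : t ∈ Icc 0 τ) {x₀ : M}
    (h₀ : γ t ∈ (extChartAt (𝓡 n) x₀).source) :
    ContDiffWithinAt ℝ 1 (velocityChart (n := n) τ γ x₀) (Icc 0 τ) t := by
  have h1 := hγ.contDiffWithinAt_chart ht h₀
  have h2 := h1.fderivWithin_right (m := 1) (uniqueDiffOn_Icc hτ) (by norm_num) ht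
  have h3 : ContDiffWithinAt ℝ 1 (fun u => (velocityChart (n := n) τ γ x₀ u).2) (Icc 0 τ) t := by
    refine (h2.clm_apply (contDiffWithinAt_const (c := (1 : ℝ)))).congr_of_eventuallyEq_of_mem
      ?_ ht
    filter_upwards [self_mem_nhdsWithin, eventually_mem_source (hγ.continuousWithinAt ht) h₀]
      with u hu hu₀
    exact ((hasDerivWithinAt_extChartAt_comp (hγ.mdifferentiableWithinAt hu) hu₀).derivWithin
      (uniqueDiffOn_Icc hτ u hu)).symm
  exact (h1.of_le (by norm_num)).prodMk h3

theorem hasCovDerivWithin_velocity (hτ : 0 < τ) {t : ℝ} (ht : t ∈ Icc 0 τ) :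
    F.HasCovDerivWithin τ γ (velocity τ γ) (Icc 0 τ) t 0 := by
  have h1 : ContDiffWithinAt ℝ 1 (fieldChart γ (velocity τ γ) (γ t)) (Icc 0 τ) t :=
    (hγ.contDiffWithinAt_velocityChart hτ ht (mem_extChartAt_source (γ t))).snd
  have h2 := (h1.differentiableWithinAt (by norm_num)).hasDerivWithinAt
  refine h2.congr_deriv ?_
  have h3 := congrArg (tangentComp (γ t)) (hγ.parallel t ht)
  have h4 : tangentComp (γ t) (F.D τ γ (velocity τ γ) t) =
      derivWithin (fieldChart γ (velocity τ γ) (γ t)) (Icc 0 τ) t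
        + F.chernTerm ⟨γ t, velocity τ γ t⟩ (tangentComp (γ t) (velocity τ γ t))
          (tangentComp (γ t) (velocity τ γ t)) := rfl
  have h5 := chernTerm_self (hγ.admissible t ht) (tangentComp (γ t) (velocity τ γ t))
  rw [h4, map_zero] at h3
  rw [map_zero, zero_sub, fieldChart_self]
  exact (eq_neg_of_add_eq_zero_left h3).trans (congrArg Neg.neg h5)

/-- The geodesic equation x'' = -H(x, x'): parallelism of γ̇ together with N y = H. Hence the
velocity is an integral curve of the spray. -/
theorem hasDerivWithinAt_velocityChart (hτ : 0 < τ) {t : ℝ} (ht : t ∈ Icc 0 τ) {x₀ : M}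
    (h₀ : γ t ∈ (extChartAt (𝓡 n) x₀).source) :
    HasDerivWithinAt (velocityChart τ γ x₀) ((velocityChart τ γ x₀ t).2,
      -F.spray x₀ (velocityChart τ γ x₀ t)) (Icc 0 τ) t := by
  have h1 := (hγ.hasCovDerivWithin_iff Subset.rfl ht h₀).1 (hγ.hasCovDerivWithin_velocity hτ ht)
  rw [map_zero, map_zero, zero_sub, ← velocityChart_snd] at h1
  have h2 := conn_self (isConicPotential (F := F) x₀) (hγ.velocityChart_mem ht h₀)
  have h3 := (hasDerivWithinAt_extChartAt_comp (hγ.mdifferentiableWithinAt ht) h₀).prodMk h1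
  exact h3.congr_deriv (Prod.ext rfl (congrArg Neg.neg h2))

end IsGeodesic

end PseudoFinslerMetric

end Curves

theorem contDiffWithinAt_succ_of_hasDerivWithinAt {E : Type*} [NormedAddCommGroup E]
    [NormedSpace ℝ E] {m : ℕ} {f f' : ℝ → E} {s : Set ℝ} {t : ℝ} (ht : t ∈ s)
    (hf : ∀ᶠ u in 𝓝[s] t, HasDerivWithinAt f (f' u) s u) (hf' : ContDiffWithinAt ℝ m f' s t) :
    ContDiffWithinAt ℝ (m + 1 : ℕ) f s t := by
  rw [Nat.cast_add, Nat.cast_one, contDiffWithinAt_succ_iff_hasFDerivWithinAt' (by simp)]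
  refine ⟨{u | HasDerivWithinAt f (f' u) s u} ∩ s, ?_, inter_subset_right.trans
    (subset_insert _ _), by simp, fun u => ContinuousLinearMap.toSpanSingleton ℝ (f' u), ?_, ?_⟩
  · rw [insert_eq_of_mem ht]
    exact Filter.inter_mem hf self_mem_nhdsWithin
  · exact fun u hu => hu.1.hasFDerivWithinAt
  · exact ((ContinuousLinearMap.toSpanSingletonCLE (𝕜 := ℝ) (E := E)).contDiff.contDiffAt
      ).comp_contDiffWithinAt t hf'

-- By the product rule, the derivative of the Hessian along the spray appears, and `conn_add_conn`
-- says that it equals the two connection terms subtracted from X' and Y'.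
set_option maxSynthPendingDepth 4 in
theorem IsSpray.hasDerivWithinAt_metric {E : Type*} [NormedAddCommGroup E]
    [NormedSpace ℝ E] [FiniteDimensional ℝ E] {ℓ : E × E → ℝ} {U : Set (E × E)} {H : E × E → E}
    (hH : IsSpray ℓ U H) (hℓ : IsConicPotential ℓ U) {z : ℝ → E × E} {s : Set ℝ} {t : ℝ}
    (hzU : z t ∈ U) (hz : HasDerivWithinAt z ((z t).2, -H (z t)) s t) {X Y : ℝ → E} {w w' : E}
    (hX : HasDerivWithinAt X (w - sprayConn H (z t) (X t)) s t)
    (hY : HasDerivWithinAt Y (w' - sprayConn H (z t) (Y t)) s t) :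
    HasDerivWithinAt (fun u => secondDeriv ℓ (z u) (0, X u) (0, Y u))
      (secondDeriv ℓ (z t) (0, w) (0, Y t) + secondDeriv ℓ (z t) (0, X t) (0, w')) s t := by
  have h1 := hasFDerivAt_secondDeriv hℓ.isOpen hℓ.contDiffOn hzU
  have h2 : HasDerivWithinAt (fun u => secondDeriv ℓ (z u))
      (thirdDeriv ℓ (z t) ((z t).2, -H (z t))) s t :=
    HasFDerivAt.comp_hasDerivWithinAt t h1 hz
  have hX' : HasDerivWithinAt (fun u => ((0, X u) : E × E)) (0, w - sprayConn H (z t) (X t)) s t :=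
    (hasDerivWithinAt_const t s (0 : E)).prodMk hX
  have hY' : HasDerivWithinAt (fun u => ((0, Y u) : E × E)) (0, w' - sprayConn H (z t) (Y t)) s t :=
    (hasDerivWithinAt_const t s (0 : E)).prodMk hY
  refine ((h2.clm_apply hX').clm_apply hY').congr_deriv ?_
  have h3 := hH.conn_add_conn hℓ hzU (X t) (Y t)
  have e : ∀ a b : E, ((0, a - b) : E × E) = (0, a) - (0, b) := fun a b => by simp
  rw [e, e, add_apply, map_sub, map_sub, sub_apply, ← h3]
  ring

/-! ### Regularity and metric compatibility for fields along a geodesic. -/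

section Fields

open Filter

variable {n : ℕ} {M : Type*} [TopologicalSpace M] [ChartedSpace (Vec n) M]
  [IsManifold (𝓡 n) 7 M] {F : PseudoFinslerMetric n M} {τ : ℝ} {γ : ℝ → M}

theorem fieldChart_sum {κ : Type*} [Fintype κ] (f : κ → ℝ → ℝ)
    (E : κ → ∀ t, TangentSpace (𝓡 n) (γ t)) (x₀ : M) (u : ℝ) :
    fieldChart γ (fun t => ∑ i, f i t • E i t) x₀ u = ∑ i, f i u • fieldChart γ (E i) x₀ u := by
  simp only [fieldChart_eq, map_sum, map_smul]

theorem contDiffWithinAt_fieldChart {m : ℕ} (hm : m ≤ 6) {ζ : ∀ t, TangentSpace (𝓡 n) (γ t)}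
    {s : Set ℝ} {t : ℝ} (ht : t ∈ s) (h : IsCrField m γ s ζ) {x₀ : M}
    (h₀ : γ t ∈ (extChartAt (𝓡 n) x₀).source) :
    ContDiffWithinAt ℝ m (fieldChart γ ζ x₀) s t := by
  have h1 := contMDiffWithinAt_tangentChart (x₀ := x₀) (by exact_mod_cast hm) (h t ht) h₀
  exact (contMDiffWithinAt_iff_contDiffWithinAt.1 h1).snd

namespace PseudoFinslerMetric

theorem HasCovDerivWithin.sum {κ : Type*} [Fintype κ] {f : κ → ℝ → ℝ} {f' : κ → ℝ}
    {E : κ → ∀ t, TangentSpace (𝓡 n) (γ t)} {s : Set ℝ} {t : ℝ}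
    {w : κ → TangentSpace (𝓡 n) (γ t)}
    (hE : ∀ i, F.HasCovDerivWithin τ γ (E i) s t (w i))
    (hf : ∀ i, HasDerivWithinAt (f i) (f' i) s t) :
    F.HasCovDerivWithin τ γ (fun u => ∑ i, f i u • E i u) s t
      (∑ i, (f' i • E i t + f i t • w i)) := by
  have h : HasDerivWithinAt (fun u => ∑ i, f i u • fieldChart γ (E i) (γ t) u)
      (∑ i, (f i t • (tangentComp (γ t) (w i) - sprayConn (F.spray (γ t))
        (velocityChart τ γ (γ t) t) (fieldChart γ (E i) (γ t) t)) +
          f' i • fieldChart γ (E i) (γ t) t)) s t :=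
    HasDerivWithinAt.fun_sum fun i _ => (hf i).smul (hE i)
  refine (h.congr_of_eventuallyEq (Eventually.of_forall fun u => fieldChart_sum f E _ u)
    (fieldChart_sum f E _ t)).congr_deriv ?_
  rw [fieldChart_sum, map_sum, map_sum, ← Finset.sum_sub_distrib]
  refine Finset.sum_congr rfl fun i _ => ?_
  rw [map_add, map_smul, map_smul, map_smul, fieldChart_self, smul_sub]
  abel

theorem HasCovDerivWithin.congr {ζ ζ' : ∀ t, TangentSpace (𝓡 n) (γ t)} {s : Set ℝ} {t : ℝ}
    {w : TangentSpace (𝓡 n) (γ t)} (h : F.HasCovDerivWithin τ γ ζ s t w)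
    (hs : ∀ u ∈ s, ζ' u = ζ u) (ht : t ∈ s) : F.HasCovDerivWithin τ γ ζ' s t w := by
  have e : ∀ u ∈ s, fieldChart γ ζ' (γ t) u = fieldChart γ ζ (γ t) u := fun u hu => by
    rw [fieldChart_eq, fieldChart_eq, hs u hu]
  rw [HasCovDerivWithin, e t ht]
  exact HasDerivWithinAt.congr h e (e t ht)

namespace IsGeodesic

variable (hγ : F.IsGeodesic τ γ)
include hγ

theorem isCrField_of_fieldChart {ζ : ∀ t, TangentSpace (𝓡 n) (γ t)}
    (h : ∀ t ∈ Icc 0 τ, ContDiffWithinAt ℝ 2 (fieldChart γ ζ (γ t)) (Icc 0 τ) t) :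
    IsCrField 2 γ (Icc 0 τ) ζ := by
  intro t ht
  have hp := mem_extChartAt_source (I := 𝓡 n) (γ t)
  refine contMDiffWithinAt_of_tangentChart (x₀ := γ t) (by norm_num) ?_
    (eventually_mem_source (hγ.continuousWithinAt ht) hp) hp
  rw [contMDiffWithinAt_iff_contDiffWithinAt]
  exact (hγ.contDiffWithinAt_chart ht hp).prodMk (h t ht)

theorem g_eventuallyEq (X Y : ∀ t, TangentSpace (𝓡 n) (γ t)) {t : ℝ} (ht : t ∈ Icc 0 τ) {x₀ : M}
    (h₀ : γ t ∈ (extChartAt (𝓡 n) x₀).source) :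
    F.g ⟨γ t, velocity τ γ t⟩ (X t) (Y t) = (1 / 2) * secondDeriv (F.localL x₀)
      (velocityChart τ γ x₀ t) (0, fieldChart γ X x₀ t) (0, fieldChart γ Y x₀ t) :=
  g_eq (hγ.admissible t ht) h₀ (X t) (Y t)

theorem hasDerivWithinAt_g (hτ : 0 < τ) {s : Set ℝ} (hs : s ⊆ Icc 0 τ) {t : ℝ} (ht : t ∈ s)
    {X Y : ∀ t, TangentSpace (𝓡 n) (γ t)} {w w' : TangentSpace (𝓡 n) (γ t)}
    (hX : F.HasCovDerivWithin τ γ X s t w) (hY : F.HasCovDerivWithin τ γ Y s t w') :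
    HasDerivWithinAt (fun u => F.g ⟨γ u, velocity τ γ u⟩ (X u) (Y u))
      (F.g ⟨γ t, velocity τ γ t⟩ w (Y t) + F.g ⟨γ t, velocity τ γ t⟩ (X t) w') s t := by
  have hp := mem_extChartAt_source (I := 𝓡 n) (γ t)
  have h1 := ((isSpray (F := F) (γ t)).hasDerivWithinAt_metric (isConicPotential (γ t))
    (hγ.velocityChart_mem (hs ht) hp)
    ((hγ.hasDerivWithinAt_velocityChart hτ (hs ht) hp).mono hs) hX hY).const_mul (1 / 2 : ℝ)
  refine (h1.congr_of_eventuallyEq ?_ (hγ.g_eventuallyEq X Y (hs ht) hp)).congr_deriv ?_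
  · filter_upwards [self_mem_nhdsWithin,
      eventually_mem_source ((hγ.continuousWithinAt (hs ht)).mono hs) hp] with u hu hu₀
    exact hγ.g_eventuallyEq X Y (hs hu) hu₀
  · have e : ∀ a : TangentSpace (𝓡 n) (γ t), tangentCoordChange (𝓡 n) (γ t) (γ t) (γ t) a =
        tangentComp (γ t) a := fun a => tangentCoordChange_self hp
    have e1 := g_eq (hγ.admissible t (hs ht)) hp w (Y t)
    have e2 := g_eq (hγ.admissible t (hs ht)) hp (X t) w'
    rw [mul_add]
    refine congrArg₂ (· + ·) (Eq.trans ?_ e1.symm) (Eq.trans ?_ e2.symm)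
    · exact congrArg (fun a : Vec n => 1 / 2 * secondDeriv (F.localL (γ t)) (velocityChart τ γ (γ t) t)
        (0, a) (0, fieldChart γ Y (γ t) t)) (e w).symm
    · exact congrArg (fun a : Vec n => 1 / 2 * secondDeriv (F.localL (γ t)) (velocityChart τ γ (γ t) t)
        (0, fieldChart γ X (γ t) t) (0, a)) (e w').symm

theorem contDiffWithinAt_g (hτ : 0 < τ) {s : Set ℝ} (hs : s ⊆ Icc 0 τ) {t : ℝ} (ht : t ∈ s)
    {X Y : ∀ t, TangentSpace (𝓡 n) (γ t)}
    (hX : ContDiffWithinAt ℝ 1 (fieldChart γ X (γ t)) s t)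
    (hY : ContDiffWithinAt ℝ 1 (fieldChart γ Y (γ t)) s t) :
    ContDiffWithinAt ℝ 1 (fun u => F.g ⟨γ u, velocity τ γ u⟩ (X u) (Y u)) s t := by
  have hp := mem_extChartAt_source (I := 𝓡 n) (γ t)
  have hℓ := isConicPotential (F := F) (γ t)
  have hz := (hγ.contDiffWithinAt_velocityChart hτ (hs ht) hp).mono hs
  have h1 : ContDiffAt ℝ 1 (secondDeriv (F.localL (γ t))) (velocityChart τ γ (γ t) t) :=
    ((contDiffOn_secondDeriv hℓ.isOpen hℓ.contDiffOn).contDiffAt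
      (hℓ.isOpen.mem_nhds (hγ.velocityChart_mem (hs ht) hp))).of_le (by norm_num)
  have h2 := h1.comp_contDiffWithinAt t hz
  have h3 := contDiffWithinAt_const (c := (1 / 2 : ℝ)).mul
    ((h2.clm_apply ((contDiffWithinAt_const (c := (0 : Vec n))).prodMk hX)).clm_apply
      ((contDiffWithinAt_const (c := (0 : Vec n))).prodMk hY))
  refine h3.congr_of_eventuallyEq_of_mem ?_ ht
  filter_upwards [self_mem_nhdsWithin,
    eventually_mem_source ((hγ.continuousWithinAt (hs ht)).mono hs) hp] with u hu hu₀
  exact hγ.g_eventuallyEq X Y (hs hu) hu₀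

theorem continuousWithinAt_g {s : Set ℝ} (hτ : 0 < τ) (hs : s ⊆ Icc 0 τ) {t : ℝ} (ht : t ∈ s)
    {X Y : ∀ t, TangentSpace (𝓡 n) (γ t)}
    (hX : ContinuousWithinAt (fieldChart γ X (γ t)) s t)
    (hY : ContinuousWithinAt (fieldChart γ Y (γ t)) s t) :
    ContinuousWithinAt (fun u => F.g ⟨γ u, velocity τ γ u⟩ (X u) (Y u)) s t := by
  have hp := mem_extChartAt_source (I := 𝓡 n) (γ t)
  have hℓ := isConicPotential (F := F) (γ t)
  have hz := ((hγ.contDiffWithinAt_velocityChart hτ (hs ht) hp).mono hs).continuousWithinAt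
  have h1 : ContinuousAt (secondDeriv (F.localL (γ t))) (velocityChart τ γ (γ t) t) :=
    ((contDiffOn_secondDeriv hℓ.isOpen hℓ.contDiffOn).contDiffAt
      (hℓ.isOpen.mem_nhds (hγ.velocityChart_mem (hs ht) hp))).continuousAt
  have h2 := h1.comp_continuousWithinAt hz
  have h3 := (continuousWithinAt_const (b := (1 / 2 : ℝ))).mul
    ((h2.clm_apply ((continuousWithinAt_const (b := (0 : Vec n))).prodMk hX)).clm_apply
      ((continuousWithinAt_const (b := (0 : Vec n))).prodMk hY))
  refine h3.congr_of_eventuallyEq_of_mem ?_ ht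
  filter_upwards [self_mem_nhdsWithin,
    eventually_mem_source ((hγ.continuousWithinAt (hs ht)).mono hs) hp] with u hu hu₀
  exact hγ.g_eventuallyEq X Y (hs hu) hu₀

theorem continuousWithinAt_R (hτ : 0 < τ) {t : ℝ} (ht : t ∈ Icc 0 τ)
    {X : ∀ t, TangentSpace (𝓡 n) (γ t)}
    (hX : ContinuousWithinAt (fieldChart γ X (γ t)) (Icc 0 τ) t) :
    ContinuousWithinAt (fieldChart γ (fun u => F.R ⟨γ u, velocity τ γ u⟩ (velocity τ γ u) (X u)
      (velocity τ γ u)) (γ t)) (Icc 0 τ) t := by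
  have hp := mem_extChartAt_source (I := 𝓡 n) (γ t)
  have hℓ := isConicPotential (F := F) (γ t)
  have hH := isSpray (F := F) (γ t)
  have hU := hℓ.isOpen.mem_nhds (hγ.velocityChart_mem ht hp)
  have hz := (hγ.contDiffWithinAt_velocityChart hτ ht hp).continuousWithinAt
  have h0 := (hH.contDiffOn.contDiffAt hU).continuousAt.comp_continuousWithinAt hz
  have h1 := ((hH.contDiffOn_fderiv hℓ).contDiffAt hU).continuousAt.comp_continuousWithinAt hz
  have h2 := (((hH.contDiffOn_fderiv hℓ).fderiv_of_isOpen (m := 1) hℓ.isOpen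
    (by norm_num)).contDiffAt hU).continuousAt.comp_continuousWithinAt hz
  have hc := continuousWithinAt_const (b := (0 : Vec n)) (s := Icc 0 τ) (x := t)
  have hN : ∀ {Y : ℝ → Vec n}, ContinuousWithinAt Y (Icc 0 τ) t → ContinuousWithinAt
      (fun u => sprayConn (F.spray (γ t)) (velocityChart τ γ (γ t) u) (Y u)) (Icc 0 τ) t := by
    intro Y hY
    simp only [sprayConn_apply]
    exact (h1.clm_apply (hc.prodMk hY)).const_smul (1 / 2 : ℝ)
  have h3 : ContinuousWithinAt (fun u => sprayCurv (F.spray (γ t)) (velocityChart τ γ (γ t) u)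
      (fieldChart γ X (γ t) u)) (Icc 0 τ) t :=
    ((((h2.clm_apply (hz.snd.prodMk h0.neg)).clm_apply (hc.prodMk hX)).const_smul (1 / 2 : ℝ)).sub
      (h1.clm_apply (hX.prodMk hc))).add (hN (hN hX))
  refine h3.congr_of_eventuallyEq_of_mem ?_ ht
  filter_upwards [self_mem_nhdsWithin, eventually_mem_source (hγ.continuousWithinAt ht) hp]
    with u hu hu₀
  exact R_eq (hγ.admissible u hu) hu₀ (X u)

theorem contDiffWithinAt_conn (hτ : 0 < τ) {t : ℝ} (ht : t ∈ Icc 0 τ) {x₀ : M}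
    (h₀ : γ t ∈ (extChartAt (𝓡 n) x₀).source) :
    ContDiffWithinAt ℝ 1 (fun u => sprayConn (F.spray x₀) (velocityChart τ γ x₀ u))
      (Icc 0 τ) t := by
  have hℓ := isConicPotential (F := F) x₀
  have hH := isSpray (F := F) x₀
  have hU := hℓ.isOpen.mem_nhds (hγ.velocityChart_mem ht h₀)
  have h1 := (((hH.contDiffOn_fderiv hℓ).contDiffAt hU).of_le
    (by norm_num : (1 : WithTop ℕ∞) ≤ 2)).comp_contDiffWithinAt t
      (hγ.contDiffWithinAt_velocityChart hτ ht h₀)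
  exact (h1.clm_comp contDiffWithinAt_const).const_smul (1 / 2 : ℝ)

/-- Bootstrap: ζ' = -N ζ with N of class C¹ along γ raises ζ from continuous to C¹ and then to C².
-/
theorem contDiffWithinAt_of_parallel (hτ : 0 < τ) {ζ : ∀ t, TangentSpace (𝓡 n) (γ t)}
    (h : ∀ t ∈ Icc 0 τ, F.HasCovDerivWithin τ γ ζ (Icc 0 τ) t 0) {t : ℝ} (ht : t ∈ Icc 0 τ) :
    ContDiffWithinAt ℝ 2 (fieldChart γ ζ (γ t)) (Icc 0 τ) t := by
  have hp := mem_extChartAt_source (I := 𝓡 n) (γ t)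
  have h1 : ∀ᶠ u in 𝓝[Icc 0 τ] t, HasDerivWithinAt (fieldChart γ ζ (γ t))
      (-sprayConn (F.spray (γ t)) (velocityChart τ γ (γ t) u) (fieldChart γ ζ (γ t) u))
      (Icc 0 τ) u := by
    filter_upwards [self_mem_nhdsWithin, eventually_mem_source (hγ.continuousWithinAt ht) hp]
      with u hu hu₀
    have := (hγ.hasCovDerivWithin_iff Subset.rfl hu hu₀).1 (h u hu)
    rwa [map_zero, map_zero, zero_sub] at this
  have hN := hγ.contDiffWithinAt_conn hτ ht hp
  have h0 : ContDiffWithinAt ℝ 0 (fieldChart γ ζ (γ t)) (Icc 0 τ) t := by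
    rw [contDiffWithinAt_zero ht]
    refine ⟨_, h1, fun u hu => ?_⟩
    exact hu.2.continuousWithinAt.mono inter_subset_left
  have h2 := contDiffWithinAt_succ_of_hasDerivWithinAt (m := 0) ht h1
    ((hN.of_le (by norm_num)).clm_apply (by exact_mod_cast h0)).neg
  exact contDiffWithinAt_succ_of_hasDerivWithinAt (m := 1) ht h1
    (ContDiffWithinAt.clm_apply (by exact_mod_cast hN) (by exact_mod_cast h2)).neg

end IsGeodesic

end PseudoFinslerMetric

end Fields

theorem exists_orthonormal_family {n : ℕ} (B : Vec n →ₗ[ℝ] Vec n →ₗ[ℝ] ℝ)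
    (hsymm : ∀ u w, B u w = B w u) (hpos : ∀ u, u ≠ 0 → 0 < B u u) :
    ∃ b : Fin n → Vec n, ∀ i j, B (b i) (b j) = if i = j then 1 else 0 := by
  obtain ⟨v, hv⟩ := LinearMap.BilinForm.exists_orthogonal_basis (B := B) ⟨fun x y => hsymm x y⟩
  have hn : Module.finrank ℝ (Vec n) = n := by simp
  let w := v.reindex (finCongr hn)
  have hw : ∀ i j, i ≠ j → B (w i) (w j) = 0 := by
    intro i j hij
    simp only [w, Module.Basis.reindex_apply]
    exact hv (fun h => hij ((finCongr hn).symm.injective h))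
  have hw0 : ∀ i, 0 < B (w i) (w i) := fun i => hpos _ (w.ne_zero i)
  refine ⟨fun i => (Real.sqrt (B (w i) (w i)))⁻¹ • w i, fun i j => ?_⟩
  simp only [map_smul, LinearMap.smul_apply, smul_eq_mul]
  split_ifs with h
  · subst h
    have h1 := Real.mul_self_sqrt (hw0 i).le
    have h2 := (Real.sqrt_pos.2 (hw0 i)).ne'
    nth_rewrite 3 [← h1]
    field_simp
  · rw [hw i j h, mul_zero, mul_zero]

/-! ### Parallel transport and parallel orthonormal frames. -/

section ParallelTransport

open Filter

variable {n : ℕ} {M : Type*} [TopologicalSpace M] [ChartedSpace (Vec n) M]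
  [IsManifold (𝓡 n) 7 M] {F : PseudoFinslerMetric n M} {τ : ℝ} {γ : ℝ → M}

namespace PseudoFinslerMetric

/-- The fundamental tensor as a bilinear form. -/
def gForm (F : PseudoFinslerMetric n M) (v : TangentBundle (𝓡 n) M) :
    Vec n →ₗ[ℝ] Vec n →ₗ[ℝ] ℝ :=
  LinearMap.mk₂ ℝ (fun u w => F.g v ((tangentComp v.proj).symm u) ((tangentComp v.proj).symm w))
    (by intro u u' w; simp only [g, fundamentalTensor, ContinuousLinearEquiv.apply_symm_apply,
          map_add, add_apply]; ring)
    (by intro c u w; simp only [g, fundamentalTensor, ContinuousLinearEquiv.apply_symm_apply,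
          map_smul, smul_apply, smul_eq_mul]; ring)
    (by intro u u' w; simp only [g, fundamentalTensor, ContinuousLinearEquiv.apply_symm_apply,
          map_add]; ring)
    (by intro c u w; simp only [g, fundamentalTensor, ContinuousLinearEquiv.apply_symm_apply,
          map_smul, smul_eq_mul]; ring)

theorem HasCovDerivWithin.union {ζ : ∀ t, TangentSpace (𝓡 n) (γ t)} {s s' : Set ℝ} {t : ℝ}
    {w : TangentSpace (𝓡 n) (γ t)} (h : F.HasCovDerivWithin τ γ ζ s t w)
    (h' : F.HasCovDerivWithin τ γ ζ s' t w) : F.HasCovDerivWithin τ γ ζ (s ∪ s') t w :=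
  HasDerivWithinAt.union h h'

theorem HasCovDerivWithin.mono {ζ : ∀ t, TangentSpace (𝓡 n) (γ t)} {s s' : Set ℝ} {t : ℝ}
    {w : TangentSpace (𝓡 n) (γ t)} (h : F.HasCovDerivWithin τ γ ζ s t w) (hs : s' ⊆ s) :
    F.HasCovDerivWithin τ γ ζ s' t w :=
  HasDerivWithinAt.mono h hs

theorem HasCovDerivWithin.of_notMem_closure {ζ : ∀ t, TangentSpace (𝓡 n) (γ t)} {s : Set ℝ} {t : ℝ}
    {w : TangentSpace (𝓡 n) (γ t)} (h : t ∉ closure s) : F.HasCovDerivWithin τ γ ζ s t w :=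
  HasFDerivWithinAt.of_notMem_closure h

namespace IsGeodesic

variable (hγ : F.IsGeodesic τ γ)
include hγ

/-- The continuation principle glues solutions of the linear equation in successive charts; ε is
chosen so that γ stays in the chart around γ(c). -/
theorem exists_parallel (hτ : 0 < τ) (v₀ : TangentSpace (𝓡 n) (γ 0)) :
    ∃ ζ : ∀ t, TangentSpace (𝓡 n) (γ t), ζ 0 = v₀ ∧
      ∀ t ∈ Icc 0 τ, F.HasCovDerivWithin τ γ ζ (Icc 0 τ) t 0 := by
  refine of_forall_eventually_imp_Icc
    (Q := fun T => ∃ ζ : ∀ t, TangentSpace (𝓡 n) (γ t), ζ 0 = v₀ ∧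
      ∀ t ∈ Icc 0 T, F.HasCovDerivWithin τ γ ζ (Icc 0 T) t 0) hτ.le ?_ ?_ ?_
  · classical
    -- On the one-point interval [0, 0] the derivative condition is vacuous, so only the value at 0
    -- matters.
    refine ⟨fun t => if h : t = 0 then h ▸ v₀ else 0, by simp, fun t ht => ?_⟩
    rw [Icc_self] at ht ⊢
    rw [HasCovDerivWithin, mem_singleton_iff.1 ht]
    exact HasFDerivWithinAt.of_subsingleton subsingleton_singleton
  · rintro s hs t ht hst ⟨ζ, h0, h⟩
    exact ⟨ζ, h0, fun u hu => (h u ⟨hu.1, hu.2.trans hst⟩).mono (Icc_subset_Icc_right hst)⟩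
  · intro c hc
    have hev := eventually_mem_source (n := n) (hγ.continuousWithinAt hc)
      (mem_extChartAt_source (γ c))
    obtain ⟨ε, hε, hball⟩ := Metric.mem_nhdsWithin_iff.1 hev
    refine ⟨ε, hε, ?_⟩
    rintro s hs t ht hsc htc hst ⟨ζ, h0, h⟩
    have hsub : Icc s t ⊆ Icc 0 τ := Icc_subset_Icc hs.1 ht.2
    have hsrc : ∀ u ∈ Icc s t, γ u ∈ (extChartAt (𝓡 n) (γ c)).source := by
      intro u hu
      refine hball ⟨?_, hsub hu⟩
      rw [Metric.mem_ball, Real.dist_eq]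
      rw [abs_lt] at hsc htc ⊢
      exact ⟨by linarith [hu.1], by linarith [hu.2]⟩
    obtain ⟨x, hxs, hx⟩ := exists_linearODE
      (A := fun u => -sprayConn (F.spray (γ c)) (velocityChart τ γ (γ c) u)) hst
      (fun u hu => ((hγ.contDiffWithinAt_conn hτ (hsub hu) (hsrc u hu)).continuousWithinAt.mono
        hsub).neg) (fieldChart γ ζ (γ c) s)
    let ξ : ∀ u, TangentSpace (𝓡 n) (γ u) := fun u =>
      (tangentComp (γ u)).symm (tangentCoordChange (𝓡 n) (γ c) (γ u) (γ u) (x u))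
    have hξ : ∀ u ∈ Icc s t, fieldChart γ ξ (γ c) u = x u := fun u hu =>
      tangentCoordChange_left_inv (hsrc u hu) (mem_extChartAt_source _) _
    have hξs : ξ s = ζ s := by
      apply (tangentComp (γ s)).injective
      change tangentCoordChange (𝓡 n) (γ c) (γ s) (γ s) (x s) = _
      rw [hxs, fieldChart_eq]
      exact tangentCoordChange_left_inv (mem_extChartAt_source _) (hsrc s (left_mem_Icc.2 hst)) _
    have hξc : ∀ u ∈ Icc s t, F.HasCovDerivWithin τ γ ξ (Icc s t) u 0 := by
      intro u hu
      rw [hγ.hasCovDerivWithin_iff hsub (hsub hu) (hsrc u hu), map_zero, map_zero, zero_sub,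
        hξ u hu]
      exact (hx u hu).congr hξ (hξ u hu)
    classical
    let θ : ∀ u, TangentSpace (𝓡 n) (γ u) := fun u => if u ≤ s then ζ u else ξ u
    have hθ₁ : ∀ u ∈ Icc 0 s, θ u = ζ u := fun u hu => if_pos hu.2
    have hθ₂ : ∀ u ∈ Icc s t, θ u = ξ u := by
      intro u hu
      rcases hu.1.eq_or_lt with rfl | hlt
      · rw [hξs]
        exact if_pos le_rfl
      · exact if_neg (not_le.2 hlt)
    refine ⟨θ, (hθ₁ 0 ⟨le_rfl, hs.1⟩).trans h0, fun u hu => ?_⟩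
    rw [← Icc_union_Icc_eq_Icc hs.1 hst]
    refine HasCovDerivWithin.union ?_ ?_
    · by_cases hus : u ∈ Icc 0 s
      · exact (h u hus).congr hθ₁ hus
      · exact HasCovDerivWithin.of_notMem_closure (by rwa [isClosed_Icc.closure_eq])
    · by_cases hus : u ∈ Icc s t
      · exact (hξc u hus).congr hθ₂ hus
      · exact HasCovDerivWithin.of_notMem_closure (by rwa [isClosed_Icc.closure_eq])

end IsGeodesic

/-- A parallel `g_{γ̇}`-orthonormal frame along a geodesic. -/
structure IsParallelFrame (F : PseudoFinslerMetric n M) (τ : ℝ) (γ : ℝ → M)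
    (E : Fin n → ∀ t, TangentSpace (𝓡 n) (γ t)) : Prop where
  parallel : ∀ i, ∀ t ∈ Icc 0 τ, F.HasCovDerivWithin τ γ (E i) (Icc 0 τ) t 0
  orthonormal : ∀ t ∈ Icc 0 τ, ∀ i j,
    F.g ⟨γ t, velocity τ γ t⟩ (E i t) (E j t) = if i = j then 1 else 0

/-- Metric compatibility makes the products of parallel fields constant, so orthonormality at 0
persists. Positivity of g_{γ̇} is thereby propagated from 0 to all of γ. -/
theorem IsGeodesic.exists_parallelFrame (hγ : F.IsGeodesic τ γ) (hτ : 0 < τ)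
    (hpos : ∀ u : TangentSpace (𝓡 n) (γ 0), u ≠ 0 → 0 < F.g ⟨γ 0, velocity τ γ 0⟩ u u) :
    ∃ E : Fin n → ∀ t, TangentSpace (𝓡 n) (γ t), F.IsParallelFrame τ γ E := by
  have h0 : (0 : ℝ) ∈ Icc 0 τ := left_mem_Icc.2 hτ.le
  obtain ⟨b, hb⟩ := exists_orthonormal_family (F.gForm ⟨γ 0, velocity τ γ 0⟩)
    (fun u w => g_comm (hγ.admissible 0 h0) u w) (fun u hu => hpos u hu)
  choose E hE0 hE using fun i => hγ.exists_parallel hτ ((tangentComp (γ 0)).symm (b i))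
  refine ⟨E, hE, fun t ht i j => ?_⟩
  have hd : ∀ u ∈ Icc 0 τ, HasDerivWithinAt
      (fun u => F.g ⟨γ u, velocity τ γ u⟩ (E i u) (E j u)) 0 (Icc 0 τ) u := by
    intro u hu
    refine (hγ.hasDerivWithinAt_g hτ Subset.rfl hu (hE i u hu) (hE j u hu)).congr_deriv ?_
    have e1 := LinearMap.map_zero₂ (F.gForm ⟨γ u, velocity τ γ u⟩) (tangentComp (γ u) (E j u))
    have e2 := map_zero (F.gForm ⟨γ u, velocity τ γ u⟩ (tangentComp (γ u) (E i u)))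
    exact (congrArg₂ (· + ·) e1 e2).trans (add_zero 0)
  have hc := constant_of_derivWithin_zero (fun u hu => (hd u hu).differentiableWithinAt)
    (fun u hu => (hd u ⟨hu.1, hu.2.le⟩).derivWithin
      (uniqueDiffOn_Icc hτ u ⟨hu.1, hu.2.le⟩)) t ht
  refine hc.trans ?_
  rw [hE0, hE0]
  exact hb i j

end PseudoFinslerMetric

end ParallelTransport

theorem bilin_sum_sum_of_orthonormal {n : ℕ} (B : Vec n →ₗ[ℝ] Vec n →ₗ[ℝ] ℝ) {b : Fin n → Vec n}
    (hb : ∀ i j, B (b i) (b j) = if i = j then 1 else 0) (a c : Fin n → ℝ) :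
    B (∑ i, a i • b i) (∑ i, c i • b i) = ∑ i, a i * c i := by
  simp [map_sum, LinearMap.sum_apply, hb, mul_comm]

theorem sum_bilin_smul_of_orthonormal {n : ℕ} (B : Vec n →ₗ[ℝ] Vec n →ₗ[ℝ] ℝ) {b : Fin n → Vec n}
    (hb : ∀ i j, B (b i) (b j) = if i = j then 1 else 0) (u : Vec n) :
    ∑ i, B u (b i) • b i = u := by
  have hli : LinearIndependent ℝ b := by
    rw [Fintype.linearIndependent_iff]
    intro a ha j
    have := congrArg (fun w => B w (b j)) ha
    simpa [map_sum, LinearMap.sum_apply, hb] using this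
  let v := basisOfLinearIndependentOfCardEqFinrank' b hli (by simp)
  have hv : ∀ i, v i = b i := fun i => by simp [v]
  have hu := v.sum_repr u
  simp only [hv] at hu
  have hc : ∀ j, B u (b j) = v.repr u j := by
    intro j
    conv_lhs => rw [← hu]
    simp [map_sum, LinearMap.sum_apply, hb]
  simp only [hc]
  exact hu

/-! ### Translation between fields along γ and curves in ℝⁿ. -/

section Frames

open Filter

variable {n : ℕ} {M : Type*} [TopologicalSpace M] [ChartedSpace (Vec n) M]
  [IsManifold (𝓡 n) 7 M] {F : PseudoFinslerMetric n M} {τ : ℝ} {γ : ℝ → M}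

/-- The field with components `x` in the frame `E`. -/
def frameField (E : Fin n → ∀ t, TangentSpace (𝓡 n) (γ t)) (x : ℝ → Vec n) :
    ∀ t, TangentSpace (𝓡 n) (γ t) := fun t => ∑ i, x t i • E i t

namespace PseudoFinslerMetric

/-- The components of a field in an orthonormal frame `E`. -/
def frameCoord (F : PseudoFinslerMetric n M) (τ : ℝ) (γ : ℝ → M)
    (E : Fin n → ∀ t, TangentSpace (𝓡 n) (γ t)) (X : ∀ t, TangentSpace (𝓡 n) (γ t)) (t : ℝ) :
    Vec n :=
  WithLp.toLp 2 fun i => F.g ⟨γ t, velocity τ γ t⟩ (X t) (E i t)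

/-- The matrix of `X ↦ R_{γ̇}(γ̇, X)γ̇` in a frame. -/
def frameCurv (F : PseudoFinslerMetric n M) (τ : ℝ) (γ : ℝ → M)
    (E : Fin n → ∀ t, TangentSpace (𝓡 n) (γ t)) (t : ℝ) : Vec n →L[ℝ] Vec n :=
  ∑ j, (EuclideanSpace.proj j : Vec n →L[ℝ] ℝ).smulRight (F.frameCoord τ γ E (fun u =>
    F.R ⟨γ u, velocity τ γ u⟩ (velocity τ γ u) (E j u) (velocity τ γ u)) t)

theorem R_sum {v : TangentBundle (𝓡 n) M} (hv : v ∈ F.A) {κ : Type*} [Fintype κ] (a : κ → ℝ)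
    (η : κ → TangentSpace (𝓡 n) v.proj) :
    F.R v v.2 (∑ i, a i • η i) v.2 = ∑ i, a i • F.R v v.2 (η i) v.2 := by
  let L : Vec n →ₗ[ℝ] Vec n :=
    { toFun := sprayCurv (F.spray v.proj) (tangentChart v.proj v)
      map_add' := fun a b => by
        have e1 : ((0, a + b) : Vec n × Vec n) = (0, a) + (0, b) := by simp
        have e2 : ((a + b, 0) : Vec n × Vec n) = (a, 0) + (b, 0) := by simp
        simp only [sprayCurv, e1, e2, map_add, smul_add]
        abel
      map_smul' := fun c a => by
        have e1 : ((0, c • a) : Vec n × Vec n) = c • (0, a) := by simp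
        have e2 : ((c • a, 0) : Vec n × Vec n) = c • (a, 0) := by simp
        simp only [sprayCurv, e1, e2, map_smul, RingHom.id_apply, smul_add, smul_sub]
        rw [smul_comm] }
  have h : ∀ η : TangentSpace (𝓡 n) v.proj, F.R v v.2 η v.2 = L η := fun η => R_self hv η
  rw [h]
  refine (map_sum L (fun i => a i • (η i : Vec n)) Finset.univ).trans ?_
  exact Finset.sum_congr rfl fun i _ => (map_smul L (a i) (η i : Vec n)).trans
    (congrArg (fun w : Vec n => a i • w) (h (η i)).symm)

namespace IsParallelFrame

variable {E : Fin n → ∀ t, TangentSpace (𝓡 n) (γ t)} (hE : F.IsParallelFrame τ γ E)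
include hE

theorem g_frameField (x y : ℝ → Vec n) {t : ℝ} (ht : t ∈ Icc 0 τ) :
    F.g ⟨γ t, velocity τ γ t⟩ (frameField E x t) (frameField E y t) = inner ℝ (x t) (y t) := by
  have h := bilin_sum_sum_of_orthonormal (F.gForm ⟨γ t, velocity τ γ t⟩)
    (b := fun i => tangentComp (γ t) (E i t)) (hE.orthonormal t ht) (x t) (y t)
  refine Eq.trans h ?_
  rw [PiLp.inner_apply]
  exact Finset.sum_congr rfl fun i _ => by simp [mul_comm]

theorem frameField_frameCoord (X : ∀ t, TangentSpace (𝓡 n) (γ t)) {t : ℝ} (ht : t ∈ Icc 0 τ) :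
    frameField E (F.frameCoord τ γ E X) t = X t :=
  sum_bilin_smul_of_orthonormal (F.gForm ⟨γ t, velocity τ γ t⟩)
    (b := fun i => tangentComp (γ t) (E i t)) (hE.orthonormal t ht) (tangentComp (γ t) (X t))

theorem inner_frameCoord (X Y : ∀ t, TangentSpace (𝓡 n) (γ t)) {t : ℝ} (ht : t ∈ Icc 0 τ) :
    inner ℝ (F.frameCoord τ γ E X t) (F.frameCoord τ γ E Y t) =
      F.g ⟨γ t, velocity τ γ t⟩ (X t) (Y t) := by
  rw [← hE.g_frameField _ _ ht, hE.frameField_frameCoord X ht, hE.frameField_frameCoord Y ht]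

theorem frameCoord_frameField (x : ℝ → Vec n) {t : ℝ} (ht : t ∈ Icc 0 τ) :
    F.frameCoord τ γ E (frameField E x) t = x t := by
  refine ext_inner_right ℝ fun w => ?_
  have h := hE.inner_frameCoord (frameField E x) (frameField E fun _ => w) ht
  rw [hE.g_frameField _ _ ht] at h
  have h2 : ∀ j, F.frameCoord τ γ E (frameField E x) t j = x t j := by
    intro j
    have h3 := bilin_sum_sum_of_orthonormal (F.gForm ⟨γ t, velocity τ γ t⟩)
      (b := fun i => tangentComp (γ t) (E i t)) (hE.orthonormal t ht) (x t) (Pi.single j 1)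
    simp only [Pi.single_apply, ite_smul, one_smul, zero_smul, mul_ite, mul_one, mul_zero,
      Finset.sum_ite_eq', Finset.mem_univ, if_true] at h3
    exact h3
  rw [show F.frameCoord τ γ E (frameField E x) t = x t from PiLp.ext h2]

theorem hasCovDerivWithin_frameField {x : ℝ → Vec n} {x' : Vec n} {s : Set ℝ} (hs : s ⊆ Icc 0 τ)
    {t : ℝ} (ht : t ∈ s) (hx : HasDerivWithinAt x x' s t) :
    F.HasCovDerivWithin τ γ (frameField E x) s t (frameField E (fun _ => x') t) := by
  have h := HasCovDerivWithin.sum (F := F) (τ := τ) (f := fun i u => x u i) (f' := fun i => x' i)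
    (fun i => (hE.parallel i t (hs ht)).mono hs)
    (fun i => ((EuclideanSpace.proj i : Vec n →L[ℝ] ℝ).hasFDerivAt).comp_hasDerivWithinAt t hx)
  simp only [smul_zero, add_zero] at h
  exact h

/-- In a parallel frame D acts on components as the ordinary derivative. -/
theorem D_eq (hγ : F.IsGeodesic τ γ) (hτ : 0 < τ) {X : ∀ t, TangentSpace (𝓡 n) (γ t)} {x' : Vec n}
    {t : ℝ} (ht : t ∈ Icc 0 τ) (hx : HasDerivWithinAt (F.frameCoord τ γ E X) x' (Icc 0 τ) t) :
    F.D τ γ X t = frameField E (fun _ => x') t :=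
  hγ.D_eq hτ ht ((hE.hasCovDerivWithin_frameField Subset.rfl ht hx).congr
    (fun _ hu => (hE.frameField_frameCoord X hu).symm) ht)

theorem contDiffWithinAt_frameCoord (hγ : F.IsGeodesic τ γ) (hτ : 0 < τ)
    {X : ∀ t, TangentSpace (𝓡 n) (γ t)} {s : Set ℝ} (hs : s ⊆ Icc 0 τ) {t : ℝ} (ht : t ∈ s)
    (hX : ContDiffWithinAt ℝ 1 (fieldChart γ X (γ t)) s t) :
    ContDiffWithinAt ℝ 1 (F.frameCoord τ γ E X) s t := by
  refine (contDiffWithinAt_euclidean).2 fun i => ?_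
  exact hγ.contDiffWithinAt_g hτ hs ht hX (((hγ.contDiffWithinAt_of_parallel hτ
    (hE.parallel i) (hs ht)).of_le (by norm_num)).mono hs)

theorem continuousWithinAt_frameCoord (hγ : F.IsGeodesic τ γ) (hτ : 0 < τ)
    {X : ∀ t, TangentSpace (𝓡 n) (γ t)} {s : Set ℝ} (hs : s ⊆ Icc 0 τ) {t : ℝ} (ht : t ∈ s)
    (hX : ContinuousWithinAt (fieldChart γ X (γ t)) s t) :
    ContinuousWithinAt (F.frameCoord τ γ E X) s t := by
  have h : ContinuousWithinAt (fun u => fun i => F.g ⟨γ u, velocity τ γ u⟩ (X u) (E i u)) s t :=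
    continuousWithinAt_pi.2 fun i => hγ.continuousWithinAt_g hτ hs ht hX
      ((hγ.contDiffWithinAt_of_parallel hτ (hE.parallel i) (hs ht)).continuousWithinAt.mono hs)
  exact (PiLp.continuous_toLp 2 _).continuousAt.comp_continuousWithinAt h

theorem isCrField_frameField (hγ : F.IsGeodesic τ γ) (hτ : 0 < τ) {x : ℝ → Vec n}
    (hx : ContDiffOn ℝ 2 x (Icc 0 τ)) : IsCrField 2 γ (Icc 0 τ) (frameField E x) := by
  refine hγ.isCrField_of_fieldChart fun t ht => ?_
  have h : ContDiffWithinAt ℝ 2 (fun u => ∑ i, x u i • fieldChart γ (E i) (γ t) u) (Icc 0 τ) t :=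
    ContDiffWithinAt.sum fun i _ => ((contDiffWithinAt_euclidean.1 (hx t ht)) i).smul
      (hγ.contDiffWithinAt_of_parallel hτ (hE.parallel i) ht)
  exact h.congr_of_eventuallyEq_of_mem
    (Eventually.of_forall fun u => fieldChart_sum (fun i u => x u i) E _ u) ht

theorem frameField_frameCurv (hγ : F.IsGeodesic τ γ) (x : ℝ → Vec n) {t : ℝ} (ht : t ∈ Icc 0 τ) :
    frameField E (fun u => F.frameCurv τ γ E u (x u)) t =
      F.R ⟨γ t, velocity τ γ t⟩ (velocity τ γ t) (frameField E x t) (velocity τ γ t) := by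
  have h1 := R_sum (hγ.admissible t ht) (fun i => x t i) (fun i => E i t)
  refine Eq.trans ?_ h1.symm
  have h2 : ∀ j, F.R ⟨γ t, velocity τ γ t⟩ (velocity τ γ t) (E j t) (velocity τ γ t) =
      frameField E (F.frameCoord τ γ E (fun u =>
        F.R ⟨γ u, velocity τ γ u⟩ (velocity τ γ u) (E j u) (velocity τ γ u))) t :=
    fun j => (hE.frameField_frameCoord (fun u => F.R ⟨γ u, velocity τ γ u⟩ (velocity τ γ u) (E j u)
      (velocity τ γ u)) ht).symm
  refine Eq.trans ?_ (Finset.sum_congr rfl fun j _ => congrArg (fun w => x t j • w) (h2 j)).symm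
  simp only [frameField, frameCurv, sum_apply, ContinuousLinearMap.smulRight_apply,
    WithLp.ofLp_sum, Finset.sum_apply, PiLp.smul_apply, smul_eq_mul,
    Finset.sum_smul, Finset.smul_sum, mul_smul]
  rw [Finset.sum_comm]
  rfl

theorem inner_frameCurv (hγ : F.IsGeodesic τ γ) (a b : Vec n) {t : ℝ} (ht : t ∈ Icc 0 τ) :
    inner ℝ (F.frameCurv τ γ E t a) b = F.g ⟨γ t, velocity τ γ t⟩
      (F.R ⟨γ t, velocity τ γ t⟩ (velocity τ γ t) (frameField E (fun _ => a) t) (velocity τ γ t))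
      (frameField E (fun _ => b) t) := by
  rw [← hE.frameField_frameCurv hγ (fun _ => a) ht, hE.g_frameField _ _ ht]

theorem inner_frameCurv_symm (hγ : F.IsGeodesic τ γ) (a b : Vec n) {t : ℝ} (ht : t ∈ Icc 0 τ) :
    inner ℝ (F.frameCurv τ γ E t a) b = inner ℝ a (F.frameCurv τ γ E t b) := by
  rw [real_inner_comm _ a, hE.inner_frameCurv hγ a b ht, hE.inner_frameCurv hγ b a ht]
  exact g_R_symm (hγ.admissible t ht) _ _

theorem continuousOn_frameCurv (hγ : F.IsGeodesic τ γ) (hτ : 0 < τ) :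
    ContinuousOn (F.frameCurv τ γ E) (Icc 0 τ) := by
  refine continuousOn_finsetSum _ fun j _ t ht => ?_
  have h := hE.continuousWithinAt_frameCoord hγ hτ Subset.rfl ht (hγ.continuousWithinAt_R hτ ht
    (hγ.contDiffWithinAt_of_parallel hτ (hE.parallel j) ht).continuousWithinAt)
  exact ((ContinuousLinearMap.smulRightL ℝ (Vec n) (Vec n)
    (EuclideanSpace.proj j)).continuous.continuousAt.comp_continuousWithinAt h)

end IsParallelFrame

end PseudoFinslerMetric

end Frames

/-! ### Normal fields along an immersion and its second fundamental form, in coordinates. -/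

section NormalFields

open Filter

theorem ContinuousLinearMap.isInvertible_of_injective {X Y : Type*} [NormedAddCommGroup X]
    [NormedSpace ℝ X] [FiniteDimensional ℝ X] [NormedAddCommGroup Y] [NormedSpace ℝ Y]
    [FiniteDimensional ℝ Y] (L : X →L[ℝ] Y) (hL : ∀ x, L x = 0 → x = 0)
    (h : Module.finrank ℝ X = Module.finrank ℝ Y) : L.IsInvertible := by
  have hinj : Function.Injective (L : X →ₗ[ℝ] Y) := (injective_iff_map_eq_zero _).2 hL
  refine ⟨(LinearEquiv.ofInjectiveOfFinrankEq (L : X →ₗ[ℝ] Y) hinj h).toContinuousLinearEquiv, ?_⟩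
  ext x
  rfl

theorem finrank_continuousDual (G : Type*) [NormedAddCommGroup G] [NormedSpace ℝ G]
    [FiniteDimensional ℝ G] : Module.finrank ℝ (G →L[ℝ] ℝ) = Module.finrank ℝ G := by
  rw [← (LinearMap.toContinuousLinearMap (𝕜 := ℝ) (E := G) (F' := ℝ)).finrank_eq]
  exact Subspace.dual_finrank_eq

variable {E : Type*} [NormedAddCommGroup E] [NormedSpace ℝ E] [FiniteDimensional ℝ E]
  {G : Type*} [NormedAddCommGroup G] [NormedSpace ℝ G] [FiniteDimensional ℝ G]
  {ℓ : E × E → ℝ} {U : Set (E × E)} {H : E × E → E}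

-- By homogeneity, normality of y to w is the first-order condition dℓ(0, w) = 0, which is how
-- normal fields are handled below.
omit [FiniteDimensional ℝ E] in
theorem IsConicPotential.secondDeriv_self (hℓ : IsConicPotential ℓ U) {z : E × E} (hz : z ∈ U)
    (w : E) : secondDeriv ℓ z (0, z.2) (0, w) = fderiv ℝ ℓ z (0, w) := by
  have := hℓ.euler₂ hz (0, w)
  rw [secondDeriv_comm hℓ.isOpen hℓ.contDiffOn hz] at this
  simp only at this
  linarith

/-- The second fundamental form of an immersion `f` in the normal direction `y`. -/
def secondFundForm (ℓ : E × E → ℝ) (H : E × E → E) (f : G → E) (c : G) (y : E) (a b : G) : ℝ :=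
  (1 / 2) * thirdDeriv ℓ (f c, y) (y, -H (f c, y)) (0, fderiv ℝ f c a) (0, fderiv ℝ f c b)
    - (1 / 2) * (secondDeriv ℓ (f c, y) (fderiv ℝ f c a, 0) (0, fderiv ℝ f c b)
      + secondDeriv ℓ (f c, y) (fderiv ℝ f c b, 0) (0, fderiv ℝ f c a))
    - fderiv ℝ ℓ (f c, y) (0, fderiv ℝ (fderiv ℝ f) c a b)

-- Differentiating the normality relation in direction a expresses the product of W'(a) with f'(b)
-- through the value W(c) alone. Hence the tangential part of the covariant derivative does not
-- depend on the extension. The factor is that of the Hessian, twice g.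
omit [FiniteDimensional ℝ E] [FiniteDimensional ℝ G] in
set_option maxSynthPendingDepth 4 in
theorem IsSpray.secondDeriv_nabla_normal (hH : IsSpray ℓ U H) (hℓ : IsConicPotential ℓ U)
    {f W : G → E} {c : G} (hf : ContDiffAt ℝ 2 f c) (hW : DifferentiableAt ℝ W c)
    (hz : (f c, W c) ∈ U)
    (hn : ∀ᶠ s in 𝓝 c, ∀ b, fderiv ℝ ℓ (f s, W s) (0, fderiv ℝ f s b) = 0) (a b : G) :
    secondDeriv ℓ (f c, W c) (0, fderiv ℝ W c a + sprayConn H (f c, W c) (fderiv ℝ f c a))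
      (0, fderiv ℝ f c b) = secondFundForm ℓ H f c (W c) a b := by
  have hf1 : HasFDerivAt f (fderiv ℝ f c) c := (hf.differentiableAt (by norm_num)).hasFDerivAt
  have hf2 : HasFDerivAt (fderiv ℝ f) (fderiv ℝ (fderiv ℝ f) c) c :=
    ((hf.fderiv_right (m := 1) (by norm_num)).differentiableAt (by norm_num)).hasFDerivAt
  have hz' : HasFDerivAt (fun s => (f s, W s)) ((fderiv ℝ f c).prod (fderiv ℝ W c)) c :=
    hf1.prodMk hW.hasFDerivAt
  have h1 : HasFDerivAt (fun s => fderiv ℝ ℓ (f s, W s))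
      ((secondDeriv ℓ (f c, W c)).comp ((fderiv ℝ f c).prod (fderiv ℝ W c))) c :=
    HasFDerivAt.comp c (_root_.hasFDerivAt_fderiv hℓ.isOpen hℓ.contDiffOn hz) hz'
  have hb : HasFDerivAt (fun s => fderiv ℝ f s b) ((fderiv ℝ (fderiv ℝ f) c).flip b) c := by
    have := hf2.clm_apply (hasFDerivAt_const b c)
    simpa using! this
  have h2 : HasFDerivAt (fun s => ((0, fderiv ℝ f s b) : E × E))
      ((0 : G →L[ℝ] E).prod ((fderiv ℝ (fderiv ℝ f) c).flip b)) c :=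
    (hasFDerivAt_const (0 : E) c).prodMk hb
  have h3 := h1.clm_apply h2
  have h4 : HasFDerivAt (fun s => fderiv ℝ ℓ (f s, W s) (0, fderiv ℝ f s b)) (0 : G →L[ℝ] ℝ) c :=
    (hasFDerivAt_const (0 : ℝ) c).congr_of_eventuallyEq (hn.mono fun s hs => hs b)
  have h5 := congrArg (fun L : G →L[ℝ] ℝ => L a) (h3.unique h4)
  simp only [add_apply, ContinuousLinearMap.comp_apply, ContinuousLinearMap.prod_apply,
    ContinuousLinearMap.flip_apply, zero_apply] at h5
  have h6 := hH.conn_eq hℓ hz (fderiv ℝ f c a) (fderiv ℝ f c b)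
  have e1 : ((0, fderiv ℝ W c a + sprayConn H (f c, W c) (fderiv ℝ f c a)) : E × E) =
      (fderiv ℝ f c a, fderiv ℝ W c a) - (fderiv ℝ f c a, 0)
        + (0, sprayConn H (f c, W c) (fderiv ℝ f c a)) := by simp
  rw [e1, map_add, map_sub, add_apply, sub_apply, h6, secondFundForm]
  linarith

omit [FiniteDimensional ℝ E] [FiniteDimensional ℝ G] in
theorem IsConicPotential.secondFundForm_symm (hℓ : IsConicPotential ℓ U) {f : G → E} {c : G}
    (hf : ContDiffAt ℝ 2 f c) {y : E} (hz : (f c, y) ∈ U) (a b : G) :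
    secondFundForm ℓ H f c y a b = secondFundForm ℓ H f c y b a := by
  have h := (hf.isSymmSndFDerivAt (by simp)) a b
  rw [secondFundForm, secondFundForm, h,
    thirdDeriv_comm₂₃ hℓ.isOpen hℓ.contDiffOn hz _ (0, fderiv ℝ f c a)]
  ring

-- Implicit function theorem with the ansatz W = y + f'(c) α, correcting y by tangent vectors only.
-- The partial derivative in α is the Gram form of the tangent space, which is invertible by
-- positivity.
omit [FiniteDimensional ℝ E] in
set_option maxSynthPendingDepth 4 in
theorem IsConicPotential.exists_normal_field (hℓ : IsConicPotential ℓ U) {f : G → E} {c : G}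
    (hf : ContDiffAt ℝ 2 f c) {y : E} (hz : (f c, y) ∈ U)
    (hpos : ∀ a, a ≠ 0 → 0 < secondDeriv ℓ (f c, y) (0, fderiv ℝ f c a) (0, fderiv ℝ f c a))
    (hy : ∀ b, fderiv ℝ ℓ (f c, y) (0, fderiv ℝ f c b) = 0) :
    ∃ W : G → E, ContDiffAt ℝ 1 W c ∧ W c = y ∧
      ∀ᶠ s in 𝓝 c, ∀ b, fderiv ℝ ℓ (f s, W s) (0, fderiv ℝ f s b) = 0 := by
  let D : G →L[ℝ] E := fderiv ℝ f c
  let Φ : G × G → G →L[ℝ] ℝ := fun u =>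
    (fderiv ℝ ℓ (f u.1, y + D u.2)).comp ((ContinuousLinearMap.inr ℝ E E).comp (fderiv ℝ f u.1))
  have hfu : ContDiffAt ℝ 2 (fun u : G × G => f u.1) (c, 0) :=
    ContDiffAt.comp (c, (0 : G)) (g := f) (f := Prod.fst) hf contDiffAt_fst
  have hf'u : ContDiffAt ℝ 1 (fun u : G × G => fderiv ℝ f u.1) (c, 0) :=
    ContDiffAt.comp (c, (0 : G)) (g := fderiv ℝ f) (f := Prod.fst)
      (hf.fderiv_right (m := 1) (by norm_num)) contDiffAt_fst
  have hcz : ContDiffAt ℝ 1 (fun u : G × G => (f u.1, y + D u.2)) (c, 0) :=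
    (hfu.of_le (by norm_num)).prodMk
      (contDiffAt_const.add (D.contDiff.contDiffAt.comp _ contDiffAt_snd))
  have hz0 : (f c, y + D 0) ∈ U := by simpa using hz
  have hℓ' : ContDiffAt ℝ 1 (fderiv ℝ ℓ) (f c, y + D 0) :=
    ((contDiffOn_fderiv_five hℓ.isOpen hℓ.contDiffOn).contDiffAt
      (hℓ.isOpen.mem_nhds hz0)).of_le (by norm_num)
  have hΦ : ContDiffAt ℝ 1 Φ (c, 0) :=
    (ContDiffAt.comp (c, (0 : G)) (g := fderiv ℝ ℓ) hℓ' hcz).clm_comp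
      (contDiffAt_const.clm_comp hf'u)
  have hpart : ∀ α b, fderiv ℝ Φ (c, 0) (0, α) b = secondDeriv ℓ (f c, y) (0, D α) (0, D b) := by
    intro α b
    have h1 : HasDerivAt (fun r : ℝ => ((c, r • α) : G × G)) (0, α) 0 := by
      have := (hasDerivAt_const (0 : ℝ) c).prodMk ((hasDerivAt_id (0 : ℝ)).smul_const α)
      simpa using this
    have h2 : HasFDerivAt Φ (fderiv ℝ Φ (c, 0)) ((fun r : ℝ => ((c, r • α) : G × G)) 0) := by
      simpa using (hΦ.differentiableAt (by norm_num)).hasFDerivAt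
    have h3' : HasDerivAt (fun r : ℝ => Φ (c, r • α)) (fderiv ℝ Φ (c, 0) (0, α)) 0 :=
      HasFDerivAt.comp_hasDerivAt (l := Φ) (l' := fderiv ℝ Φ (c, 0))
        (f := fun r : ℝ => ((c, r • α) : G × G)) (0 : ℝ) h2 h1
    have h3 := h3'.clm_apply (hasDerivAt_const (0 : ℝ) b)
    have h4 : HasDerivAt (fun r : ℝ => ((f c, y + D (r • α)) : E × E)) (0, D α) 0 := by
      have := (hasDerivAt_const (0 : ℝ) (f c)).prodMk
        (((hasDerivAt_id (0 : ℝ)).smul_const (D α)).const_add y)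
      simpa using this
    have h5 : HasFDerivAt (fderiv ℝ ℓ) (secondDeriv ℓ (f c, y))
        ((fun r : ℝ => ((f c, y + D (r • α)) : E × E)) 0) := by
      simpa using hasFDerivAt_fderiv hℓ.isOpen hℓ.contDiffOn hz
    have h6' : HasDerivAt (fun r : ℝ => fderiv ℝ ℓ (f c, y + D (r • α)))
        (secondDeriv ℓ (f c, y) (0, D α)) 0 := HasFDerivAt.comp_hasDerivAt (0 : ℝ) h5 h4
    have h6 := h6'.clm_apply
      (hasDerivAt_const (0 : ℝ) ((0, D b) : E × E))
    have h7 := h3.unique h6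
    simpa using h7
  have hinv : (fderiv ℝ Φ (c, 0) ∘L ContinuousLinearMap.inr ℝ G G).IsInvertible := by
    refine ContinuousLinearMap.isInvertible_of_injective _ (fun α hα => ?_)
      (finrank_continuousDual G).symm
    by_contra hne
    have h1 := hpos α hne
    have h2 := congrArg (fun L : G →L[ℝ] ℝ => L α) hα
    simp only [ContinuousLinearMap.comp_apply, ContinuousLinearMap.inr_apply, zero_apply] at h2
    rw [hpart] at h2
    exact h1.ne' h2
  have hne : (1 : WithTop ℕ∞) ≠ 0 := by norm_num
  refine ⟨fun s => y + D (hΦ.implicitFunction hne hinv s), ?_, ?_, ?_⟩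
  · exact contDiffAt_const.add (D.contDiff.contDiffAt.comp _
      (hΦ.contDiffAt_implicitFunction hne hinv))
  · have := hΦ.implicitFunction_apply_self hne hinv
    simp only at this
    simp [this]
  · have hΦ0 : Φ (c, 0) = 0 := by
      ext b
      simpa [Φ] using! hy b
    filter_upwards [hΦ.eventually_apply_implicitFunction hne hinv] with s hs b
    rw [hΦ0] at hs
    exact congrArg (fun L : G →L[ℝ] ℝ => L b) hs

end NormalFields

/-! ### The embedded submanifold in charts. -/

section Embeddings

open Filter

variable {n k : ℕ} {M : Type*} [TopologicalSpace M] [ChartedSpace (Vec n) M]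
  [IsManifold (𝓡 n) 7 M] {P : Type*} [TopologicalSpace P] [ChartedSpace (Vec k) P]
  [IsManifold (𝓡 k) 7 P] {ι : P → M}

-- In the charts of the immersion normal form ι is x ↦ (x, 0), and projecting to the first factor
-- inverts it. The purpose is injectivity of the differential of ι.
omit [IsManifold (𝓡 n) 7 M] [IsManifold (𝓡 k) 7 P] in
theorem Manifold.IsSmoothEmbedding.exists_local_left_inverse
    (hι : Manifold.IsSmoothEmbedding (𝓡 k) (𝓡 n) 7 ι) (p : P) :
    ∃ ρ : M → P, MDifferentiableAt (𝓡 n) (𝓡 k) ρ (ι p) ∧ ρ ∘ ι =ᶠ[𝓝 p] id := by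
  have h := hι.isImmersion.isImmersionAt p
  have hw := h.writtenInCharts
  have hleft : ∀ x ∈ h.domChart.source, h.codChart (ι x) = h.equiv (h.domChart x, 0) := by
    intro x hx
    have := hw (x := h.domChart x) (by simpa using h.domChart.map_source hx)
    simpa [h.domChart.left_inv hx] using this
  refine ⟨fun y => h.domChart.symm (h.equiv.symm (h.codChart y)).1, ?_, ?_⟩
  · have h1 : MDifferentiableAt (𝓡 n) (𝓡 n) h.codChart (ι p) :=
      (contMDiffAt_of_mem_maximalAtlas h.codChart_mem_maximalAtlas
        h.mem_codChart_source).mdifferentiableAt (by norm_num)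
    have h2 : MDifferentiableAt (𝓡 n) (𝓡 k) (fun w : Vec n => (h.equiv.symm w).1)
        (h.codChart (ι p)) :=
      ((ContinuousLinearMap.fst ℝ (Vec k) h.complement).comp
        (h.equiv.symm : Vec n →L[ℝ] Vec k × h.complement)).mdifferentiableAt
    have hp : (h.equiv.symm (h.codChart (ι p))).1 = h.domChart p := by
      rw [hleft p h.mem_domChart_source]
      simp
    have h3 : MDifferentiableAt (𝓡 k) (𝓡 k) h.domChart.symm
        (h.equiv.symm (h.codChart (ι p))).1 := by
      rw [hp]
      exact (contMDiffAt_symm_of_mem_maximalAtlas h.domChart_mem_maximalAtlas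
        (h.domChart.map_source h.mem_domChart_source)).mdifferentiableAt (by norm_num)
    exact h3.comp (ι p) (h2.comp (ι p) h1)
  · filter_upwards [h.domChart.open_source.mem_nhds h.mem_domChart_source] with x hx
    simp only [Function.comp_apply, id]
    rw [hleft x hx]
    simp [h.domChart.left_inv hx]

omit [IsManifold (𝓡 n) 7 M] [IsManifold (𝓡 k) 7 P] in
theorem Manifold.IsSmoothEmbedding.mfderiv_eq_zero
    (hι : Manifold.IsSmoothEmbedding (𝓡 k) (𝓡 n) 7 ι) (p : P) (a : TangentSpace (𝓡 k) p)
    (ha : mfderiv (𝓡 k) (𝓡 n) ι p a = 0) : a = 0 := by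
  obtain ⟨ρ, hρ, hρι⟩ := hι.exists_local_left_inverse p
  have h1 := mfderiv_comp p hρ ((hι.contMDiff p).mdifferentiableAt (by norm_num))
  rw [hρι.mfderiv_eq, mfderiv_id] at h1
  have h2 := congrArg (fun L : Vec k →L[ℝ] Vec k => L a) h1
  refine Eq.trans h2 ?_
  exact (congrArg (mfderiv (𝓡 n) (𝓡 k) ρ (ι p)) ha).trans (map_zero _)

/-- The map `ι` in the charts around `p` and `ι p`. -/
def chartMap (ι : P → M) (p : P) : Vec k → Vec n :=
  extChartAt (𝓡 n) (ι p) ∘ ι ∘ (extChartAt (𝓡 k) p).symm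

omit [IsManifold (𝓡 n) 7 M] [IsManifold (𝓡 k) 7 P] in
theorem chartMap_apply {p x : P} (hx : x ∈ (extChartAt (𝓡 k) p).source) :
    chartMap (n := n) ι p (extChartAt (𝓡 k) p x) = extChartAt (𝓡 n) (ι p) (ι x) := by
  simp only [chartMap, Function.comp_apply]
  rw [(extChartAt (𝓡 k) p).left_inv hx]

variable (hι : Manifold.IsSmoothEmbedding (𝓡 k) (𝓡 n) 7 ι)
include hι

omit [IsManifold (𝓡 n) 7 M] [IsManifold (𝓡 k) 7 P] in
theorem contDiffAt_chartMap (p : P) :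
    ContDiffAt ℝ 7 (chartMap (n := n) ι p) (extChartAt (𝓡 k) p p) := by
  have h := (contMDiffAt_iff.1 (hι.contMDiff p)).2
  simpa [chartMap] using! h

theorem fderiv_chartMap {p x : P} (hx : x ∈ (extChartAt (𝓡 k) p).source)
    (hx' : ι x ∈ (extChartAt (𝓡 n) (ι p)).source) (b : Vec k) :
    fderiv ℝ (chartMap (n := n) ι p) (extChartAt (𝓡 k) p x) b =
      tangentCoordChange (𝓡 n) (ι x) (ι p) (ι x) (tangentComp (ι x)
        (mfderiv (𝓡 k) (𝓡 n) ι x ((tangentComp x).symm (tangentCoordChange (𝓡 k) p x x b)))) := by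
  have hxx := mem_extChartAt_source (I := 𝓡 k) x
  have hιx := mem_extChartAt_source (I := 𝓡 n) (ι x)
  have h1 := ((contDiffAt_chartChange (n := k) hx hxx).differentiableAt (by norm_num)).hasFDerivAt
  rw [fderiv_chartChange] at h1
  obtain ⟨B, hB⟩ : ∃ B : Vec k →L[ℝ] Vec n, B = mfderiv (𝓡 k) (𝓡 n) ι x := ⟨_, rfl⟩
  have h2 : HasFDerivAt (chartMap (n := n) ι x) B (extChartAt (𝓡 k) x x) := by
    have := (((hι.contMDiff x).mdifferentiableAt (by norm_num)).hasMFDerivAt).2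
    rw [← hasFDerivWithinAt_univ]
    rw [hB]
    simpa [chartMap, writtenInExtChartAt] using! this
  have h3 := ((contDiffAt_chartChange (n := n) hιx hx').differentiableAt
    (by norm_num)).hasFDerivAt
  rw [fderiv_chartChange] at h3
  have e1 : (extChartAt (𝓡 k) x ∘ (extChartAt (𝓡 k) p).symm) (extChartAt (𝓡 k) p x) =
      extChartAt (𝓡 k) x x := by
    simp only [Function.comp_apply]
    rw [(extChartAt (𝓡 k) p).left_inv hx]
  have h4 : HasFDerivAt (chartMap (n := n) ι x ∘
      (extChartAt (𝓡 k) x ∘ (extChartAt (𝓡 k) p).symm))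
      (B.comp (tangentCoordChange (𝓡 k) p x x)) (extChartAt (𝓡 k) p x) := by
    rw [← e1] at h2
    exact h2.comp _ h1
  have e2 : (chartMap (n := n) ι x ∘ (extChartAt (𝓡 k) x ∘ (extChartAt (𝓡 k) p).symm))
      (extChartAt (𝓡 k) p x) = extChartAt (𝓡 n) (ι x) (ι x) := by
    rw [Function.comp_apply, e1, chartMap_apply hxx]
  have h5 : HasFDerivAt ((extChartAt (𝓡 n) (ι p) ∘ (extChartAt (𝓡 n) (ι x)).symm) ∘
      (chartMap (n := n) ι x ∘ (extChartAt (𝓡 k) x ∘ (extChartAt (𝓡 k) p).symm)))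
      ((tangentCoordChange (𝓡 n) (ι x) (ι p) (ι x)).comp
        (B.comp (tangentCoordChange (𝓡 k) p x x))) (extChartAt (𝓡 k) p x) := by
    rw [← e2] at h3
    exact h3.comp _ h4
  have h6 : chartMap (n := n) ι p =ᶠ[𝓝 (extChartAt (𝓡 k) p x)]
      (extChartAt (𝓡 n) (ι p) ∘ (extChartAt (𝓡 n) (ι x)).symm) ∘
      (chartMap (n := n) ι x ∘ (extChartAt (𝓡 k) x ∘ (extChartAt (𝓡 k) p).symm)) := by
    have hc : ContinuousAt (extChartAt (𝓡 k) p).symm (extChartAt (𝓡 k) p x) :=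
      continuousAt_extChartAt_symm' hx
    have e0 : (extChartAt (𝓡 k) p).symm (extChartAt (𝓡 k) p x) = x :=
      (extChartAt (𝓡 k) p).left_inv hx
    have hs1 : ∀ᶠ s in 𝓝 (extChartAt (𝓡 k) p x),
        (extChartAt (𝓡 k) p).symm s ∈ (extChartAt (𝓡 k) x).source :=
      hc ((isOpen_extChartAt_source x).mem_nhds (by rw [e0]; exact hxx))
    have hs2 : ∀ᶠ s in 𝓝 (extChartAt (𝓡 k) p x),
        ι ((extChartAt (𝓡 k) p).symm s) ∈ (extChartAt (𝓡 n) (ι x)).source := by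
      refine (ContinuousAt.comp (g := ι) hι.contMDiff.continuous.continuousAt hc)
        ((isOpen_extChartAt_source (ι x)).mem_nhds ?_)
      rw [Function.comp_apply, e0]
      exact hιx
    filter_upwards [hs1, hs2] with s h1s h2s
    simp only [Function.comp_apply]
    rw [chartMap_apply h1s, (extChartAt (𝓡 n) (ι x)).left_inv h2s]
    rfl
  rw [(h5.congr_of_eventuallyEq h6).fderiv, hB]
  rfl

omit [IsManifold (𝓡 n) 7 M] [IsManifold (𝓡 k) 7 P] in
theorem mem_tangentSet_iff {x : P} {w : TangentSpace (𝓡 n) (ι x)} :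
    (⟨ι x, w⟩ : TangentBundle (𝓡 n) M) ∈ tangentSet k ι ↔
      ∃ a : TangentSpace (𝓡 k) x, mfderiv (𝓡 k) (𝓡 n) ι x a = w := by
  constructor
  · rintro ⟨⟨x', a⟩, h⟩
    have h1 : ι x' = ι x := congrArg Bundle.TotalSpace.proj h
    obtain rfl := hι.isEmbedding.injective h1
    refine ⟨a, ?_⟩
    simpa [tangentMap] using h
  · rintro ⟨a, rfl⟩
    exact ⟨⟨x, a⟩, rfl⟩

namespace PseudoFinslerMetric

variable {F : PseudoFinslerMetric n M}

/-- Normality at all points near p is read in the fixed charts around p and ι p, as needed to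
differentiate it. -/
theorem normal_iff {p x : P} (hx : x ∈ (extChartAt (𝓡 k) p).source)
    (hx' : ι x ∈ (extChartAt (𝓡 n) (ι p)).source) {v : TangentBundle (𝓡 n) M} (hv : v.proj = ι x)
    (hvA : v ∈ F.A) :
    v ∈ F.normalBundle k ι ↔ ∀ b, fderiv ℝ (F.localL (ι p)) (tangentChart (ι p) v)
      (0, fderiv ℝ (chartMap (n := n) ι p) (extChartAt (𝓡 k) p x) b) = 0 := by
  obtain ⟨_, y⟩ := v
  subst hv
  have hz := tangentChart_mem_chartDomain hvA hx'
  have hg : ∀ w : TangentSpace (𝓡 n) (ι x), F.g ⟨ι x, y⟩ y w = 1 / 2 * fderiv ℝ (F.localL (ι p))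
      (tangentChart (ι p) ⟨ι x, y⟩)
      (0, tangentCoordChange (𝓡 n) (ι x) (ι p) (ι x) (tangentComp (ι x) w)) := fun w =>
    (g_eq hvA hx' y w).trans (congrArg (fun r => 1 / 2 * r)
      ((isConicPotential (ι p)).secondDeriv_self hz _))
  have hxx := mem_extChartAt_source (I := 𝓡 k) x
  constructor
  · intro h b
    have h1 := h.2.2 (mfderiv (𝓡 k) (𝓡 n) ι x
      ((tangentComp x).symm (tangentCoordChange (𝓡 k) p x x b))) ((mem_tangentSet_iff hι).2 ⟨_, rfl⟩)
    have h2 := (hg _).symm.trans h1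
    rw [fderiv_chartMap hι hx hx']
    linarith
  · refine fun h => ⟨hvA, mem_range_self x, fun w hw => ?_⟩
    obtain ⟨a, rfl⟩ := (mem_tangentSet_iff hι).1 hw
    have h1 := h (tangentCoordChange (𝓡 k) x p x (tangentComp x a))
    rw [fderiv_chartMap hι hx hx', tangentCoordChange_left_inv hxx hx] at h1
    refine (hg _).trans ?_
    rw [ContinuousLinearEquiv.symm_apply_apply] at h1
    rw [h1, mul_zero]

end PseudoFinslerMetric

end Embeddings

/-! ### Normal extensions and the shape operator on the manifold. -/

section ShapeOperator

open Filter

variable {n k : ℕ} {M : Type*} [TopologicalSpace M] [ChartedSpace (Vec n) M]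
  [IsManifold (𝓡 n) 7 M] {P : Type*} [TopologicalSpace P] [ChartedSpace (Vec k) P]
  [IsManifold (𝓡 k) 7 P] {ι : P → M}

namespace PseudoFinslerMetric

variable {F : PseudoFinslerMetric n M}

theorem g_eq_self {v : TangentBundle (𝓡 n) M} (hv : v ∈ F.A) (u w : TangentSpace (𝓡 n) v.proj) :
    F.g v u w = (1 / 2) * secondDeriv (F.localL v.proj) (tangentChart v.proj v)
      (0, tangentComp v.proj u) (0, tangentComp v.proj w) := by
  have hp := mem_extChartAt_source (I := 𝓡 n) v.proj
  have e : ∀ a : TangentSpace (𝓡 n) v.proj, tangentCoordChange (𝓡 n) v.proj v.proj v.proj a =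
      tangentComp v.proj a := fun a => tangentCoordChange_self hp
  refine (g_eq hv hp u w).trans ?_
  exact congrArg₂ (fun a b : Vec n => 1 / 2 * secondDeriv (F.localL v.proj) (tangentChart v.proj v)
    (0, a) (0, b)) (e u) (e w)

variable (hι : Manifold.IsSmoothEmbedding (𝓡 k) (𝓡 n) 7 ι)
include hι

omit [IsManifold (𝓡 n) 7 M] [IsManifold (𝓡 k) 7 P] in
theorem eventually_normal_iff (p : P) : ∀ᶠ s in 𝓝 (extChartAt (𝓡 k) p p),
    s ∈ (extChartAt (𝓡 k) p).target ∧
      ι ((extChartAt (𝓡 k) p).symm s) ∈ (extChartAt (𝓡 n) (ι p)).source := by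
  have h1 : ∀ᶠ s in 𝓝 (extChartAt (𝓡 k) p p), s ∈ (extChartAt (𝓡 k) p).target :=
    extChartAt_target_mem_nhds p
  have h2 : ContinuousAt (fun s => ι ((extChartAt (𝓡 k) p).symm s)) (extChartAt (𝓡 k) p p) :=
    ContinuousAt.comp (g := ι) hι.contMDiff.continuous.continuousAt (continuousAt_extChartAt_symm p)
  refine h1.and (h2.eventually ((isOpen_extChartAt_source (ι p)).mem_nhds ?_))
  simp only [extChartAt_to_inv]
  exact mem_extChartAt_source _

omit hι [IsManifold (𝓡 n) 7 M] [IsManifold (𝓡 k) 7 P] in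
theorem chartMap_self (p : P) :
    chartMap (n := n) (k := k) ι p (extChartAt (𝓡 k) p p) = extChartAt (𝓡 n) (ι p) (ι p) :=
  chartMap_apply (mem_extChartAt_source _)

theorem fderiv_chartMap_self (p : P) (b : Vec k) :
    fderiv ℝ (chartMap (n := n) ι p) (extChartAt (𝓡 k) p p) b =
      tangentComp (ι p) (mfderiv (𝓡 k) (𝓡 n) ι p ((tangentComp p).symm b)) := by
  rw [fderiv_chartMap hι (mem_extChartAt_source p) (mem_extChartAt_source (ι p)),
    tangentCoordChange_self (mem_extChartAt_source p),
    tangentCoordChange_self (mem_extChartAt_source (ι p))]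

/-- In the charts around p and ι p the extension V becomes a normal field W, to which
`secondDeriv_nabla_normal` applies; the right-hand side no longer involves V. -/
theorem g_nablaAlong {p : P} {y : TangentSpace (𝓡 n) (ι p)} {V : P → TangentBundle (𝓡 n) M}
    (hvA : (⟨ι p, y⟩ : TangentBundle (𝓡 n) M) ∈ F.A)
    (hV : F.IsNormalExtension k ι ⟨ι p, y⟩ p V) (a b : Vec k) :
    F.g ⟨ι p, y⟩ (F.nablaAlong k ι ⟨ι p, y⟩ p V ((tangentComp p).symm a))
      (mfderiv (𝓡 k) (𝓡 n) ι p ((tangentComp p).symm b)) =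
    (1 / 2) * secondFundForm (F.localL (ι p)) (F.spray (ι p)) (chartMap (n := n) ι p)
      (extChartAt (𝓡 k) p p) (tangentComp (ι p) y) a b := by
  set c := extChartAt (𝓡 k) p p with hc
  set f : Vec k → Vec n := chartMap (n := n) ι p with hf
  let W : Vec k → Vec n := fun s => (tangentChart (ι p) (V ((extChartAt (𝓡 k) p).symm s))).2
  have hp := mem_extChartAt_source (I := 𝓡 n) (ι p)
  have hself : tangentChart (ι p) (⟨ι p, y⟩ : TangentBundle (𝓡 n) M) =
      (extChartAt (𝓡 n) (ι p) (ι p), tangentComp (ι p) y) := tangentChart_self ⟨ι p, y⟩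
  have hWc : W c = tangentComp (ι p) y := by
    have e : W c = (tangentChart (ι p) (V p)).2 := by
      simp only [W, hc, extChartAt_to_inv]
    rw [e, hV.value, hself]
  have hfc : f c = extChartAt (𝓡 n) (ι p) (ι p) := chartMap_self p
  have hzc : (f c, W c) = tangentChart (ι p) (⟨ι p, y⟩ : TangentBundle (𝓡 n) M) := by
    rw [hself, hfc, hWc]
  have hzU : (f c, W c) ∈ F.chartDomain (ι p) := by
    rw [hzc]
    exact tangentChart_mem_chartDomain hvA hp
  have hVp : (V p).proj ∈ (extChartAt (𝓡 n) (ι p)).source := by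
    rw [hV.proj_eq]
    exact hp
  have hVc : ContMDiffAt (𝓡 k) 𝓘(ℝ, Vec n × Vec n) 1 (fun x => tangentChart (ι p) (V x)) p :=
    contMDiffWithinAt_tangentChart (by norm_num) hV.smooth hVp
  have hW' : ContMDiffAt (𝓡 k) 𝓘(ℝ, Vec n) 1 (fun x => (tangentChart (ι p) (V x)).2) p :=
    ContMDiffAt.comp p (g := Prod.snd) (contDiff_snd.contMDiff.contMDiffAt) hVc
  have hWd : DifferentiableAt ℝ W c := by
    have h := (contMDiffAt_iff.1 hW').2
    have h' : ContDiffAt ℝ 1 W c := by simpa [W, Function.comp_def] using! h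
    exact h'.differentiableAt (by norm_num)
  have hmf : ∀ a : Vec k, NormedSpace.fromTangentSpace _ (mfderiv (𝓡 k) 𝓘(ℝ, Vec n)
      (fun x => (tangentChart (ι p) (V x)).2) p ((tangentComp p).symm a)) = fderiv ℝ W c a := by
    intro a
    have h := (hW'.mdifferentiableAt (by norm_num)).mfderiv
    rw [h]
    have e : writtenInExtChartAt (𝓡 k) 𝓘(ℝ, Vec n) p (fun x => (tangentChart (ι p) (V x)).2) = W := by
      rw [writtenInExtChartAt, extChartAt_model_space_eq_id]
      rfl
    rw [e]
    simp [fderivWithin_univ, hc]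
    rfl
  have hn : ∀ᶠ s in 𝓝 c, ∀ b, fderiv ℝ (F.localL (ι p)) (f s, W s) (0, fderiv ℝ f s b) = 0 := by
    have h1 : ∀ᶠ s in 𝓝 c, V ((extChartAt (𝓡 k) p).symm s) ∈ F.normalBundle k ι := by
      have h2 : Tendsto (extChartAt (𝓡 k) p).symm (𝓝 c) (𝓝 p) := by
        have := continuousAt_extChartAt_symm (I := 𝓡 k) p
        rwa [ContinuousAt, extChartAt_to_inv] at this
      exact h2.eventually hV.normal
    filter_upwards [h1, eventually_normal_iff hι p] with s hs1 hs2
    have hx := (extChartAt (𝓡 k) p).map_target hs2.1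
    have h3 := (normal_iff hι hx hs2.2 (hV.proj_eq _) hs1.1).1 hs1
    rw [(extChartAt (𝓡 k) p).right_inv hs2.1] at h3
    have e : tangentChart (ι p) (V ((extChartAt (𝓡 k) p).symm s)) = (f s, W s) := by
      refine Prod.ext ?_ rfl
      change extChartAt (𝓡 n) (ι p) (V _).proj = _
      rw [hV.proj_eq]
      rfl
    rw [e] at h3
    exact h3
  have key := (isSpray (F := F) (ι p)).secondDeriv_nabla_normal (isConicPotential (ι p))
    ((contDiffAt_chartMap hι p).of_le (by norm_num)) hWd hzU hn a b
  refine (g_eq_self hvA _ _).trans ?_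
  rw [← hWc, ← key]
  have e1 : tangentComp (ι p) (F.nablaAlong k ι ⟨ι p, y⟩ p V ((tangentComp p).symm a)) =
      fderiv ℝ W c a + sprayConn (F.spray (ι p)) (f c, W c) (fderiv ℝ f c a) := by
    rw [hzc, fderiv_chartMap_self hι]
    refine Eq.trans ?_ (congrArg (fderiv ℝ W c a + ·) (chernTerm_self hvA _))
    exact congrArg (· + _) (hmf a)
  have e2 : tangentComp (ι p) (mfderiv (𝓡 k) (𝓡 n) ι p ((tangentComp p).symm b)) =
      fderiv ℝ f c b := (fderiv_chartMap_self hι p b).symm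
  rw [hzc]
  rw [hzc] at e1
  exact congrArg₂ (fun a b : Vec n => 1 / 2 * secondDeriv (F.localL (ι p))
    (tangentChart (ι p) (⟨ι p, y⟩ : TangentBundle (𝓡 n) M)) (0, a) (0, b)) e1 e2

theorem exists_normalExtension {p : P} {y : TangentSpace (𝓡 n) (ι p)}
    (hv : (⟨ι p, y⟩ : TangentBundle (𝓡 n) M) ∈ F.normalBundle k ι)
    (hpos : ∀ u : TangentSpace (𝓡 n) (ι p), u ≠ 0 → 0 < F.g ⟨ι p, y⟩ u u) :
    ∃ V, F.IsNormalExtension k ι ⟨ι p, y⟩ p V := by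
  set c := extChartAt (𝓡 k) p p with hc
  set f : Vec k → Vec n := chartMap (n := n) ι p with hf
  have hp := mem_extChartAt_source (I := 𝓡 n) (ι p)
  have hpp := mem_extChartAt_source (I := 𝓡 k) p
  have hself : tangentChart (ι p) (⟨ι p, y⟩ : TangentBundle (𝓡 n) M) =
      (f c, tangentComp (ι p) y) :=
    (tangentChart_self ⟨ι p, y⟩).trans (Prod.ext (chartMap_self p).symm rfl)
  have hzU : (f c, tangentComp (ι p) y) ∈ F.chartDomain (ι p) := by
    rw [← hself]
    exact tangentChart_mem_chartDomain hv.1 hp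
  have hn := (normal_iff hι hpp hp rfl hv.1).1 hv
  rw [hself] at hn
  have hf2 : ContDiffAt ℝ 7 f c := contDiffAt_chartMap hι p
  obtain ⟨W, hWc, hW, hWn⟩ := (isConicPotential (F := F) (ι p)).exists_normal_field
    (hf2.of_le (by norm_num)) hzU (fun a ha => by
      have h1 := hpos (mfderiv (𝓡 k) (𝓡 n) ι p ((tangentComp p).symm a))
        (fun h => ha ((tangentComp p).symm.injective
          ((hι.mfderiv_eq_zero p _ h).trans (map_zero _).symm)))
      have h2 := g_eq_self hv.1 (mfderiv (𝓡 k) (𝓡 n) ι p ((tangentComp p).symm a))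
        (mfderiv (𝓡 k) (𝓡 n) ι p ((tangentComp p).symm a))
      have h3 := fderiv_chartMap_self hι p a
      have h4 := h1.trans_eq h2
      simp only at h4
      rw [← h3, hself] at h4
      linarith) hn
  let V : P → TangentBundle (𝓡 n) M := fun x => ⟨ι x, (tangentComp (ι x)).symm
    (tangentCoordChange (𝓡 n) (ι p) (ι x) (ι x) (W (extChartAt (𝓡 k) p x)))⟩
  have hVt : ∀ x, ι x ∈ (extChartAt (𝓡 n) (ι p)).source → tangentChart (ι p) (V x) =
      (extChartAt (𝓡 n) (ι p) (ι x), W (extChartAt (𝓡 k) p x)) := fun x hx =>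
    Prod.ext rfl (tangentCoordChange_left_inv hx (mem_extChartAt_source _) _)
  have hsrc : ∀ᶠ x in 𝓝 p, ι x ∈ (extChartAt (𝓡 n) (ι p)).source :=
    hι.contMDiff.continuous.continuousAt ((isOpen_extChartAt_source (ι p)).mem_nhds hp)
  have hVp : V p = ⟨ι p, y⟩ := by
    have h : tangentCoordChange (𝓡 n) (ι p) (ι p) (ι p) (W (extChartAt (𝓡 k) p p)) =
        tangentComp (ι p) y := (tangentCoordChange_self hp).trans hW
    exact congrArg (fun w => (⟨ι p, w⟩ : TangentBundle (𝓡 n) M)) h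
  have hchart : ContMDiffAt (𝓡 k) 𝓘(ℝ, Vec k) 1 (extChartAt (𝓡 k) p) p :=
    contMDiffAt_extChartAt (n := 7) |>.of_le (by norm_num)
  have hWs : ContMDiffAt (𝓡 k) 𝓘(ℝ, Vec n) 1 (fun x => W (extChartAt (𝓡 k) p x)) p :=
    ContMDiffAt.comp p (g := W) hWc.contMDiffAt hchart
  have hιs : ContMDiffAt (𝓡 k) 𝓘(ℝ, Vec n) 1 (fun x => extChartAt (𝓡 n) (ι p) (ι x)) p :=
    ContMDiffAt.comp p (g := extChartAt (𝓡 n) (ι p))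
      ((contMDiffAt_extChartAt (n := 7)).of_le (by norm_num))
      ((hι.contMDiff p).of_le (by norm_num))
  have hpair : ContMDiffAt (𝓡 k) 𝓘(ℝ, Vec n × Vec n) 1
      (fun x => (extChartAt (𝓡 n) (ι p) (ι x), W (extChartAt (𝓡 k) p x))) p :=
    hιs.prodMk_space hWs
  have hVsm : ContMDiffAt (𝓡 k) 𝓘(ℝ, Vec n × Vec n) 1 (fun x => tangentChart (ι p) (V x)) p :=
    hpair.congr_of_eventuallyEq (hsrc.mono fun x hx => hVt x hx)
  refine ⟨V, fun _ => rfl, hVp, ?_, ?_⟩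
  · refine contMDiffWithinAt_of_tangentChart (x₀ := ι p) (by norm_num) hVsm ?_ hp
    rw [nhdsWithin_univ]
    exact hsrc
  · have h1 : ∀ᶠ x in 𝓝 p, ∀ b, fderiv ℝ (F.localL (ι p))
        (f (extChartAt (𝓡 k) p x), W (extChartAt (𝓡 k) p x))
        (0, fderiv ℝ f (extChartAt (𝓡 k) p x) b) = 0 :=
      (continuousAt_extChartAt p).eventually hWn
    have h2 : ∀ᶠ x in 𝓝 p, tangentChart (ι p) (V x) ∈ F.chartDomain (ι p) := by
      refine hVsm.continuousAt ((isConicPotential (F := F) (ι p)).isOpen.mem_nhds ?_)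
      rw [hVp, hself]
      exact hzU
    have h3 : ∀ᶠ x in 𝓝 p, x ∈ (extChartAt (𝓡 k) p).source :=
      extChartAt_source_mem_nhds p
    filter_upwards [h1, h2, h3, hsrc] with x hx1 hx2 hx3 hx4
    have hA : V x ∈ F.A := by
      have h := hx2.2
      rwa [mem_preimage, (tangentChart (n := n) (ι p)).left_inv
        (by rw [tangentChart_source]; exact hx4)] at h
    refine (normal_iff hι hx3 hx4 rfl hA).2 fun b => ?_
    rw [hVt x hx4, ← chartMap_apply hx3]
    exact hx1 b

end PseudoFinslerMetric

end ShapeOperator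

/-- A positive definite form restricts to a nondegenerate form on T, so the functional B z on T is
represented by an element of T. -/
theorem exists_orthogonal_component {n : ℕ} (B : Vec n →ₗ[ℝ] Vec n →ₗ[ℝ] ℝ)
    (hpos : ∀ u, u ≠ 0 → 0 < B u u) (T : Submodule ℝ (Vec n)) (z : Vec n) :
    ∃ w ∈ T, ∀ u ∈ T, B (z - w) u = 0 := by
  let L : T →ₗ[ℝ] Module.Dual ℝ T := B.domRestrict₁₂ T T
  have hinj : Function.Injective L := by
    refine (injective_iff_map_eq_zero _).2 fun w hw => ?_
    by_contra hne
    have h1 := hpos w (by simpa using hne)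
    have h2 := congrArg (fun φ : Module.Dual ℝ T => φ w) hw
    exact h1.ne' (by simpa [L] using! h2)
  have hsurj : Function.Surjective L :=
    (LinearMap.injective_iff_surjective_of_finrank_eq_finrank
      (Subspace.dual_finrank_eq (K := ℝ) (V := T)).symm).1 hinj
  obtain ⟨w, hw⟩ := hsurj ((B z).comp T.subtype)
  refine ⟨w, w.2, fun u hu => ?_⟩
  have h := congrArg (fun φ : Module.Dual ℝ T => φ ⟨u, hu⟩) hw
  have h' : B w u = B z u := by simpa [L] using! h
  rw [map_sub, LinearMap.sub_apply, h', sub_self]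

section SecondFundForm

variable {E : Type*} [NormedAddCommGroup E] [NormedSpace ℝ E]
  {G : Type*} [NormedAddCommGroup G] [NormedSpace ℝ G]

/-- The second fundamental form as a bilinear map. -/
def secondFundFormLin (ℓ : E × E → ℝ) (H : E × E → E) (f : G → E) (c : G) (y : E) :
    G →ₗ[ℝ] G →ₗ[ℝ] ℝ :=
  have e1 : ∀ a b : E, ((0, a + b) : E × E) = (0, a) + (0, b) := fun a b => by simp
  have e2 : ∀ a b : E, ((a + b, 0) : E × E) = (a, 0) + (b, 0) := fun a b => by simp
  have e3 : ∀ (r : ℝ) (a : E), ((0, r • a) : E × E) = r • (0, a) := fun r a => by simp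
  have e4 : ∀ (r : ℝ) (a : E), ((r • a, 0) : E × E) = r • (a, 0) := fun r a => by simp
  LinearMap.mk₂ ℝ (secondFundForm ℓ H f c y)
    (by intro a a' b; simp only [secondFundForm, map_add, e1, e2, add_apply]; ring)
    (by intro r a b
        simp only [secondFundForm, map_smul, e3, e4, smul_apply, smul_eq_mul]; ring)
    (by intro a b b'; simp only [secondFundForm, map_add, e1, e2, add_apply]; ring)
    (by intro r a b
        simp only [secondFundForm, map_smul, e3, e4, smul_apply, smul_eq_mul]; ring)

end SecondFundForm

section ShapeOperator

variable {n k : ℕ} {M : Type*} [TopologicalSpace M] [ChartedSpace (Vec n) M]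
  [IsManifold (𝓡 n) 7 M] {P : Type*} [TopologicalSpace P] [ChartedSpace (Vec k) P]
  {ι : P → M}

namespace PseudoFinslerMetric

variable {F : PseudoFinslerMetric n M}

theorem tanPart_spec {v : TangentBundle (𝓡 n) M}
    (hpos : ∀ u : TangentSpace (𝓡 n) v.proj, u ≠ 0 → 0 < F.g v u u)
    {T : Submodule ℝ (Vec n)} (hT : ∀ w : TangentSpace (𝓡 n) v.proj,
      (⟨v.proj, w⟩ : TangentBundle (𝓡 n) M) ∈ tangentSet k ι ↔ tangentComp v.proj w ∈ T)
    (z : TangentSpace (𝓡 n) v.proj) :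
    (⟨v.proj, F.tanPart k ι v z⟩ : TangentBundle (𝓡 n) M) ∈ tangentSet k ι ∧
    ∀ u : TangentSpace (𝓡 n) v.proj, (⟨v.proj, u⟩ : TangentBundle (𝓡 n) M) ∈ tangentSet k ι →
      F.g v (F.tanPart k ι v z) u = F.g v z u := by
  obtain ⟨w, hwT, hw⟩ := exists_orthogonal_component (F.gForm v) hpos T (tangentComp v.proj z)
  have h := Classical.epsilon_spec (p := fun w : TangentSpace (𝓡 n) v.proj =>
    (⟨v.proj, w⟩ : TangentBundle (𝓡 n) M) ∈ tangentSet k ι ∧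
      ∀ u : TangentSpace (𝓡 n) v.proj, (⟨v.proj, u⟩ : TangentBundle (𝓡 n) M) ∈ tangentSet k ι →
        F.g v (z - w) u = 0) ⟨w, (hT w).2 hwT, fun u hu => hw u ((hT u).1 hu)⟩
  refine ⟨h.1, fun u hu => ?_⟩
  have h1 : F.gForm v (tangentComp v.proj z - tangentComp v.proj (F.tanPart k ι v z))
      (tangentComp v.proj u) = 0 := h.2 u hu
  rw [map_sub, LinearMap.sub_apply] at h1
  exact (sub_eq_zero.1 h1).symm

variable [IsManifold (𝓡 k) 7 P]

/-- The tangent space of `P` and the second fundamental form of `P` in the direction `v`. -/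
theorem exists_shapeOperator_form (hι : Manifold.IsSmoothEmbedding (𝓡 k) (𝓡 n) 7 ι)
    {v : TangentBundle (𝓡 n) M} (hv : v ∈ F.normalBundle k ι)
    (hpos : ∀ u : TangentSpace (𝓡 n) v.proj, u ≠ 0 → 0 < F.g v u u) :
    ∃ (T : Submodule ℝ (Vec n)) (β : Vec n →ₗ[ℝ] Vec n →ₗ[ℝ] ℝ), (∀ a b, β a b = β b a) ∧
      (∀ w : TangentSpace (𝓡 n) v.proj, (⟨v.proj, w⟩ : TangentBundle (𝓡 n) M) ∈ tangentSet k ι ↔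
        tangentComp v.proj w ∈ T) ∧
      ∀ u : TangentSpace (𝓡 n) v.proj, tangentComp v.proj u ∈ T →
        tangentComp v.proj (F.shapeOperator k ι v u) ∈ T ∧
        ∀ w : TangentSpace (𝓡 n) v.proj, tangentComp v.proj w ∈ T →
          F.g v (F.shapeOperator k ι v u) w = β (tangentComp v.proj u) (tangentComp v.proj w) := by
  obtain ⟨x, y⟩ := v
  obtain ⟨p, rfl⟩ : ∃ p, ι p = x := hv.2.1
  obtain ⟨V, hV⟩ := exists_normalExtension hι hv hpos
  obtain ⟨D, hD⟩ : ∃ D : Vec k →L[ℝ] Vec n, D = mfderiv (𝓡 k) (𝓡 n) ι p := ⟨_, rfl⟩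
  have hDinj : Function.Injective (D : Vec k →ₗ[ℝ] Vec n) := by
    refine (injective_iff_map_eq_zero _).2 fun a ha => hι.mfderiv_eq_zero p a ?_
    rw [← hD]
    exact ha
  -- Composition with a left inverse of the differential transports the form σ from the parameter
  -- space to a bilinear form on all of ℝⁿ; only its values on T are used.
  obtain ⟨Q, hQ⟩ := LinearMap.exists_leftInverse_of_injective (D : Vec k →ₗ[ℝ] Vec n)
    (LinearMap.ker_eq_bot.2 hDinj)
  have hQD : ∀ a, Q (D a) = a := fun a => congrArg (fun L : Vec k →ₗ[ℝ] Vec k => L a) hQ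
  let σ := secondFundFormLin (F.localL (ι p)) (F.spray (ι p)) (chartMap (n := n) ι p)
    (extChartAt (𝓡 k) p p) (tangentComp (ι p) y)
  have hσ : ∀ a b, σ a b = σ b a := by
    refine (isConicPotential (F := F) (ι p)).secondFundForm_symm
      ((contDiffAt_chartMap hι p).of_le (by norm_num)) ?_
    rw [chartMap_self]
    exact (tangentChart_self (⟨ι p, y⟩ : TangentBundle (𝓡 n) M)) ▸
      tangentChart_mem_chartDomain hv.1 (mem_extChartAt_source _)
  have hT : ∀ w : TangentSpace (𝓡 n) (ι p), (⟨ι p, w⟩ : TangentBundle (𝓡 n) M) ∈ tangentSet k ι ↔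
      tangentComp (ι p) w ∈ LinearMap.range (D : Vec k →ₗ[ℝ] Vec n) := by
    intro w
    rw [mem_tangentSet_iff hι, hD]
    rfl
  refine ⟨LinearMap.range (D : Vec k →ₗ[ℝ] Vec n), ((1 / 2 : ℝ) • σ).compl₁₂ Q Q, fun a b => ?_,
    hT, fun u hu => ?_⟩
  · simp only [LinearMap.compl₁₂_apply, LinearMap.smul_apply]
    rw [hσ]
  obtain ⟨a, ha⟩ := hu
  have ha' : mfderiv (𝓡 k) (𝓡 n) ι p a = u := by
    rw [← hD]
    exact ha
  have h := Classical.epsilon_spec (p := fun z : TangentSpace (𝓡 n) (ι p) =>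
    ∃ (p' : P) (a : TangentSpace (𝓡 k) p') (V : P → TangentBundle (𝓡 n) M),
      tangentMap (𝓡 k) (𝓡 n) ι ⟨p', a⟩ = ⟨ι p, u⟩ ∧ F.IsNormalExtension k ι ⟨ι p, y⟩ p' V ∧
      z = F.tanPart k ι ⟨ι p, y⟩ (F.nablaAlong k ι ⟨ι p, y⟩ p' V a))
    ⟨_, p, a, V, congrArg (fun w => (⟨ι p, w⟩ : TangentBundle (𝓡 n) M)) ha', hV, rfl⟩
  -- The witnesses hidden in `shapeOperator` need not be p, a and V. Injectivity of ι forces p' = p,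
  -- and independence of the extension makes V' harmless.
  obtain ⟨p', a', V', h1, hV', h2⟩ := h
  obtain rfl : p' = p := hι.isEmbedding.injective (congrArg Bundle.TotalSpace.proj h1)
  have ha'' : mfderiv (𝓡 k) (𝓡 n) ι p' a' = u := by simpa [tangentMap] using h1
  have h3 : F.shapeOperator k ι ⟨ι p', y⟩ u =
    F.tanPart k ι ⟨ι p', y⟩ (F.nablaAlong k ι ⟨ι p', y⟩ p' V' a') := h2
  have h4 := tanPart_spec (v := ⟨ι p', y⟩) hpos hT (F.nablaAlong k ι ⟨ι p', y⟩ p' V' a')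
  simp only
  rw [h3]
  refine ⟨(hT _).1 h4.1, fun w hw => ?_⟩
  have h5 := h4.2 w ((hT w).2 hw)
  obtain ⟨b, hb⟩ := hw
  have hb' : mfderiv (𝓡 k) (𝓡 n) ι p' b = w := by
    rw [← hD]
    exact hb
  have h6 := g_nablaAlong hι hv.1 hV' a' b
  refine h5.trans ?_
  rw [← hb']
  refine h6.trans ?_
  have e1 : Q (tangentComp (ι p') u) = a' := by
    rw [← ha'', ← hD]
    exact hQD a'
  have e2 : Q (tangentComp (ι p') (mfderiv (𝓡 k) (𝓡 n) ι p' b)) = b := by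
    rw [← hD]
    exact hQD b
  rw [LinearMap.compl₁₂_apply, e1, e2]
  rfl

end PseudoFinslerMetric

end ShapeOperator

theorem exists_clm_of_bilin {n : ℕ} (B : Vec n →ₗ[ℝ] Vec n →ₗ[ℝ] ℝ) :
    ∃ S : Vec n →L[ℝ] Vec n, ∀ a b, inner ℝ (S a) b = B a b := by
  let o := EuclideanSpace.basisFun (Fin n) ℝ
  refine ⟨LinearMap.toContinuousLinearMap (∑ i, (B.flip (o i)).smulRight (o i)), fun a b => ?_⟩
  conv_rhs => rw [← o.sum_repr' b]
  simp [sum_inner, inner_smul_left, mul_comm]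

theorem exists_mem_Ioo_of_partition {m : ℕ} {t : ℕ → ℝ} {s : ℝ} (h0 : t 0 < s) (hm : s < t m)
    (hs : ∀ i ≤ m, s ≠ t i) : ∃ i < m, s ∈ Ioo (t i) (t (i + 1)) := by
  induction m with
  | zero => exact absurd (h0.trans hm) (lt_irrefl _)
  | succ m ih =>
    rcases lt_or_gt_of_ne (hs m (Nat.le_succ m)) with h | h
    · obtain ⟨i, hi, hsi⟩ := ih h fun i hi => hs i (hi.trans (Nat.le_succ m))
      exact ⟨i, hi.trans (Nat.lt_succ_self m), hsi⟩
    · exact ⟨m, Nat.lt_succ_self m, h, hm⟩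

/-- Inside a piece `deriv` agrees with the derivative within the closed piece, which is continuous
on a compact interval. The sum of the |Cᵢ| is a common bound for the finitely many pieces. -/
theorem exists_bound_deriv_of_partition {V : Type*} [NormedAddCommGroup V] [NormedSpace ℝ V]
    {m : ℕ} {t : ℕ → ℝ} {x : ℝ → V} (ht : ∀ i < m, t i < t (i + 1))
    (hx : ∀ i < m, ContDiffOn ℝ 1 x (Icc (t i) (t (i + 1)))) :
    ∃ C : ℝ, ∀ s ∈ Ioo (t 0) (t m) \ t '' Iic m, HasDerivAt x (deriv x s) s ∧ ‖deriv x s‖ ≤ C := by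
  have hb : ∀ i : ℕ, ∃ C : ℝ, i < m → ∀ s ∈ Ioo (t i) (t (i + 1)),
      HasDerivAt x (deriv x s) s ∧ ‖deriv x s‖ ≤ C := by
    intro i
    by_cases hi : i < m
    · have hc := (hx i hi).continuousOn_derivWithin (uniqueDiffOn_Icc (ht i hi)) le_rfl
      obtain ⟨C, hC⟩ := isCompact_Icc.exists_bound_of_continuousOn hc
      refine ⟨C, fun _ s hs => ?_⟩
      have hn : Icc (t i) (t (i + 1)) ∈ 𝓝 s := Icc_mem_nhds hs.1 hs.2
      have hd : DifferentiableAt ℝ x s :=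
        (((hx i hi) s (Ioo_subset_Icc_self hs)).differentiableWithinAt
          (by norm_num)).differentiableAt hn
      refine ⟨hd.hasDerivAt, ?_⟩
      rw [← derivWithin_of_mem_nhds hn]
      exact hC s (Ioo_subset_Icc_self hs)
    · exact ⟨0, fun h => absurd h hi⟩
  choose C hC using hb
  refine ⟨∑ i ∈ Finset.range m, |C i|, fun s hs => ?_⟩
  obtain ⟨i, hi, hsi⟩ := exists_mem_Ioo_of_partition hs.1.1 hs.1.2
    fun i hi h => hs.2 ⟨i, hi, h.symm⟩
  refine ⟨(hC i hi s hsi).1, (hC i hi s hsi).2.trans ((le_abs_self _).trans ?_)⟩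
  exact Finset.single_le_sum (f := fun i => |C i|) (fun _ _ => abs_nonneg _)
    (Finset.mem_range.2 hi)

theorem Icc_subset_of_partition {m : ℕ} {t : ℕ → ℝ} (ht : ∀ i < m, t i < t (i + 1)) {i : ℕ}
    (hi : i < m) : Icc (t i) (t (i + 1)) ⊆ Icc (t 0) (t m) := by
  have hmono : ∀ j ≤ m, ∀ i ≤ j, t i ≤ t j := by
    intro j
    induction j with
    | zero => intro _ i hi; rw [Nat.le_zero.1 hi]
    | succ j ih =>
      intro hj i hi
      rcases Nat.le_succ_iff.1 hi with h | h
      · exact (ih (Nat.le_of_succ_le hj) i h).trans (ht j hj).le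
      · rw [h]
  exact Icc_subset_Icc (hmono i hi.le 0 (Nat.zero_le _)) (hmono m le_rfl (i + 1) hi)

/-! ### The index form in a parallel frame, and the conclusion. -/

section Index

open Filter

variable {n k : ℕ} {M : Type*} [TopologicalSpace M] [ChartedSpace (Vec n) M]
  [IsManifold (𝓡 n) 7 M] {F : PseudoFinslerMetric n M} {τ : ℝ} {γ : ℝ → M}

theorem continuousWithinAt_fieldChart {ζ : ∀ t, TangentSpace (𝓡 n) (γ t)} {s : Set ℝ} {t : ℝ}
    (ht : t ∈ s) (h : ContinuousOn (liftField γ ζ) s) :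
    ContinuousWithinAt (fieldChart γ ζ (γ t)) s t := by
  have h0 : IsCrField 0 γ s ζ := by
    rw [IsCrField, Nat.cast_zero, contMDiffOn_zero_iff]
    exact h
  exact (contDiffWithinAt_fieldChart (by norm_num) ht h0 (mem_extChartAt_source _)).continuousWithinAt

namespace PseudoFinslerMetric

variable {E : Fin n → ∀ t, TangentSpace (𝓡 n) (γ t)}

theorem IsParallelFrame.indexIntegrand_eq (hE : F.IsParallelFrame τ γ E) (hγ : F.IsGeodesic τ γ)
    (hτ : 0 < τ) {X : ∀ t, TangentSpace (𝓡 n) (γ t)} {x' : Vec n} {t : ℝ} (ht : t ∈ Icc 0 τ)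
    (hx : HasDerivWithinAt (F.frameCoord τ γ E X) x' (Icc 0 τ) t) :
    F.indexIntegrand τ γ X X t = inner ℝ (F.frameCurv τ γ E t (F.frameCoord τ γ E X t))
      (F.frameCoord τ γ E X t) + inner ℝ x' x' := by
  have h1 := hE.inner_frameCurv hγ (F.frameCoord τ γ E X t) (F.frameCoord τ γ E X t) ht
  have h2 : frameField E (fun _ => F.frameCoord τ γ E X t) t = X t := hE.frameField_frameCoord X ht
  rw [h2] at h1
  rw [h1, indexIntegrand, hE.D_eq hγ hτ ht hx, hE.g_frameField _ _ ht]

theorem IsParallelFrame.isJacobi_frameField (hE : F.IsParallelFrame τ γ E)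
    (hγ : F.IsGeodesic τ γ) (hτ : 0 < τ) {f f₁ : ℝ → Vec n}
    (hf : ∀ t ∈ Icc 0 τ, HasDerivWithinAt f (f₁ t) (Icc 0 τ) t)
    (hf₁ : ∀ t ∈ Icc 0 τ, HasDerivWithinAt f₁ (F.frameCurv τ γ E t (f t)) (Icc 0 τ) t) :
    F.IsJacobi τ γ (frameField E f) ∧
      ∀ t ∈ Icc 0 τ, F.D τ γ (frameField E f) t = frameField E f₁ t := by
  have hD : ∀ t ∈ Icc 0 τ, F.D τ γ (frameField E f) t = frameField E f₁ t := fun t ht =>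
    hγ.D_eq hτ ht (hE.hasCovDerivWithin_frameField Subset.rfl ht (hf t ht))
  refine ⟨⟨hE.isCrField_frameField hγ hτ fun t ht => ?_, fun t ht => ?_⟩, hD⟩
  · have hc : ContinuousOn (fun t => F.frameCurv τ γ E t (f t)) (Icc 0 τ) :=
      (hE.continuousOn_frameCurv hγ hτ).clm_apply fun t ht => (hf t ht).continuousWithinAt
    have h0 : ContDiffWithinAt ℝ (0 : ℕ) (fun t => F.frameCurv τ γ E t (f t)) (Icc 0 τ) t := by
      exact_mod_cast contDiffOn_zero.2 hc t ht
    have h1 := contDiffWithinAt_succ_of_hasDerivWithinAt (m := 0) ht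
      (eventually_nhdsWithin_of_forall hf₁) h0
    exact contDiffWithinAt_succ_of_hasDerivWithinAt (m := 1) ht
      (eventually_nhdsWithin_of_forall hf) h1
  · have h1 : F.D τ γ (F.D τ γ (frameField E f)) t =
        frameField E (fun _ => F.frameCurv τ γ E t (f t)) t :=
      hγ.D_eq hτ ht ((hE.hasCovDerivWithin_frameField Subset.rfl ht (hf₁ t ht)).congr hD ht)
    rw [h1, ← hE.frameField_frameCurv hγ f ht]
    exact sub_self _

variable {P : Type*} [TopologicalSpace P] [ChartedSpace (Vec k) P] [IsManifold (𝓡 k) 7 P]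
  {ι : P → M}

/-- All data are transported by a parallel orthonormal frame to the situation of
`euclidean_index_form_pos`. -/
theorem indexForm_pos_of_not_isFocal (hι : Manifold.IsSmoothEmbedding (𝓡 k) (𝓡 n) 7 ι)
    (hτ : 0 < τ) (hγ : F.IsGeodesic τ γ)
    (hperp : liftField γ (velocity τ γ) 0 ∈ F.normalBundle k ι)
    (hpos : ∀ u : TangentSpace (𝓡 n) (γ 0), u ≠ 0 → 0 < F.g ⟨γ 0, velocity τ γ 0⟩ u u)
    (hfocal : ∀ t ∈ Ioc 0 τ, ¬ F.IsFocal k ι τ γ t) {X : ∀ t, TangentSpace (𝓡 n) (γ t)}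
    (hX : X ∈ pc2Fields k ι τ γ) :
    IntervalIntegrable (F.indexIntegrand τ γ X X) volume 0 τ ∧
      ((∃ t ∈ Icc 0 τ, X t ≠ 0) → 0 < F.indexForm k ι τ γ X X) := by
  have h0 : (0 : ℝ) ∈ Icc 0 τ := left_mem_Icc.2 hτ.le
  obtain ⟨E, hE⟩ := hγ.exists_parallelFrame hτ hpos
  obtain ⟨T, β, hβ, hT, hS⟩ := exists_shapeOperator_form hι hperp hpos
  change ∀ w : TangentSpace (𝓡 n) (γ 0), (⟨γ 0, w⟩ : TangentBundle (𝓡 n) M) ∈ tangentSet k ι ↔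
    tangentComp (γ 0) w ∈ T at hT
  -- E₀ passes from frame components at t = 0 to chart components. Thus T.comap E₀ is T_pP in the
  -- frame, and S represents the pulled-back second fundamental form.
  let E₀ : Vec n →ₗ[ℝ] Vec n :=
    { toFun := fun a => tangentComp (γ 0) (frameField E (fun _ => a) 0)
      map_add' := fun a b => by
        simp only [frameField, PiLp.add_apply, add_smul, Finset.sum_add_distrib, map_add]
      map_smul' := fun c a => by
        simp only [frameField, PiLp.smul_apply, smul_eq_mul, mul_smul, ← Finset.smul_sum,
          map_smul, RingHom.id_apply] }
  have hE₀ : ∀ Y : ∀ t, TangentSpace (𝓡 n) (γ t),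
      E₀ (F.frameCoord τ γ E Y 0) = tangentComp (γ 0) (Y 0) := fun Y =>
    congrArg (tangentComp (γ 0)) (hE.frameField_frameCoord Y h0)
  obtain ⟨S, hSβ⟩ := exists_clm_of_bilin (β.compl₁₂ E₀ E₀)
  simp only [LinearMap.compl₁₂_apply] at hSβ
  have hfoc : ∀ f f₁ : ℝ → Vec n, (∀ t ∈ Icc 0 τ, HasDerivWithinAt f (f₁ t) (Icc 0 τ) t) →
      (∀ t ∈ Icc 0 τ, HasDerivWithinAt f₁ (F.frameCurv τ γ E t (f t)) (Icc 0 τ) t) →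
      f 0 ∈ T.comap E₀ → (∀ w ∈ T.comap E₀, inner ℝ (f₁ 0 - S (f 0)) w = 0) →
      ∀ t₀ ∈ Ioc 0 τ, f t₀ = 0 → ∀ t ∈ Icc 0 τ, f t = 0 := by
    intro f f₁ hf hf₁ hf0 hf0' t₀ ht₀ hft₀
    by_contra! hne
    obtain ⟨t, ht, hft⟩ := hne
    obtain ⟨hJ, hD⟩ := hE.isJacobi_frameField hγ hτ hf hf₁
    have hJ0 : tangentComp (γ 0) (frameField E f 0) ∈ T := hf0
    obtain ⟨hST, hSg⟩ := hS (frameField E f 0) hJ0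
    obtain ⟨hτT, hτg⟩ := tanPart_spec (v := ⟨γ 0, velocity τ γ 0⟩) hpos hT
      (F.D τ γ (frameField E f) 0)
    refine hfocal t₀ ht₀ ⟨frameField E f, ⟨hJ, (hT _).2 hJ0, ?_⟩, ⟨t, ht, fun h => hft ?_⟩, ?_⟩
    -- The tangential part of D J and the shape operator at J(0) both lie in T and have the same
    -- g-products with T; positivity on their difference gives equality.
    · let B := F.gForm ⟨γ 0, velocity τ γ 0⟩
      let a := tangentComp (γ 0) (F.tanPart k ι ⟨γ 0, velocity τ γ 0⟩ (F.D τ γ (frameField E f) 0))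
      let b := tangentComp (γ 0) (F.shapeOperator k ι ⟨γ 0, velocity τ γ 0⟩ (frameField E f 0))
      have hab : ∀ u ∈ T, B a u = B b u := by
        intro u hu
        let U : ∀ t, TangentSpace (𝓡 n) (γ t) := fun t => (tangentComp (γ t)).symm u
        have e1 : B a u = F.g ⟨γ 0, velocity τ γ 0⟩ (F.D τ γ (frameField E f) 0) (U 0) :=
          hτg (U 0) ((hT (U 0)).2 hu)
        have e2 : B b u = β (tangentComp (γ 0) (frameField E f 0)) u := hSg (U 0) hu
        have hU := hE.frameField_frameCoord U h0
        rw [e1, e2, hD 0 h0, ← hU, hE.g_frameField _ _ h0]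
        have hw : E₀ (F.frameCoord τ γ E U 0) = u := hE₀ U
        have h3 := hf0' (F.frameCoord τ γ E U 0) (by rw [Submodule.mem_comap, hw]; exact hu)
        rw [inner_sub_left, sub_eq_zero, hSβ, hw] at h3
        exact h3
      have hmem : a - b ∈ T := T.sub_mem ((hT _).1 hτT) hST
      have hz : B (a - b) (a - b) = 0 := by
        rw [LinearMap.map_sub₂, hab _ hmem, sub_self]
      by_contra hcon
      refine (hpos ((tangentComp (γ 0)).symm (a - b)) fun h => hcon ?_).ne' hz
      have h4 : a - b = 0 := h
      exact (tangentComp (γ 0)).injective (sub_eq_zero.1 h4)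
    · have h5 := hE.frameCoord_frameField f ht
      have h6 := hE.inner_frameCoord (frameField E f) (frameField E f) ht
      rw [h5, h] at h6
      have h7 : F.g ⟨γ t, velocity τ γ t⟩ (0 : TangentSpace (𝓡 n) (γ t)) 0 = 0 :=
        map_zero (F.gForm ⟨γ t, velocity τ γ t⟩ 0)
      rw [h7] at h6
      exact inner_self_eq_zero.1 h6
    · simp [frameField, hft₀]
  obtain ⟨⟨hXc, m, t, ht0, htm, htX⟩, hX0, hXτ⟩ := hX
  have hstep : ∀ i < m, t i < t (i + 1) := fun i hi => (htX i hi).1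
  have hsub : ∀ i < m, Icc (t i) (t (i + 1)) ⊆ Icc 0 τ := fun i hi => by
    have := Icc_subset_of_partition hstep hi
    rwa [ht0, htm] at this
  set x := F.frameCoord τ γ E X with hx
  have hxC : ∀ i < m, ContDiffOn ℝ 1 x (Icc (t i) (t (i + 1))) := fun i hi s hs =>
    hE.contDiffWithinAt_frameCoord hγ hτ (hsub i hi) hs
      ((contDiffWithinAt_fieldChart (by norm_num) hs (htX i hi).2
        (mem_extChartAt_source _)).of_le (by norm_num))
  obtain ⟨C, hC⟩ := exists_bound_deriv_of_partition hstep hxC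
  rw [ht0, htm] at hC
  have hZ : (t '' Iic m).Countable := ((finite_Iic m).image t).countable
  have hxτ : x τ = 0 := by
    have h1 := hE.inner_frameCoord X X (right_mem_Icc.2 hτ.le)
    have h2 : F.g ⟨γ τ, velocity τ γ τ⟩ (0 : TangentSpace (𝓡 n) (γ τ)) 0 = 0 :=
      map_zero (F.gForm ⟨γ τ, velocity τ γ τ⟩ 0)
    rw [hXτ, h2] at h1
    exact inner_self_eq_zero.1 h1
  have hx0 : x 0 ∈ T.comap E₀ := by
    rw [Submodule.mem_comap, hE₀]
    exact (hT _).1 hX0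
  have hmain := euclidean_index_form_pos hτ (hE.continuousOn_frameCurv hγ hτ)
    (fun t ht a b => hE.inner_frameCurv_symm hγ a b ht) (T.comap E₀) S
    (fun a _ b _ => by rw [real_inner_comm _ a, hSβ, hSβ, hβ]) hfoc
    (fun s hs => hE.continuousWithinAt_frameCoord hγ hτ Subset.rfl hs
      (continuousWithinAt_fieldChart hs hXc)) hZ (fun s hs => (hC s hs).1) (fun s hs => (hC s hs).2)
    (stronglyMeasurable_deriv x).aestronglyMeasurable hx0 hxτ
  -- At break points D X carries no meaning, as X may fail to be differentiable there. The two
  -- integrands are compared off this finite set and off τ.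
  have hae : ∀ᵐ s ∂(volume : Measure ℝ), s ∈ Set.uIoc 0 τ →
      inner ℝ (F.frameCurv τ γ E s (x s)) (x s) + inner ℝ (deriv x s) (deriv x s) =
        F.indexIntegrand τ γ X X s := by
    have h1 : ∀ᵐ s ∂(volume : Measure ℝ), s ∉ t '' Iic m :=
      (hZ.measure_zero volume) |> compl_mem_ae_iff.2
    have h2 : ∀ᵐ s ∂(volume : Measure ℝ), s ≠ τ := by
      refine compl_mem_ae_iff.2 (measure_singleton τ)
    filter_upwards [h1, h2] with s hs1 hs2 hs
    rw [uIoc_of_le hτ.le] at hs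
    have hs' : s ∈ Ioo 0 τ := ⟨hs.1, lt_of_le_of_ne hs.2 hs2⟩
    exact (hE.indexIntegrand_eq hγ hτ (Ioo_subset_Icc_self hs')
      (hC s ⟨hs', hs1⟩).1.hasDerivWithinAt).symm
  refine ⟨hmain.1.congr_ae ((ae_restrict_iff' measurableSet_uIoc).2 hae), fun hne => ?_⟩
  obtain ⟨s, hs, hXs⟩ := hne
  have h1 := hmain.2 ⟨s, hs, fun h => hXs ?_⟩
  · rw [intervalIntegral.integral_congr_ae hae, hSβ, hE₀] at h1
    refine h1.trans_eq (congrArg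
      (fun r => (∫ s in (0 : ℝ)..τ, F.indexIntegrand τ γ X X s) + r) ?_)
    exact ((hS (X 0) ((hT _).1 hX0)).2 (X 0) ((hT _).1 hX0)).symm
  · rw [← hE.frameField_frameCoord X hs]
    simp [frameField, h]

end PseudoFinslerMetric

end Index

end

theorem lemma2p15 {n k : ℕ} (hk : k < n)
    {M : Type*} [TopologicalSpace M] [T2Space M] [SecondCountableTopology M] [ConnectedSpace M]
    [ChartedSpace (EuclideanSpace ℝ (Fin n)) M] [IsManifold (𝓡 n) 7 M]
    (F : PseudoFinslerMetric n M)
    {P : Type*} [TopologicalSpace P] [ConnectedSpace P]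
    [ChartedSpace (EuclideanSpace ℝ (Fin k)) P] [IsManifold (𝓡 k) 7 P]
    (ι : P → M) (hι : Manifold.IsSmoothEmbedding (𝓡 k) (𝓡 n) 7 ι)
    (τ : ℝ) (hτ : 0 < τ) (γ : ℝ → M) (hγ : F.IsGeodesic τ γ)
    (hperp : liftField γ (velocity τ γ) 0 ∈ F.normalBundle k ι)
    (hpos : ∀ u : TangentSpace (𝓡 n) (γ 0), u ≠ 0 → 0 < F.g ⟨γ 0, velocity τ γ 0⟩ u u)
    (hfocal : ∀ t ∈ Set.Ioc 0 τ, ¬ F.IsFocal k ι τ γ t) :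
    ∀ X ∈ pc2Fields k ι τ γ,
      IntervalIntegrable (F.indexIntegrand τ γ X X) MeasureTheory.volume 0 τ ∧
      ((∃ t ∈ Set.Icc 0 τ, X t ≠ 0) → 0 < F.indexForm k ι τ γ X X) := by
  exact fun X hX =>
    PseudoFinslerMetric.indexForm_pos_of_not_isFocal hι hτ hγ hperp hpos hfocal hX
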